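/- Let $\mathscr{D}=(D_1,D_2,D_3)$ be a positively oriented tangential triple of open disks in $\mathbb{C}$: $\overline{D_j}\cap\overline{D_k}$ consists of exactly one point for $j\neq k$ (the disks are pairwise externally tangent), and the tangency points $q_1,q_2,q_3$, where $\{q_j\}=\overline{D_k}\cap\overline{D_l}$ for $\{j,k,l\}=\{1,2,3\}$, are in counterclockwise order. Let $T(\mathscr{D})$ be the bounded connected component of $\mathbb{C}\setminus\bigcup_j\overline{D_j}$, let $V_0(\mathscr{D}):=\{q_1,q_2,q_3\}$, and let $D_{\mathrm{in}}(\mathscr{D})$ be the unique open disk contained in $T(\mathscr{D})$ and externally tangent to $D_1,D_2,D_3$. Set $\kappa(\mathscr{D}):=\sqrt{\beta\gamma+\gamma\alpha+\alpha\beta}$, where $\alpha,\beta,\gamma$ are the reciprocals of the radii of $D_1,D_2,D_3$. Let $\Phi_j(\mathscr{D})$ be the triple obtained from $\mathscr{D}$ by replacing $D_j$ with $D_{\mathrm{in}}(\mathscr{D})$, and for a finite word $w=w_1\dots w_m$ in the letters $1,2,3$ (the empty word included) put $\mathscr{D}_w:=\Phi_{w_m}\circ\dots\circ\Phi_{w_1}(\mathscr{D})$.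 The Apollonian gasket is the compact set $K(\mathscr{D}):=\overline{T(\mathscr{D})}\setminus\bigcup_w D_{\mathrm{in}}(\mathscr{D}_w)$, the union being over all finite words $w$. Let $$\mathscr{A}_{\mathscr{D}}:=\{\overline{T(\mathscr{D})}\cap\partial D_j\mid j=1,2,3\}\cup\{\partial D_{\mathrm{in}}(\mathscr{D}_w)\mid w \text{ a finite word}\},\qquad K^0(\mathscr{D}):=\bigcup_{C\in\mathscr{A}_{\mathscr{D}}}C .$$ For $C\in\mathscr{A}_{\mathscr{D}}$ let $\mathrm{rad}(C)$ be the radius of the circle containing $C$, $\mathscr{H}^1_C$ the length measure on $C$, and $\nabla_C$ the gradient along $C$. Define the Borel measure $\mu^{\mathscr{D}}:=\sum_{C\in\mathscr{A}_{\mathscr{D}}}\mathrm{rad}(C)\,\mathscr{H}^1_C(\cdot\cap C)$ on $K(\mathscr{D})$, let $\mathcal{F}_{\mathscr{D}}$ be the set of all $u:K^0(\mathscr{D})\to\mathbb{R}$ such that for each $C\in\mathscr{A}_{\mathscr{D}}$ the restriction $u|_C$ is absolutely continuous with $|\nabla_C u|\in L^2(C,\mathscr{H}^1_C)$, and such that $\sum_{C}\mathrm{rad}(C)\int_C|\nabla_C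 u|^2\,d\mathscr{H}^1_C<\infty$, and for $u,v\in\mathcal{F}_{\mathscr{D}}$ set $$\mathcal{E}^{\mathscr{D}}(u,v):=\sum_{C\in\mathscr{A}_{\mathscr{D}}}\int_C\langle\nabla_C u,\nabla_C v\rangle\,\mathrm{rad}(C)\,d\mathscr{H}^1_C .$$ Functions on $K^0(\mathscr{D})$ are regarded as $\mu^{\mathscr{D}}$-a.e. defined functions on $K(\mathscr{D})$. **Theorem.** $K(\mathscr{D})$ is compact, $\mu^{\mathscr{D}}$ is finite and has full support, $\mathcal{F}_{\mathscr{D}}\subset L^2(K(\mathscr{D}),\mu^{\mathscr{D}})$ with injective inclusion map, and the following hold. 1. $(\mathcal{E}^{\mathscr{D}},\mathcal{F}_{\mathscr{D}})$ is an irreducible, strongly local, regular symmetric Dirichlet form on $L^2(K(\mathscr{D}),\mu^{\mathscr{D}})$, and the space of Lipschitz continuous functions on $K(\mathscr{D})$ (with the Euclidean metric) is a core of it. Here *irreducible* means: if $A\subset K(\mathscr{D})$ is Borel and, for all $u,v\in\mathcal{F}_{\mathscr{D}}$, $\mathbf{1}_Au\in\mathcal{F}_{\mathscr{D}}$ and $\mathcal{E}^{\mathscr{D}}(u,v)=\mathcal{E}^{\mathscr{D}}(\mathbf{1}_Au,\mathbf{1}_Av)+\mathcal{E}^{\mathscr{D}}(\mathbf{1}_{A^c}u,\mathbf{1}_{A^c}v)$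 (as elements of $L^2$), then $\mu^{\mathscr{D}}(A)=0$ or $\mu^{\mathscr{D}}(K(\mathscr{D})\setminus A)=0$. 2. For every $u\in\mathcal{F}_{\mathscr{D}}$ with $u|_{V_0(\mathscr{D})}=0$, $$\int_{K(\mathscr{D})}u^2\,d\mu^{\mathscr{D}}\le\frac{40}{\kappa(\mathscr{D})^{2}}\,\mathcal{E}^{\mathscr{D}}(u,u).$$ 3. The inclusion map $\mathcal{F}_{\mathscr{D}}\hookrightarrow L^2(K(\mathscr{D}),\mu^{\mathscr{D}})$ is a compact linear operator with respect to the norm $\|u\|_{\mathcal{F}_{\mathscr{D}}}:=\bigl(\mathcal{E}^{\mathscr{D}}(u,u)+\int_{K(\mathscr{D})}u^2\,d\mu^{\mathscr{D}}\bigr)^{1/2}$ on $\mathcal{F}_{\mathscr{D}}$. -/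

import Mathlib

open MeasureTheory Filter Topology
open scoped ENNReal NNReal

noncomputable section

/-! ### Symmetric forms on `L²(X, μ)` and Dirichlet forms -/

/-- A bilinear form with values in `ℝ`, defined on a linear subspace (its domain) of `L²(X, μ)`. -/
structure L2Form {X : Type*} [MeasurableSpace X] (μ : Measure X) where
  /-- the domain of the form -/
  domain : Submodule ℝ (Lp ℝ 2 μ)
  /-- the form itself -/
  form : LinearMap.BilinForm ℝ domain

namespace L2Form

variable {X : Type*} [MeasurableSpace X] {μ : Measure X}

/-- `𝓔₁(f, f) = 𝓔(f, f) + ∫ f² dμ`, the square of the norm of the domain. -/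
def energyOne (𝓔 : L2Form μ) (f : 𝓔.domain) : ℝ :=
  𝓔.form f f + ‖(f : Lp ℝ 2 μ)‖ ^ 2

/-- Symmetric Dirichlet forms: densely defined, symmetric, non-negative definite, closed
(the domain is complete for `𝓔₁`) and Markovian (the unit contraction operates). -/
structure IsSymmetricDirichletForm (𝓔 : L2Form μ) : Prop where
  dense : Dense (𝓔.domain : Set (Lp ℝ 2 μ))
  symm : ∀ f g : 𝓔.domain, 𝓔.form f g = 𝓔.form g f
  nonneg : ∀ f : 𝓔.domain, 0 ≤ 𝓔.form f f
  closed : ∀ f : ℕ → 𝓔.domain,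
    (∀ ε > 0, ∃ N, ∀ m ≥ N, ∀ n ≥ N, 𝓔.energyOne (f m - f n) < ε) →
      ∃ g : 𝓔.domain, Tendsto (fun n => 𝓔.energyOne (f n - g)) atTop (𝓝 0)
  markov : ∀ f : 𝓔.domain, ∃ g : 𝓔.domain,
    (g : Lp ℝ 2 μ) =ᵐ[μ] (fun x => min (max ((f : Lp ℝ 2 μ) x) 0) 1) ∧
      𝓔.form g g ≤ 𝓔.form f f

/-- A set `𝒞` of functions is a core of `𝓔`: it consists of continuous functions with compact
support belonging to the domain, it is dense in the domain with respect to `𝓔₁`, and it is dense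
in the space of all continuous functions with compact support with respect to the uniform norm. -/
structure IsCore [TopologicalSpace X] (𝓔 : L2Form μ) (𝒞 : Set (X → ℝ)) : Prop where
  continuous : ∀ φ ∈ 𝒞, Continuous φ
  hasCompactSupport : ∀ φ ∈ 𝒞, HasCompactSupport φ
  mem_domain : ∀ φ ∈ 𝒞, ∃ g : 𝓔.domain, (g : Lp ℝ 2 μ) =ᵐ[μ] φ
  dense_domain : ∀ f : 𝓔.domain, ∀ ε > 0, ∃ φ ∈ 𝒞, ∃ g : 𝓔.domain,
    (g : Lp ℝ 2 μ) =ᵐ[μ] φ ∧ 𝓔.energyOne (f - g) < ε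
  dense_continuous : ∀ ψ : X → ℝ, Continuous ψ → HasCompactSupport ψ → ∀ ε > 0,
    ∃ φ ∈ 𝒞, ∀ x, |ψ x - φ x| < ε

/-- `𝓔` is regular: the continuous functions with compact support in the domain form a core. -/
def IsRegular [TopologicalSpace X] (𝓔 : L2Form μ) : Prop :=
  𝓔.IsCore {φ : X → ℝ | Continuous φ ∧ HasCompactSupport φ ∧
    ∃ g : 𝓔.domain, (g : Lp ℝ 2 μ) =ᵐ[μ] φ}

/-- `supp[f]` for `f ∈ L²(X, μ)`: the topological support of the measure `|f| dμ`. -/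
def l2Support [TopologicalSpace X] (f : Lp ℝ 2 μ) : Set X :=
  (μ.withDensity fun x => ‖f x‖ₑ).support

/-- Strong locality: `𝓔(f, g) = 0` whenever `f` and `g` have compact supports and `g` is
constant on a neighbourhood of the support of `f`. -/
def IsStronglyLocal [TopologicalSpace X] (𝓔 : L2Form μ) : Prop :=
  ∀ f g : 𝓔.domain, IsCompact (l2Support (f : Lp ℝ 2 μ)) → IsCompact (l2Support (g : Lp ℝ 2 μ)) →
    (∃ U : Set X, IsOpen U ∧ l2Support (f : Lp ℝ 2 μ) ⊆ U ∧
      ∃ c : ℝ, ∀ᵐ x ∂μ.restrict U, (g : Lp ℝ 2 μ) x = c) →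
    𝓔.form f g = 0

/-- A measurable set `A` is `𝓔`-invariant: multiplication by the indicator function of `A` maps
the domain into itself, and `𝓔(f, g) = 𝓔(1_A f, 1_A g) + 𝓔(1_{Aᶜ} f, 1_{Aᶜ} g)`. -/
def IsInvariant (𝓔 : L2Form μ) (A : Set X) : Prop :=
  MeasurableSet A ∧ ∃ P : 𝓔.domain → 𝓔.domain,
    (∀ f : 𝓔.domain, (P f : Lp ℝ 2 μ) =ᵐ[μ] A.indicator (f : Lp ℝ 2 μ)) ∧
    ∀ f g : 𝓔.domain, 𝓔.form f g = 𝓔.form (P f) (P g) + 𝓔.form (f - P f) (g - P g)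

/-- Irreducibility: every invariant set is null or has null complement. -/
def IsIrreducible (𝓔 : L2Form μ) : Prop :=
  ∀ A : Set X, 𝓔.IsInvariant A → μ A = 0 ∨ μ Aᶜ = 0

/-- The inclusion of the domain, normed by `𝓔₁(f, f)^{1/2}`, into `L²(X, μ)` is a compact
operator: the image of the unit ball is relatively compact. -/
def HasCompactInclusion (𝓔 : L2Form μ) : Prop :=
  IsCompact (closure ((fun f : 𝓔.domain => (f : Lp ℝ 2 μ)) '' {f | 𝓔.energyOne f ≤ 1}))

end L2Form

/-! ### The Apollonian gasket -/

namespace Apollonian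

/-- An open disk in `ℂ`, given by its centre and its (positive) radius. -/
structure Disk where
  /-- the centre -/
  cent : ℂ
  /-- the radius -/
  rad : ℝ
  rad_pos : 0 < rad

namespace Disk

instance : Nonempty Disk := ⟨⟨0, 1, one_pos⟩⟩

/-- The set of points of the open disk. -/
def interior (B : Disk) : Set ℂ := Metric.ball B.cent B.rad

/-- The closed disk. -/
def closed (B : Disk) : Set ℂ := Metric.closedBall B.cent B.rad

/-- The boundary circle. -/
def boundary (B : Disk) : Set ℂ := Metric.sphere B.cent B.rad

/-- The curvature `1 / r`. -/
def curv (B : Disk) : ℝ := B.rad⁻¹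

/-- The length measure of the boundary circle (`r dθ`), as a measure on `ℂ`. -/
def lengthMeasure (B : Disk) : Measure ℂ :=
  ENNReal.ofReal B.rad •
    (volume.restrict (Set.Ioc (-Real.pi) Real.pi)).map (circleMap B.cent B.rad)

/-- External tangency: the closed disks meet in exactly one point. -/
def Tangent (B B' : Disk) : Prop := (B.closed ∩ B'.closed).ncard = 1

/-- The gradient vector at `x ∈ ∂B` along the circle `∂B` of a function `f`: the derivative of `f`
with respect to arc length times the unit tangent vector `i (x - cent) / r`. -/
def circleGrad (B : Disk) (f : ℂ → ℝ) (x : ℂ) : ℂ :=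
  (deriv (fun t : ℝ => f (B.cent + (x - B.cent) * Complex.exp (t * Complex.I))) 0 / B.rad) •
    (Complex.I * (x - B.cent) / B.rad)

end Disk

/-- Three open disks. -/
abbrev Triple := Fin 3 → Disk

namespace Triple

/-- The ideal triangle `T(𝒟)`: the bounded connected component of the complement of the three
closed disks (as a set of points: those whose connected component in the complement is bounded). -/
def idealTriangle (D : Triple) : Set ℂ :=
  {z | z ∈ (⋃ j, (D j).closed)ᶜ ∧
    Bornology.IsBounded (connectedComponentIn (⋃ j, (D j).closed)ᶜ z)}

/-- The point `q_j(𝒟)` where the two disks other than the `j`-th one touch. -/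
def q (D : Triple) (j : Fin 3) : ℂ :=
  Classical.epsilon fun z => ∀ k, k ≠ j → z ∈ (D k).closed

/-- `V₀(𝒟) = {q_1, q_2, q_3}`. -/
def V0 (D : Triple) : Set ℂ := Set.range D.q

/-- Positively oriented tangential disk triples consisting of disks. The points `q_j` lie on the
boundary of `T(𝒟)` in counterclockwise order; since `T(𝒟)` lies inside the circle through them,
this means that the triangle `q_1 q_2 q_3` has positive signed area. -/
structure IsTangential (D : Triple) : Prop where
  tangent : ∀ j k, j ≠ k → (D j).Tangent (D k)
  oriented : 0 < ((starRingEnd ℂ) (D.q 1 - D.q 0) * (D.q 2 - D.q 0)).im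

/-- `κ(𝒟) = √(βγ + γα + αβ)`, with `α, β, γ` the curvatures of the disks. -/
def kappa (D : Triple) : ℝ :=
  Real.sqrt ((D 1).curv * (D 2).curv + (D 2).curv * (D 0).curv + (D 0).curv * (D 1).curv)

/-- `B` is an inscribed disk of `T(𝒟)`. -/
def IsInscribed (D : Triple) (B : Disk) : Prop :=
  B.interior ⊆ D.idealTriangle ∧ ∀ j, B.Tangent (D j)

/-- `D_in(𝒟)`, the inscribed disk. -/
def inscribed (D : Triple) : Disk := Classical.epsilon D.IsInscribed

/-- `Φ_j(𝒟)`: the `j`-th disk is replaced by the inscribed disk. -/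
def step (D : Triple) (j : Fin 3) : Triple := Function.update D j D.inscribed

/-- `𝒟_w = Φ_{w_m}(⋯ Φ_{w_1}(𝒟) ⋯)` for a word `w = w_1 … w_m`. -/
def word (D : Triple) (w : List (Fin 3)) : Triple := w.foldl step D

/-- The Apollonian gasket `K(𝒟)`. -/
def gasket (D : Triple) : Set ℂ :=
  closure D.idealTriangle \ ⋃ w : List (Fin 3), (D.word w).inscribed.interior

/-! ### The arcs of the gasket

The family `𝒜_𝒟` of arcs is indexed, without repetition, by `Fin 3 ⊕ List (Fin 3)`: the three sides
of `T(𝒟)` and the circles `∂D_in(𝒟_w)`. -/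

/-- The index set of the arcs. -/
abbrev ArcIndex := Fin 3 ⊕ List (Fin 3)

/-- The disk whose boundary circle contains the given arc. -/
def arcDisk (D : Triple) : ArcIndex → Disk
  | Sum.inl j => D j
  | Sum.inr w => (D.word w).inscribed

/-- The arcs: `closure T(𝒟) ∩ ∂D_j` and `∂D_in(𝒟_w)`. -/
def arc (D : Triple) : ArcIndex → Set ℂ
  | Sum.inl j => closure D.idealTriangle ∩ (D j).boundary
  | Sum.inr w => (D.word w).inscribed.boundary

/-- `K⁰(𝒟)`, the union of all arcs. -/
def arcUnion (D : Triple) : Set ℂ := ⋃ i, D.arc i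

/-- The length measure of an arc. -/
def arcMeasure (D : Triple) (i : ArcIndex) : Measure ℂ :=
  (D.arcDisk i).lengthMeasure.restrict (D.arc i)

/-- `∑_C rad(C) ℋ¹_C(· ∩ C)`, as a measure on `ℂ`. -/
def ambientMeasure (D : Triple) : Measure ℂ :=
  Measure.sum fun i => ENNReal.ofReal (D.arcDisk i).rad • D.arcMeasure i

/-- The measure `μ^𝒟 = ∑_C rad(C) ℋ¹_C(· ∩ C)` on `K(𝒟)`. -/
def gasketMeasure (D : Triple) : Measure D.gasket :=
  D.ambientMeasure.comap Subtype.val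

/-- Extension by zero of a function on `K⁰(𝒟)`. -/
def zeroExt (D : Triple) (u : D.arcUnion → ℝ) : ℂ → ℝ := Function.extend Subtype.val u 0

/-- A function on `K⁰(𝒟)` as a function on `K(𝒟)` (it is zero on `K(𝒟) \ K⁰(𝒟)`, which is
`μ^𝒟`-null). -/
def onGasket (D : Triple) (u : D.arcUnion → ℝ) : D.gasket → ℝ := fun x => D.zeroExt u x

/-- The gradient of `u` along the `i`-th arc (at the interior points of the arc). -/
def arcGrad (D : Triple) (u : D.arcUnion → ℝ) (i : ArcIndex) : ℂ → ℂ :=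
  (D.arcDisk i).circleGrad (D.zeroExt u)

/-- `u` is absolutely continuous on the `i`-th arc, in the angular variable. -/
def IsACOnArc (D : Triple) (u : D.arcUnion → ℝ) (i : ArcIndex) : Prop :=
  ∀ a b : ℝ, a ≤ b →
    (∀ θ ∈ Set.Icc a b, circleMap (D.arcDisk i).cent (D.arcDisk i).rad θ ∈ D.arc i) →
    AbsolutelyContinuousOnInterval
      (fun θ => D.zeroExt u (circleMap (D.arcDisk i).cent (D.arcDisk i).rad θ)) a b

/-- The space `ℱ_𝒟 = W^{1,2}_𝒟`: functions on `K⁰(𝒟)` which belong to `W^{1,2}(C)` for each arc `C`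
and whose gradient is square-integrable with respect to `μ^𝒟`. -/
def sobolevSpace (D : Triple) : Set (D.arcUnion → ℝ) :=
  {u | (∀ i, D.IsACOnArc u i ∧ MemLp (D.arcGrad u i) 2 (D.arcMeasure i)) ∧
    ∑' i, ENNReal.ofReal (D.arcDisk i).rad * ∫⁻ x, ‖D.arcGrad u i x‖ₑ ^ 2 ∂D.arcMeasure i < ∞}

/-- `ℰ^𝒟(u, v) = ∑_C ∫_C ⟨∇_C u, ∇_C v⟩ rad(C) dℋ¹_C`. -/
def energy (D : Triple) (u v : D.arcUnion → ℝ) : ℝ :=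
  ∑' i, (D.arcDisk i).rad * ∫ x, inner ℝ (D.arcGrad u i x) (D.arcGrad v i x) ∂D.arcMeasure i

/-- `𝒞^lip_𝒟`, the Lipschitz functions on `K(𝒟)`. -/
def lipschitzFunctions (D : Triple) : Set (D.gasket → ℝ) :=
  {φ | ∃ L : ℝ≥0, LipschitzWith L φ}

/-- The form `𝓔` on a subspace of `L²(K(𝒟), μ^𝒟)` is `(ℰ^𝒟, ℱ_𝒟)`: each `u ∈ ℱ_𝒟` is in `L²`, the
resulting map `ℱ_𝒟 → L²` is injective with image the domain of `𝓔`, and carries `ℰ^𝒟` to `𝓔`. -/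
structure IsEnergyForm (D : Triple) (𝓔 : L2Form D.gasketMeasure) : Prop where
  memLp : ∀ u ∈ D.sobolevSpace, MemLp (D.onGasket u) 2 D.gasketMeasure
  injective : ∀ u ∈ D.sobolevSpace, ∀ v ∈ D.sobolevSpace,
    D.onGasket u =ᵐ[D.gasketMeasure] D.onGasket v → u = v
  mem_domain : ∀ f : Lp ℝ 2 D.gasketMeasure,
    f ∈ 𝓔.domain ↔ ∃ u ∈ D.sobolevSpace, f =ᵐ[D.gasketMeasure] D.onGasket u
  form_eq : ∀ f g : 𝓔.domain, ∀ u ∈ D.sobolevSpace, ∀ v ∈ D.sobolevSpace,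
    (f : Lp ℝ 2 D.gasketMeasure) =ᵐ[D.gasketMeasure] D.onGasket u →
    (g : Lp ℝ 2 D.gasketMeasure) =ᵐ[D.gasketMeasure] D.onGasket v →
    𝓔.form f g = D.energy u v

end Triple

end Apollonian

end

/-! In the angular coordinate of a circle the radius drops out of the energy: rad(C) times the
integral of |∇u|² over C is the integral of |∂u/∂θ|² dθ, while the mass becomes rad(C)² times the
integral of u² dθ. The form is therefore the squared L² norm of a single derivative operator on the
disjoint union of the parameter intervals of the arcs, and the analysis comes down to comparing it
with sums of squared radii.

Geometry. By Descartes' theorem the inscribed disk has curvature α+β+γ+2κ, and replacing `D j` by it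
adds the two retained curvatures to κ. So κ grows at least linearly with the length of a word, while
a cell has diameter at most 10/κ. The three children cut each side into two pieces and the inscribed
circle into three, so the integral over all arcs (`totalInt`) is exactly additive over the children
(`Kissing.totalInt_step`). A bound proved for one cell thus passes to all levels by induction.

Poincaré inequality. Let u vanish at the three vertices. On a side, Cauchy–Schwarz suffices. The
circle of a word w is reached from a side through the inscribed circles of the prefixes of w, a
chain of |w|+2 touching arcs, so that u² ≤ (|w|+2)·π·(energy) there. What remains is the sum of
(|w|+2)·rad². Two supersolutions of the subdivision bound it: a quarter of the area of the triangle
of tangency points dominates the sum of rad², and (3/2)κ⁻² dominates the sum of these areas over all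
cells. The constants add up to less than 40/κ².

Approximation. The affine interpolation of u at the vertices of a cell has at most 100 times the
energy of u on it (`Kissing.totalInt_affine_le`). Interpolants on the cells of level n glue to a
Lipschitz function, because two cells meet at a common vertex transversally. By the Poincaré
inequality on small cells they converge to u in L² with bounded energies; a parallelogram argument
and the closedness of the gradient turn this into convergence in the energy norm. Hence the
Lipschitz functions form a core.

The rest is one-dimensional. Point evaluations on arcs are bounded, so the gradient is closed.
Contractions decrease derivatives, which gives the Markov property, and locality of the derivative
gives strong locality. Zero energy forces constancy by the Poincaré inequality, hence
irreducibility. Compactness holds because, up to a small L² error, a function of bounded energy is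
controlled by its finitely many values at the vertices of level n. -/

noncomputable section

/-! ### Scalar and cross products in the plane -/

namespace Apollonian

/-- The cross product of two plane vectors. -/
def cross (a b : ℂ) : ℝ := a.re * b.im - a.im * b.re

/-- The scalar product of two plane vectors. -/
def dot (a b : ℂ) : ℝ := a.re * b.re + a.im * b.im

theorem norm_sq_eq_dot (a : ℂ) : ‖a‖ ^ 2 = dot a a := by
  rw [Complex.sq_norm, Complex.normSq_apply, dot]

theorem abs_cross_le (a b : ℂ) : |cross a b| ≤ ‖a‖ * ‖b‖ := by
  apply abs_le_of_sq_le_sq _ (by positivity)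
  rw [mul_pow, norm_sq_eq_dot, norm_sq_eq_dot]
  simp only [cross, dot]
  nlinarith [sq_nonneg (a.re * b.re + a.im * b.im)]

theorem abs_dot_le (a b : ℂ) : |dot a b| ≤ ‖a‖ * ‖b‖ := by
  apply abs_le_of_sq_le_sq _ (by positivity)
  rw [mul_pow, norm_sq_eq_dot, norm_sq_eq_dot]
  simp only [dot]
  nlinarith [sq_nonneg (a.re * b.im - a.im * b.re)]

theorem two_dot_eq (a b : ℂ) : 2 * dot a b = ‖a‖ ^ 2 + ‖b‖ ^ 2 - ‖b - a‖ ^ 2 := by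
  simp only [norm_sq_eq_dot, dot, Complex.sub_re, Complex.sub_im]; ring

theorem cross_sq (a b : ℂ) : cross a b ^ 2 = ‖a‖ ^ 2 * ‖b‖ ^ 2 - dot a b ^ 2 := by
  simp only [norm_sq_eq_dot, dot, cross]; ring

/-! ### External tangency of two disks -/

namespace Disk

/-- The point of the segment of centres where two externally tangent disks touch. -/
def contact (B B' : Disk) : ℂ :=
  ((B'.rad / (B.rad + B'.rad) : ℝ) : ℂ) * B.cent + ((B.rad / (B.rad + B'.rad) : ℝ) : ℂ) * B'.cent

theorem contact_comm (B B' : Disk) : B.contact B' = B'.contact B := by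
  rw [contact, contact, add_comm, add_comm B.rad]

theorem contact_sub_cent (B B' : Disk) :
    B.contact B' - B.cent = ((B.rad / (B.rad + B'.rad) : ℝ) : ℂ) * (B'.cent - B.cent) := by
  have := B.rad_pos; have := B'.rad_pos
  have h : ((B'.rad / (B.rad + B'.rad) : ℝ) : ℂ) = 1 - ((B.rad / (B.rad + B'.rad) : ℝ) : ℂ) := by
    rw [← Complex.ofReal_one, ← Complex.ofReal_sub]; congr 1; field_simp; ring
  rw [contact, h]; ring

theorem norm_contact_sub_cent {B B' : Disk} (h : ‖B'.cent - B.cent‖ = B.rad + B'.rad) :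
    ‖B.contact B' - B.cent‖ = B.rad := by
  have h1 := B.rad_pos; have h2 := B'.rad_pos
  rw [contact_sub_cent, norm_mul, h, Complex.norm_real, Real.norm_eq_abs, abs_of_pos (by positivity)]
  field_simp

/-- Stewart's identity: the mean of the squared distances to the two centres, with the weights that
define the contact point, exceeds |x - contact|² by a constant. At tangency, membership in both
closed disks leaves nothing for |x - contact|². -/
theorem eq_contact_of_le {B B' : Disk} (h : ‖B'.cent - B.cent‖ = B.rad + B'.rad) {x : ℂ}
    (hx : ‖x - B.cent‖ ≤ B.rad) (hx' : ‖x - B'.cent‖ ≤ B'.rad) : x = B.contact B' := by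
  have h1 := B.rad_pos; have h2 := B'.rad_pos
  have key : B'.rad / (B.rad + B'.rad) * ‖x - B.cent‖ ^ 2 +
      B.rad / (B.rad + B'.rad) * ‖x - B'.cent‖ ^ 2 = ‖x - B.contact B'‖ ^ 2 +
      B.rad / (B.rad + B'.rad) * (B'.rad / (B.rad + B'.rad)) * ‖B'.cent - B.cent‖ ^ 2 := by
    simp only [norm_sq_eq_dot, dot, contact, Complex.sub_re, Complex.sub_im, Complex.add_re,
      Complex.add_im, Complex.re_ofReal_mul, Complex.im_ofReal_mul]
    field_simp; ring
  have e1 : ‖x - B.cent‖ ^ 2 ≤ B.rad ^ 2 := by gcongr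
  have e2 : ‖x - B'.cent‖ ^ 2 ≤ B'.rad ^ 2 := by gcongr
  have e3 : B'.rad / (B.rad + B'.rad) * B.rad ^ 2 + B.rad / (B.rad + B'.rad) * B'.rad ^ 2 =
     B.rad / (B.rad + B'.rad) * (B'.rad / (B.rad + B'.rad)) * ‖B'.cent - B.cent‖ ^ 2 := by
    rw [h]; field_simp
  have e4 : B'.rad / (B.rad + B'.rad) * ‖x - B.cent‖ ^ 2 ≤ B'.rad / (B.rad + B'.rad) * B.rad ^ 2 := by
    gcongr
  have e5 : B.rad / (B.rad + B'.rad) * ‖x - B'.cent‖ ^ 2 ≤ B.rad / (B.rad + B'.rad) * B'.rad ^ 2 := by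
    gcongr
  have : ‖x - B.contact B'‖ ^ 2 ≤ 0 := by linarith
  have : ‖x - B.contact B'‖ = 0 := by
    have := sq_nonneg ‖x - B.contact B'‖; exact pow_eq_zero_iff (two_ne_zero) |>.1 (by linarith)
  exact sub_eq_zero.1 (norm_eq_zero.1 this)

theorem mem_closed {B : Disk} {x : ℂ} : x ∈ B.closed ↔ ‖x - B.cent‖ ≤ B.rad := by
  rw [closed, Metric.mem_closedBall, dist_eq_norm]

theorem mem_interior {B : Disk} {x : ℂ} : x ∈ B.interior ↔ ‖x - B.cent‖ < B.rad := by
  rw [interior, Metric.mem_ball, dist_eq_norm]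

theorem mem_boundary {B : Disk} {x : ℂ} : x ∈ B.boundary ↔ ‖x - B.cent‖ = B.rad := by
  rw [boundary, Metric.mem_sphere, dist_eq_norm]

/-- A single common point excludes overlap: overlapping open disks meet in a nonempty open set, and
a singleton of the plane has empty interior. -/
theorem tangent_iff {B B' : Disk} : B.Tangent B' ↔ ‖B'.cent - B.cent‖ = B.rad + B'.rad := by
  have h1 := B.rad_pos; have h2 := B'.rad_pos
  constructor
  · intro h
    obtain ⟨x, hx⟩ := Set.ncard_eq_one.1 h
    have hxm : x ∈ B.closed ∩ B'.closed := hx ▸ rfl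
    have a1 := mem_closed.1 hxm.1
    have a2 := mem_closed.1 hxm.2
    apply le_antisymm
    · calc ‖B'.cent - B.cent‖ = ‖(x - B.cent) - (x - B'.cent)‖ := by congr 1; ring
        _ ≤ _ := (norm_sub_le _ _).trans (add_le_add a1 a2)
    · by_contra hlt
      push Not at hlt
      obtain ⟨y, hy, hy'⟩ := exists_dist_lt_lt h1 h2
        (show dist B.cent B'.cent < B'.rad + B.rad by rw [dist_comm, dist_eq_norm]; linarith)
      have ho : IsOpen (Metric.ball B.cent B.rad ∩ Metric.ball B'.cent B'.rad) :=
        Metric.isOpen_ball.inter Metric.isOpen_ball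
      have hne : (Metric.ball B.cent B.rad ∩ Metric.ball B'.cent B'.rad).Nonempty :=
        ⟨y, by rwa [Metric.mem_ball, dist_comm], hy'⟩
      have hsub : Metric.ball B.cent B.rad ∩ Metric.ball B'.cent B'.rad ⊆ {x} := by
        rw [← hx]
        exact Set.inter_subset_inter Metric.ball_subset_closedBall Metric.ball_subset_closedBall
      have := ho.subset_interior_iff.2 hsub hne.some_mem
      simp [interior_singleton] at this
  · intro h
    rw [Tangent, Set.ncard_eq_one]
    refine ⟨B.contact B', Set.eq_singleton_iff_unique_mem.2 ⟨⟨?_, ?_⟩, fun x hx => ?_⟩⟩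
    · exact mem_closed.2 (norm_contact_sub_cent h).le
    · rw [contact_comm]
      refine mem_closed.2 (norm_contact_sub_cent ?_).le
      rw [norm_sub_rev, h, add_comm]
    · exact eq_contact_of_le h (mem_closed.1 hx.1) (mem_closed.1 hx.2)

theorem lt_norm_sub_of_mem_interior {B B' : Disk} (h : ‖B'.cent - B.cent‖ = B.rad + B'.rad) {x : ℂ}
    (hx : ‖x - B.cent‖ < B.rad) : B'.rad < ‖x - B'.cent‖ := by
  have : ‖B'.cent - B.cent‖ ≤ ‖x - B.cent‖ + ‖x - B'.cent‖ := by
    calc ‖B'.cent - B.cent‖ = ‖(x - B.cent) - (x - B'.cent)‖ := by congr 1; ring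
        _ ≤ _ := norm_sub_le _ _
  linarith

theorem le_norm_sub_of_mem_closed {B B' : Disk} (h : ‖B'.cent - B.cent‖ = B.rad + B'.rad) {x : ℂ}
    (hx : ‖x - B.cent‖ ≤ B.rad) : B'.rad ≤ ‖x - B'.cent‖ := by
  have : ‖B'.cent - B.cent‖ ≤ ‖x - B.cent‖ + ‖x - B'.cent‖ := by
    calc ‖B'.cent - B.cent‖ = ‖(x - B.cent) - (x - B'.cent)‖ := by congr 1; ring
        _ ≤ _ := norm_sub_le _ _
  linarith

end Disk

/-! ### Tangent triples and the triangle of their centres -/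

namespace Triple

/-- Three mutually externally tangent disks whose centres are in counterclockwise order. -/
structure Kissing (D : Triple) : Prop where
  dist : ∀ j k, j ≠ k → ‖(D k).cent - (D j).cent‖ = (D j).rad + (D k).rad
  orient : 0 < cross ((D 1).cent - (D 0).cent) ((D 2).cent - (D 0).cent)

/-- Unnormalised barycentric coordinates with respect to the triangle of centres. -/
def bary (D : Triple) (j : Fin 3) (z : ℂ) : ℝ := cross ((D (j + 1)).cent - z) ((D (j + 2)).cent - z)

/-- Twice the area of the triangle of centres. -/
def area (D : Triple) : ℝ := cross ((D 1).cent - (D 0).cent) ((D 2).cent - (D 0).cent)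

theorem fin3_ne (j : Fin 3) : j ≠ j + 1 ∧ j ≠ j + 2 ∧ j + 1 ≠ j + 2 := by
  fin_cases j <;> decide

theorem fin3_cases (j k : Fin 3) : k = j ∨ k = j + 1 ∨ k = j + 2 := by
  revert j k; decide

theorem fin3_add (j : Fin 3) :
    j + 1 + 1 = j + 2 ∧ j + 1 + 2 = j ∧ j + 2 + 1 = j ∧ j + 2 + 2 = j + 1 := by
  revert j; decide

theorem forall_fin3 (j : Fin 3) {p : Fin 3 → Prop} :
    (∀ k, p k) ↔ p j ∧ p (j + 1) ∧ p (j + 2) := by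
  refine ⟨fun h => ⟨h _, h _, h _⟩, fun ⟨h0, h1, h2⟩ k => ?_⟩
  rcases fin3_cases j k with rfl | rfl | rfl <;> assumption

theorem sum_fin3 {M : Type*} [AddCommMonoid M] (j : Fin 3) (f : Fin 3 → M) :
    ∑ k, f k = f j + f (j + 1) + f (j + 2) := by
  rw [Fin.sum_univ_three]
  fin_cases j
  · rfl
  · change f 0 + f 1 + f 2 = f 1 + f 2 + f 0; abel
  · change f 0 + f 1 + f 2 = f 2 + f 0 + f 1; abel

theorem area_eq (D : Triple) (j : Fin 3) :
    D.area = cross ((D (j + 1)).cent - (D j).cent) ((D (j + 2)).cent - (D j).cent) := by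
  fin_cases j
  · rfl
  · change D.area = cross ((D 2).cent - (D 1).cent) ((D 0).cent - (D 1).cent)
    simp only [area, cross, Complex.sub_re, Complex.sub_im]; ring
  · change D.area = cross ((D 0).cent - (D 2).cent) ((D 1).cent - (D 2).cent)
    simp only [area, cross, Complex.sub_re, Complex.sub_im]; ring

theorem bary_add (D : Triple) (j : Fin 3) (z : ℂ) :
    D.bary j z + D.bary (j + 1) z + D.bary (j + 2) z = D.area := by
  rw [← sum_fin3 j (fun k => D.bary k z), Fin.sum_univ_three]
  change cross ((D 1).cent - z) ((D 2).cent - z) + cross ((D 2).cent - z) ((D 0).cent - z) +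
    cross ((D 0).cent - z) ((D 1).cent - z) = _
  simp only [area, cross, Complex.sub_re, Complex.sub_im]; ring

theorem bary_smul (D : Triple) (j : Fin 3) (z : ℂ) :
    (D.area : ℂ) * (z - (D j).cent) = D.bary (j + 1) z * ((D (j + 1)).cent - (D j).cent) +
      D.bary (j + 2) z * ((D (j + 2)).cent - (D j).cent) := by
  obtain ⟨e1, e2, e3, e4⟩ := fin3_add j
  rw [D.area_eq j]
  simp only [bary, cross, e1, e2, e3, e4]
  apply Complex.ext <;>
  simp only [Complex.re_ofReal_mul, Complex.im_ofReal_mul, Complex.add_re, Complex.add_im,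
    Complex.sub_re, Complex.sub_im] <;> ring

theorem curv_pos (D : Triple) (j : Fin 3) : 0 < (D j).curv := inv_pos.2 (D j).rad_pos

theorem rad_eq (D : Triple) (j : Fin 3) : (D j).rad = 1 / (D j).curv := by
  rw [Disk.curv, one_div, inv_inv]

theorem kappa_sq (D : Triple) (j : Fin 3) : D.kappa ^ 2 =
    (D j).curv * (D (j + 1)).curv + (D (j + 1)).curv * (D (j + 2)).curv +
      (D (j + 2)).curv * (D j).curv := by
  have h0 := D.curv_pos 0; have h1 := D.curv_pos 1; have h2 := D.curv_pos 2
  rw [kappa, Real.sq_sqrt (by positivity)]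
  fin_cases j
  · change _ = (D 0).curv * (D 1).curv + (D 1).curv * (D 2).curv + (D 2).curv * (D 0).curv; ring
  · change _ = (D 1).curv * (D 2).curv + (D 2).curv * (D 0).curv + (D 0).curv * (D 1).curv; ring
  · change _ = (D 2).curv * (D 0).curv + (D 0).curv * (D 1).curv + (D 1).curv * (D 2).curv; ring

theorem kappa_pos (D : Triple) : 0 < D.kappa := by
  have h0 := D.curv_pos 0; have h1 := D.curv_pos 1; have h2 := D.curv_pos 2
  exact Real.sqrt_pos.2 (by positivity)

namespace Kissing

variable {D : Triple}

theorem area_pos (h : D.Kissing) : 0 < D.area := h.orient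

theorem two_dot (h : D.Kissing) (j : Fin 3) :
    dot ((D (j + 1)).cent - (D j).cent) ((D (j + 2)).cent - (D j).cent) =
      (D j).rad ^ 2 + (D j).rad * (D (j + 1)).rad + (D j).rad * (D (j + 2)).rad -
        (D (j + 1)).rad * (D (j + 2)).rad := by
  have := two_dot_eq ((D (j + 1)).cent - (D j).cent) ((D (j + 2)).cent - (D j).cent)
  rw [h.dist _ _ (fin3_ne j).1, h.dist _ _ (fin3_ne j).2.1, sub_sub_sub_cancel_right,
    h.dist _ _ (fin3_ne j).2.2] at this
  linarith

/-- Heron's formula for a triangle whose sides are sums of two radii: the semiperimeter is the sum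
of the radii, and κ² is that sum divided by the product of the radii. -/
theorem area_formula (h : D.Kissing) (j : Fin 3) :
    D.area = 2 * (D j).rad * (D (j + 1)).rad * (D (j + 2)).rad * D.kappa := by
  have h0 := (D j).rad_pos; have h1 := (D (j + 1)).rad_pos; have h2 := (D (j + 2)).rad_pos
  have hk := D.kappa_pos
  have e := cross_sq ((D (j + 1)).cent - (D j).cent) ((D (j + 2)).cent - (D j).cent)
  rw [← D.area_eq j, h.two_dot j, h.dist _ _ (fin3_ne j).1, h.dist _ _ (fin3_ne j).2.1] at e
  have hk2 := D.kappa_sq j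
  simp only [Disk.curv] at hk2
  have e2 : D.area ^ 2 = (2 * (D j).rad * (D (j + 1)).rad * (D (j + 2)).rad * D.kappa) ^ 2 := by
    rw [mul_pow _ D.kappa, hk2, e]; field_simp; ring
  exact (sq_eq_sq₀ h.area_pos.le (by positivity)).1 e2

end Kissing

end Triple

/-! ### Tangency points and the bounded complementary component -/

namespace Triple

theorem q_eq_contact {D : Triple}
    (h : ∀ j k, j ≠ k → ‖(D k).cent - (D j).cent‖ = (D j).rad + (D k).rad) (j : Fin 3) :
    D.q j = (D (j + 1)).contact (D (j + 2)) := by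
  obtain ⟨h1, h2, h3⟩ := fin3_ne j
  have hs : ∃ z, ∀ k, k ≠ j → z ∈ (D k).closed := by
    refine ⟨(D (j + 1)).contact (D (j + 2)), (forall_fin3 j).2 ⟨fun h => absurd rfl h, fun _ => ?_,
      fun _ => ?_⟩⟩
    · exact Disk.mem_closed.2 (Disk.norm_contact_sub_cent (h _ _ h3)).le
    · rw [Disk.contact_comm]
      exact Disk.mem_closed.2 (Disk.norm_contact_sub_cent (h _ _ h3.symm)).le
  have := Classical.epsilon_spec hs
  exact Disk.eq_contact_of_le (h _ _ h3) (Disk.mem_closed.1 (this _ h1.symm))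
    (Disk.mem_closed.1 (this _ h2.symm))

theorem cross_contact (D : Triple) :
    cross ((D 2).contact (D 0) - (D 1).contact (D 2)) ((D 0).contact (D 1) - (D 1).contact (D 2)) =
      2 * (D 0).rad * (D 1).rad * (D 2).rad / (((D 0).rad + (D 1).rad) * ((D 1).rad + (D 2).rad) *
        ((D 2).rad + (D 0).rad)) * D.area := by
  have h0 := (D 0).rad_pos; have h1 := (D 1).rad_pos; have h2 := (D 2).rad_pos
  simp only [area, cross, Disk.contact, Complex.sub_re, Complex.sub_im, Complex.add_re,
      Complex.add_im, Complex.re_ofReal_mul, Complex.im_ofReal_mul]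
  field_simp
  ring

/-- The signed areas of the triangle of tangency points and of the triangle of centres differ by a
positive factor (`cross_contact`), so the two orientation conditions agree. -/
theorem isTangential_iff {D : Triple} : D.IsTangential ↔ D.Kissing := by
  have h0 := (D 0).rad_pos; have h1 := (D 1).rad_pos; have h2 := (D 2).rad_pos
  have key : (∀ j k, j ≠ k → ‖(D k).cent - (D j).cent‖ = (D j).rad + (D k).rad) →
      ((starRingEnd ℂ) (D.q 1 - D.q 0) * (D.q 2 - D.q 0)).im =
      2 * (D 0).rad * (D 1).rad * (D 2).rad / (((D 0).rad + (D 1).rad) * ((D 1).rad + (D 2).rad) *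
        ((D 2).rad + (D 0).rad)) * D.area := by
    intro h
    have q0 : D.q 0 = (D 1).contact (D 2) := q_eq_contact h 0
    have q1 : D.q 1 = (D 2).contact (D 0) := q_eq_contact h 1
    have q2 : D.q 2 = (D 0).contact (D 1) := q_eq_contact h 2
    rw [q0, q1, q2, ← D.cross_contact]
    simp only [cross, Complex.mul_im, Complex.conj_re, Complex.conj_im]
    ring
  constructor
  · intro h
    have hd : ∀ j k, j ≠ k → ‖(D k).cent - (D j).cent‖ = (D j).rad + (D k).rad :=
      fun j k hjk => Disk.tangent_iff.1 (h.tangent j k hjk)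
    refine ⟨hd, ?_⟩
    have := h.oriented
    rw [key hd] at this
    exact pos_of_mul_pos_right this (by positivity)
  · intro h
    refine ⟨fun j k hjk => Disk.tangent_iff.2 (h.dist j k hjk), ?_⟩
    rw [key h.dist]
    have := h.area_pos
    positivity

/-- The complement of the three closed disks. -/
def outside (D : Triple) : Set ℂ := {z | ∀ j, (D j).rad < ‖z - (D j).cent‖}

theorem compl_iUnion_closed (D : Triple) : (⋃ j, (D j).closed)ᶜ = D.outside := by
  ext z; simp [outside, Disk.closed, dist_eq_norm]

/-- The closed curvilinear triangle between the three disks. -/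
def curvTriangle (D : Triple) : Set ℂ :=
  {z | ∀ j, (D j).rad ≤ ‖z - (D j).cent‖ ∧ 0 ≤ D.bary j z}

theorem continuous_bary (D : Triple) (j : Fin 3) : Continuous (D.bary j) := by
  unfold bary cross; fun_prop

theorem isClosed_curvTriangle (D : Triple) : IsClosed D.curvTriangle := by
  simp only [curvTriangle, Set.ofPred_forall, Set.ofPred_and]
  exact isClosed_iInter fun j => (isClosed_le continuous_const (by fun_prop)).inter
    (isClosed_le continuous_const (D.continuous_bary j))

namespace Kissing

variable {D : Triple}

/-- Such a point lies on the segment between two centres, where the distances to the ends add up to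
the length. Hence every edge of the triangle of centres is covered by two closed disks and avoids
`outside`. -/
theorem norm_sub_cent_of_bary_eq_zero (h : D.Kissing) {j : Fin 3} {z : ℂ} (hj : D.bary j z = 0)
    (h1 : 0 ≤ D.bary (j + 1) z) (h2 : 0 ≤ D.bary (j + 2) z) :
    ‖z - (D (j + 1)).cent‖ + ‖z - (D (j + 2)).cent‖ = (D (j + 1)).rad + (D (j + 2)).rad := by
  obtain ⟨e1, e2, e3, e4⟩ := fin3_add j
  have ha := h.area_pos
  have s := D.bary_add j z
  have b1 := congrArg norm (D.bary_smul (j + 1) z)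
  have b2 := congrArg norm (D.bary_smul (j + 2) z)
  simp only [e1, e2, e3, e4, hj, Complex.ofReal_zero, zero_mul, zero_add, add_zero, norm_mul,
    Complex.norm_real, Real.norm_eq_abs, abs_of_nonneg h1, abs_of_nonneg h2, abs_of_pos ha] at b1 b2
  rw [h.dist _ _ (fin3_ne j).2.2] at b1
  rw [h.dist _ _ (fin3_ne j).2.2.symm] at b2
  have : D.area * (‖z - (D (j + 1)).cent‖ + ‖z - (D (j + 2)).cent‖) =
      D.area * ((D (j + 1)).rad + (D (j + 2)).rad) := by
    rw [mul_add, b1, b2, ← s, hj]; ring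
  exact mul_left_cancel₀ ha.ne' this

theorem bary_pos_of_nonneg (h : D.Kissing) {z : ℂ} (hz : z ∈ D.outside)
    (hb : ∀ j, 0 ≤ D.bary j z) (j : Fin 3) : 0 < D.bary j z := by
  refine lt_of_le_of_ne (hb j) fun h0 => ?_
  have := h.norm_sub_cent_of_bary_eq_zero h0.symm (hb _) (hb _)
  have := hz (j + 1); have := hz (j + 2); linarith

/-- The edges of the triangle of centres avoid `outside`, which is therefore split into an open part
inside the triangle and an open part off it. A connected set cannot change sides. -/
theorem bary_pos_of_isPreconnected (h : D.Kissing) {S : Set ℂ} (hS : IsPreconnected S)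
    (hSo : S ⊆ D.outside) {z : ℂ} (hz : z ∈ S) (hb : ∀ j, 0 ≤ D.bary j z) :
    ∀ x ∈ S, ∀ j, 0 < D.bary j x := by
  have hu : IsOpen {x | ∀ j, 0 < D.bary j x} := by
    simp only [Set.ofPred_forall]
    exact isOpen_iInter_of_finite fun j => isOpen_lt continuous_const (D.continuous_bary j)
  have hv : IsOpen {x | ∃ j, D.bary j x < 0} := by
    simp only [Set.ofPred_exists]
    exact isOpen_iUnion fun j => isOpen_lt (D.continuous_bary j) continuous_const
  refine hS.subset_left_of_subset_union hu hv ?_ (fun x hx => ?_)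
    ⟨z, hz, fun j => h.bary_pos_of_nonneg (hSo hz) hb j⟩
  · refine Set.disjoint_left.2 fun x hx ⟨j, hj⟩ => ?_
    exact absurd (hx j) hj.le.not_gt
  · by_cases hx0 : ∀ j, 0 ≤ D.bary j x
    · exact Or.inl fun j => h.bary_pos_of_nonneg (hSo hx) hx0 j
    · push Not at hx0; exact Or.inr hx0

theorem norm_sub_cent_le (h : D.Kissing) {z : ℂ} (hb : ∀ j, 0 ≤ D.bary j z) (j : Fin 3) :
    ‖z - (D j).cent‖ ≤ ‖(D (j + 1)).cent - (D j).cent‖ + ‖(D (j + 2)).cent - (D j).cent‖ := by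
  have ha := h.area_pos
  have s := D.bary_add j z
  have b := congrArg norm (D.bary_smul j z)
  rw [norm_mul, Complex.norm_real, Real.norm_eq_abs, abs_of_pos ha] at b
  have b' : D.area * ‖z - (D j).cent‖ ≤ D.bary (j + 1) z * ‖(D (j + 1)).cent - (D j).cent‖ +
      D.bary (j + 2) z * ‖(D (j + 2)).cent - (D j).cent‖ := by
    rw [b]; refine (norm_add_le _ _).trans (le_of_eq ?_)
    simp [abs_of_nonneg (hb _)]
  have h0 := hb j; have h1 := hb (j + 1); have h2 := hb (j + 2)
  have n1 := norm_nonneg ((D (j + 1)).cent - (D j).cent)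
  have n2 := norm_nonneg ((D (j + 2)).cent - (D j).cent)
  refine le_of_mul_le_mul_left (b'.trans ?_) ha
  rw [mul_add]
  exact add_le_add (mul_le_mul_of_nonneg_right (by linarith) n1)
    (mul_le_mul_of_nonneg_right (by linarith) n2)

theorem isBounded_bary_nonneg (h : D.Kissing) : Bornology.IsBounded {z | ∀ j, 0 ≤ D.bary j z} :=
  (Metric.isBounded_closedBall (x := (D 0).cent)).subset fun z hz => by
    rw [Metric.mem_closedBall, dist_eq_norm]; exact h.norm_sub_cent_le hz 0

/-- Along the outward normal of the edge opposite to `j` the distances to all three centres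
increase, so this ray from z stays in `outside` and runs to infinity. -/
theorem not_isBounded_of_bary_neg (h : D.Kissing) {z : ℂ} (hz : z ∈ D.outside) {j : Fin 3}
    (hj : D.bary j z < 0) : ¬ Bornology.IsBounded (connectedComponentIn D.outside z) := by
  set E := (D (j + 2)).cent - (D (j + 1)).cent with hE
  set n : ℂ := -Complex.I * E with hn
  have hnre : n.re = E.im := by simp [hn]
  have hnim : n.im = -E.re := by simp [hn]
  have d1 : ∀ k, 0 < dot (z - (D k).cent) n := by
    refine (forall_fin3 j).2 ⟨?_, ?_, ?_⟩
    · have ha := h.area_pos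
      rw [D.area_eq j] at ha
      simp only [dot, hnre, hnim, hE, bary, cross, Complex.sub_re, Complex.sub_im] at *
      linarith
    all_goals
      simp only [dot, hnre, hnim, hE, bary, cross, Complex.sub_re, Complex.sub_im] at *
      linarith
  have hn0 : 0 < ‖n‖ := by
    rw [norm_pos_iff]; rintro h0
    have := d1 0; rw [h0] at this; simp [dot] at this
  set R : Set ℂ := (fun t : ℝ => z + t * n) '' Set.Ici 0
  have hR : IsPreconnected R := isPreconnected_Ici.image _ (by fun_prop)
  have hRo : R ⊆ D.outside := by
    rintro _ ⟨t, ht, rfl⟩ k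
    refine (hz k).trans_le ((sq_le_sq₀ (norm_nonneg _) (norm_nonneg _)).1 ?_)
    have ht : 0 ≤ t := ht
    have e : ‖z + t * n - (D k).cent‖ ^ 2 = ‖z - (D k).cent‖ ^ 2 + 2 * t * dot (z - (D k).cent) n +
        t ^ 2 * ‖n‖ ^ 2 := by
      simp only [norm_sq_eq_dot, dot, Complex.sub_re, Complex.sub_im, Complex.add_re,
        Complex.add_im, Complex.re_ofReal_mul, Complex.im_ofReal_mul]; ring
    have := d1 k
    rw [e]; nlinarith [mul_nonneg ht this.le, mul_nonneg (sq_nonneg t) (sq_nonneg ‖n‖)]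
  have hsub : R ⊆ connectedComponentIn D.outside z :=
    hR.subset_connectedComponentIn ⟨0, Set.self_mem_Ici, by simp⟩ hRo
  intro hb
  obtain ⟨C, hC⟩ := (hb.subset hsub).exists_norm_le
  have hC0 : 0 ≤ C := (norm_nonneg _).trans (hC _ ⟨0, Set.self_mem_Ici, rfl⟩)
  have ht : 0 ≤ (C + ‖z‖ + 1) / ‖n‖ := by positivity
  have := hC _ ⟨(C + ‖z‖ + 1) / ‖n‖, ht, rfl⟩
  have h3 : ‖(((C + ‖z‖ + 1) / ‖n‖ : ℝ) : ℂ) * n‖ = C + ‖z‖ + 1 := by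
    rw [norm_mul, Complex.norm_real, Real.norm_eq_abs, abs_of_nonneg ht]; field_simp
  have h4 : ‖(((C + ‖z‖ + 1) / ‖n‖ : ℝ) : ℂ) * n‖ ≤
      ‖z + (((C + ‖z‖ + 1) / ‖n‖ : ℝ) : ℂ) * n‖ + ‖z‖ := by
    refine le_trans (le_of_eq ?_) (norm_sub_le _ _); congr 1; ring
  dsimp only at this
  linarith

theorem idealTriangle_eq (h : D.Kissing) :
    D.idealTriangle = D.outside ∩ {z | ∀ j, 0 < D.bary j z} := by
  ext z
  simp only [idealTriangle, compl_iUnion_closed, Set.mem_ofPred_eq, Set.mem_inter_iff]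
  refine and_congr_right fun hz => ⟨fun hb => ?_, fun hp => ?_⟩
  · by_contra hn
    have : ∃ j, D.bary j z < 0 := by
      by_contra hn'
      push Not at hn'
      exact hn (h.bary_pos_of_nonneg hz hn')
    obtain ⟨j, hj⟩ := this
    exact h.not_isBounded_of_bary_neg hz hj hb
  · refine h.isBounded_bary_nonneg.subset fun x hx j => ?_
    exact (h.bary_pos_of_isPreconnected isPreconnected_connectedComponentIn
      (connectedComponentIn_subset _ _) (mem_connectedComponentIn hz) (fun j => (hp j).le) x hx j).le

theorem isOpen_idealTriangle (h : D.Kissing) : IsOpen D.idealTriangle := by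
  rw [h.idealTriangle_eq]
  simp only [outside, Set.ofPred_forall]
  exact (isOpen_iInter_of_finite fun j => isOpen_lt continuous_const (by fun_prop)).inter
    (isOpen_iInter_of_finite fun j => isOpen_lt continuous_const (D.continuous_bary j))

theorem isCompact_curvTriangle (h : D.Kissing) : IsCompact D.curvTriangle :=
  Metric.isCompact_of_isClosed_isBounded D.isClosed_curvTriangle
    (h.isBounded_bary_nonneg.subset fun _ hz j => (hz j).2)

theorem subset_curvTriangle (h : D.Kissing) : D.idealTriangle ⊆ D.curvTriangle := by
  rw [h.idealTriangle_eq]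
  exact fun z hz j => ⟨(hz.1 j).le, (hz.2 j).le⟩

end Kissing

end Triple

/-! ### The closure of the ideal triangle -/

namespace Triple

theorem fin3_exists_ne (j k : Fin 3) : ∃ i : Fin 3, i ≠ j ∧ i ≠ k := by
  revert j k; decide

namespace Kissing

variable {D : Triple}

theorem q_eq (h : D.Kissing) (j : Fin 3) : D.q j = (D (j + 1)).contact (D (j + 2)) :=
  q_eq_contact h.dist j

theorem norm_q_sub_fst (h : D.Kissing) (j : Fin 3) :
    ‖D.q j - (D (j + 1)).cent‖ = (D (j + 1)).rad := by
  rw [h.q_eq]; exact Disk.norm_contact_sub_cent (h.dist _ _ (fin3_ne j).2.2)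

theorem norm_q_sub_snd (h : D.Kissing) (j : Fin 3) :
    ‖D.q j - (D (j + 2)).cent‖ = (D (j + 2)).rad := by
  rw [h.q_eq, Disk.contact_comm]; exact Disk.norm_contact_sub_cent (h.dist _ _ (fin3_ne j).2.2.symm)

theorem bary_q (h : D.Kissing) (j : Fin 3) : D.bary j (D.q j) = 0 := by
  have h1 := (D (j + 1)).rad_pos; have h2 := (D (j + 2)).rad_pos
  rw [h.q_eq]
  simp only [bary, cross, Disk.contact, Complex.sub_re, Complex.sub_im, Complex.add_re,
      Complex.add_im, Complex.re_ofReal_mul, Complex.im_ofReal_mul]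
  field_simp; ring

theorem bary_fst_q (h : D.Kissing) (j : Fin 3) : D.bary (j + 1) (D.q j) =
    (D (j + 2)).rad / ((D (j + 1)).rad + (D (j + 2)).rad) * D.area := by
  have h1 := (D (j + 1)).rad_pos; have h2 := (D (j + 2)).rad_pos
  obtain ⟨e1, e2, e3, e4⟩ := fin3_add j
  rw [h.q_eq, D.area_eq j]
  simp only [bary, cross, Disk.contact, Complex.sub_re, Complex.sub_im, Complex.add_re,
      Complex.add_im, Complex.re_ofReal_mul, Complex.im_ofReal_mul, e1, e2]
  field_simp; ring

theorem bary_snd_q (h : D.Kissing) (j : Fin 3) : D.bary (j + 2) (D.q j) =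
    (D (j + 1)).rad / ((D (j + 1)).rad + (D (j + 2)).rad) * D.area := by
  have h1 := (D (j + 1)).rad_pos; have h2 := (D (j + 2)).rad_pos
  have := D.bary_add j (D.q j)
  rw [h.bary_q, h.bary_fst_q] at this
  have e : D.area = (D (j + 2)).rad / ((D (j + 1)).rad + (D (j + 2)).rad) * D.area +
    (D (j + 1)).rad / ((D (j + 1)).rad + (D (j + 2)).rad) * D.area := by field_simp; ring
  linarith

theorem bary_q_pos (h : D.Kissing) {j k : Fin 3} (hjk : k ≠ j) : 0 < D.bary k (D.q j) := by
  have h1 := (D (j + 1)).rad_pos; have h2 := (D (j + 2)).rad_pos; have ha := h.area_pos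
  rcases fin3_cases j k with rfl | rfl | rfl
  · exact absurd rfl hjk
  · rw [h.bary_fst_q]; positivity
  · rw [h.bary_snd_q]; positivity

theorem eq_q_of_le (h : D.Kissing) {j : Fin 3} {z : ℂ} (h1 : ‖z - (D (j + 1)).cent‖ ≤ (D (j + 1)).rad)
    (h2 : ‖z - (D (j + 2)).cent‖ ≤ (D (j + 2)).rad) : z = D.q j := by
  rw [h.q_eq]; exact Disk.eq_contact_of_le (h.dist _ _ (fin3_ne j).2.2) h1 h2

theorem eq_q_of_ne (h : D.Kissing) {i k l : Fin 3} {z : ℂ} (hik : i ≠ k) (hil : i ≠ l) (hkl : k ≠ l)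
    (h1 : ‖z - (D k).cent‖ ≤ (D k).rad) (h2 : ‖z - (D l).cent‖ ≤ (D l).rad) : z = D.q i := by
  rcases fin3_cases i k with rfl | rfl | rfl
  · exact absurd rfl hik
  · rcases fin3_cases i l with rfl | rfl | rfl
    · exact absurd rfl hil
    · exact absurd rfl hkl
    · exact h.eq_q_of_le h1 h2
  · rcases fin3_cases i l with rfl | rfl | rfl
    · exact absurd rfl hil
    · exact h.eq_q_of_le h2 h1
    · exact absurd rfl hkl

theorem rad_lt_norm_q_sub (h : D.Kissing) (j : Fin 3) : (D j).rad < ‖D.q j - (D j).cent‖ := by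
  obtain ⟨n1, n2, n3⟩ := fin3_ne j
  by_contra hle
  push Not at hle
  have := h.eq_q_of_ne (i := j + 2) n2.symm n3.symm n1 hle (h.norm_q_sub_fst j).le
  have h1 := h.bary_q_pos (j := j) (k := j + 2) n2.symm
  rw [this, h.bary_q] at h1
  exact lt_irrefl _ h1

theorem mem_closure_of_eventually {z w : ℂ}
    (hw : ∀ᶠ t : ℝ in 𝓝[>] 0, z + t * w ∈ D.idealTriangle) : z ∈ closure D.idealTriangle := by
  have ht : Tendsto (fun t : ℝ => z + t * w) (𝓝[>] 0) (𝓝 z) := by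
    have : ContinuousAt (fun t : ℝ => z + t * w) 0 := by fun_prop
    have h2 := this.tendsto
    simp only [Complex.ofReal_zero, zero_mul, add_zero] at h2
    exact h2.mono_left nhdsWithin_le_nhds
  exact mem_closure_of_tendsto ht hw

theorem eventually_of_lt {f g : ℂ → ℝ} (hf : Continuous f) (hg : Continuous g) {z : ℂ} (w : ℂ)
    (h : f z < g z) : ∀ᶠ t : ℝ in 𝓝[>] 0, f (z + t * w) < g (z + t * w) := by
  have ho : IsOpen {t : ℝ | f (z + t * w) < g (z + t * w)} :=
    isOpen_lt (by fun_prop) (by fun_prop)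
  exact mem_nhdsWithin_of_mem_nhds (ho.mem_nhds (by simpa using h))

/-- Two circles touching at `q j` have a common tangent there, orthogonal to the line of centres. A
step t along it raises the squared distance to both centres by a multiple of t², and with the
direction `I * E` it enters the triangle of centres. -/
theorem q_mem_closure (h : D.Kissing) (j : Fin 3) : D.q j ∈ closure D.idealTriangle := by
  obtain ⟨n1, n2, n3⟩ := fin3_ne j
  set E := (D (j + 2)).cent - (D (j + 1)).cent with hE
  have hEn : 0 < ‖E‖ := by
    have h1 := (D (j + 1)).rad_pos; have h2 := (D (j + 2)).rad_pos
    rw [hE, h.dist _ _ n3]; positivity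
  have hs1 : D.q j - (D (j + 1)).cent =
      (((D (j + 1)).rad / ((D (j + 1)).rad + (D (j + 2)).rad) : ℝ) : ℂ) * E := by
    rw [h.q_eq, Disk.contact_sub_cent]
  have hs2 : D.q j - (D (j + 2)).cent =
      ((-((D (j + 2)).rad / ((D (j + 2)).rad + (D (j + 1)).rad)) : ℝ) : ℂ) * E := by
    rw [h.q_eq, Disk.contact_comm, Disk.contact_sub_cent, hE]; push_cast; ring
  have key : ∀ (k : Fin 3) (s : ℝ), ‖D.q j - (D k).cent‖ = (D k).rad → D.q j - (D k).cent = (s : ℂ) * E →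
      ∀ᶠ t : ℝ in 𝓝[>] 0, (D k).rad < ‖D.q j + t * (Complex.I * E) - (D k).cent‖ := by
    intro k s hk hs
    filter_upwards [self_mem_nhdsWithin] with t (ht : 0 < t)
    rw [← sq_lt_sq₀ (D k).rad_pos.le (norm_nonneg _), ← hk, norm_sq_eq_dot, norm_sq_eq_dot,
      add_sub_right_comm, hs]
    have : 0 < t ^ 2 * dot E E := by rw [← norm_sq_eq_dot]; positivity
    simp only [dot, Complex.add_re, Complex.add_im, Complex.mul_re, Complex.mul_im,
      Complex.ofReal_re, Complex.ofReal_im, Complex.I_re, Complex.I_im] at this ⊢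
    nlinarith
  have e1 : ∀ᶠ t : ℝ in 𝓝[>] 0, 0 < D.bary j (D.q j + t * (Complex.I * E)) := by
    filter_upwards [self_mem_nhdsWithin] with t (ht : 0 < t)
    have : D.bary j (D.q j + t * (Complex.I * E)) = D.bary j (D.q j) + t * dot E E := by
      simp only [bary, cross, hE, dot, Complex.add_re, Complex.add_im, Complex.mul_re,
        Complex.mul_im, Complex.sub_re, Complex.sub_im,
        Complex.ofReal_re, Complex.ofReal_im, Complex.I_re, Complex.I_im]; ring
    rw [this, h.bary_q, ← norm_sq_eq_dot]; positivity
  refine mem_closure_of_eventually (w := Complex.I * E) ?_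
  filter_upwards [eventually_of_lt continuous_const (D.continuous_bary (j + 1)) (Complex.I * E)
      (h.bary_q_pos n1.symm), eventually_of_lt continuous_const (D.continuous_bary (j + 2))
      (Complex.I * E) (h.bary_q_pos n2.symm), e1, key _ _ (h.norm_q_sub_fst j) hs1,
      key _ _ (h.norm_q_sub_snd j) hs2, eventually_of_lt (f := fun _ => (D j).rad)
      (g := fun z => ‖z - (D j).cent‖) continuous_const (by fun_prop) (Complex.I * E)
      (h.rad_lt_norm_q_sub j)] with t a1 a2 a3 a4 a5 a6
  rw [h.idealTriangle_eq]
  exact ⟨(forall_fin3 j).2 ⟨a6, a4, a5⟩, (forall_fin3 j).2 ⟨a3, a1, a2⟩⟩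

/-- A further point of `curvTriangle` either lies on exactly one circle, and a radial push outwards
frees it, or on an edge of the triangle of centres, which forces it to be a tangency point. -/
theorem closure_idealTriangle (h : D.Kissing) : closure D.idealTriangle = D.curvTriangle := by
  refine Set.Subset.antisymm (D.isClosed_curvTriangle.closure_subset_iff.2 h.subset_curvTriangle)
    fun z hz => ?_
  by_cases hb : ∀ j, 0 < D.bary j z
  · by_cases ho : z ∈ D.outside
    · exact subset_closure (h.idealTriangle_eq ▸ ⟨ho, hb⟩)
    · simp only [outside, Set.mem_ofPred_eq, not_forall, not_lt] at ho
      obtain ⟨j, hj⟩ := ho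
      obtain ⟨n1, n2, n3⟩ := fin3_ne j
      have hne : ∀ k, k ≠ j → (D k).rad < ‖z - (D k).cent‖ := by
        intro k hk
        by_contra hle
        push Not at hle
        obtain ⟨i, hij, hik⟩ := fin3_exists_ne j k
        have := hb i
        rw [h.eq_q_of_ne hij hik hk.symm hj hle, h.bary_q] at this
        exact lt_irrefl _ this
      have hj' : ‖z - (D j).cent‖ = (D j).rad := le_antisymm hj (hz j).1
      have key : ∀ᶠ t : ℝ in 𝓝[>] 0, (D j).rad < ‖z + t * (z - (D j).cent) - (D j).cent‖ := by
        filter_upwards [self_mem_nhdsWithin] with t (ht : 0 < t)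
        have e : z + t * (z - (D j).cent) - (D j).cent = ((1 + t : ℝ) : ℂ) * (z - (D j).cent) := by
          push_cast; ring
        rw [e, norm_mul, Complex.norm_real, Real.norm_eq_abs, abs_of_pos (by linarith), hj']
        nlinarith [(D j).rad_pos]
      have bt : ∀ k, ∀ᶠ t : ℝ in 𝓝[>] 0, 0 < D.bary k (z + t * (z - (D j).cent)) := fun k =>
        eventually_of_lt continuous_const (D.continuous_bary k) _ (hb k)
      have nt : ∀ k, k ≠ j → ∀ᶠ t : ℝ in 𝓝[>] 0,
          (D k).rad < ‖z + t * (z - (D j).cent) - (D k).cent‖ := fun k hk =>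
        eventually_of_lt (f := fun _ => (D k).rad) (g := fun z => ‖z - (D k).cent‖)
          continuous_const (by fun_prop) _ (hne k hk)
      refine mem_closure_of_eventually (w := z - (D j).cent) ?_
      filter_upwards [key, eventually_all.2 bt, nt _ n1.symm, nt _ n2.symm] with t a1 a2 a3 a4
      rw [h.idealTriangle_eq]
      exact ⟨(forall_fin3 j).2 ⟨a1, a3, a4⟩, a2⟩
  · push Not at hb
    obtain ⟨j, hj⟩ := hb
    have := h.norm_sub_cent_of_bary_eq_zero (le_antisymm hj (hz j).2) (hz _).2 (hz _).2
    have h1 := (hz (j + 1)).1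
    have h2 := (hz (j + 2)).1
    rw [h.eq_q_of_le (j := j) (z := z) (by linarith) (by linarith)]
    exact h.q_mem_closure j

end Kissing

/-! ### The inscribed disk -/

/-- The curvature of the inscribed disk. -/
def inCurv (D : Triple) : ℝ := (D 0).curv + (D 1).curv + (D 2).curv + 2 * D.kappa

theorem inCurv_eq (D : Triple) (j : Fin 3) :
    D.inCurv = (D j).curv + (D (j + 1)).curv + (D (j + 2)).curv + 2 * D.kappa := by
  rw [inCurv, ← Fin.sum_univ_three (fun k => (D k).curv), sum_fin3 j]

theorem inCurv_pos (D : Triple) : 0 < D.inCurv := by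
  have := D.curv_pos 0; have := D.curv_pos 1; have := D.curv_pos 2; have := D.kappa_pos
  unfold inCurv; positivity

/-- The barycentric coordinates of the centre of the inscribed disk. -/
def inWeight (D : Triple) (j : Fin 3) : ℝ :=
  (D j).curv * ((D (j + 1)).curv + (D (j + 2)).curv + D.kappa) / (D.kappa * D.inCurv)

theorem inWeight_pos (D : Triple) (j : Fin 3) : 0 < D.inWeight j := by
  have := D.curv_pos j; have := D.curv_pos (j + 1); have := D.curv_pos (j + 2)
  have := D.kappa_pos; have := D.inCurv_pos
  unfold inWeight; positivity

theorem inWeight_add (D : Triple) (j : Fin 3) :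
    D.inWeight j + D.inWeight (j + 1) + D.inWeight (j + 2) = 1 := by
  obtain ⟨e1, e2, e3, e4⟩ := fin3_add j
  have := D.kappa_pos; have := D.inCurv_pos
  simp only [inWeight, e1, e2, e3, e4]
  rw [← add_div, ← add_div, div_eq_one_iff_eq (by positivity), D.inCurv_eq j]
  have := D.kappa_sq j
  linarith

/-- The inscribed disk, given explicitly. -/
def soddy (D : Triple) : Disk where
  cent := ∑ j, (D.inWeight j : ℂ) * (D j).cent
  rad := D.inCurv⁻¹
  rad_pos := inv_pos.2 D.inCurv_pos

theorem soddy_sub_cent (D : Triple) (j : Fin 3) : D.soddy.cent - (D j).cent =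
    D.inWeight (j + 1) * ((D (j + 1)).cent - (D j).cent) +
      D.inWeight (j + 2) * ((D (j + 2)).cent - (D j).cent) := by
  have : (D.inWeight j : ℂ) = 1 - D.inWeight (j + 1) - D.inWeight (j + 2) := by
    have := D.inWeight_add j
    rw [← Complex.ofReal_one, ← Complex.ofReal_sub, ← Complex.ofReal_sub]; congr 1; linarith
  rw [soddy, sum_fin3 j, this]; ring

/-- So `inWeight j` is the area ratio between the triangle of centres of the `j`-th child and that
of the parent. Its formula is what `area_formula` predicts when the child has κ plus the two
retained curvatures in place of κ. -/
theorem bary_soddy (D : Triple) (j : Fin 3) : D.bary j D.soddy.cent = D.inWeight j * D.area := by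
  obtain ⟨e1, e2, e3, e4⟩ := fin3_add j
  have w : D.inWeight j = 1 - D.inWeight (j + 1) - D.inWeight (j + 2) := by
    linarith [D.inWeight_add j]
  have e : D.soddy.cent = D.inWeight j * (D j).cent + D.inWeight (j + 1) * (D (j + 1)).cent +
    D.inWeight (j + 2) * (D (j + 2)).cent := by rw [soddy, sum_fin3 j]
  rw [D.area_eq j, bary, e, w]
  simp only [cross, Complex.add_re, Complex.add_im, Complex.sub_re, Complex.sub_im,
    Complex.re_ofReal_mul, Complex.im_ofReal_mul]
  ring

namespace Kissing

variable {D : Triple}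

/-- Expanding the square in the two edge vectors at the `j`-th centre leaves an identity between
rational functions of the curvatures, valid modulo κ² = ab + bc + ca. -/
theorem norm_soddy_sub (h : D.Kissing) (j : Fin 3) :
    ‖D.soddy.cent - (D j).cent‖ = D.soddy.rad + (D j).rad := by
  have ha := D.curv_pos j; have hb := D.curv_pos (j + 1); have hc := D.curv_pos (j + 2)
  have hk := D.kappa_pos; have hd := D.inCurv_pos
  have hrp := (D j).rad_pos
  have hsp := D.soddy.rad_pos
  obtain ⟨e1, e2, e3, e4⟩ := fin3_add j
  rw [← sq_eq_sq₀ (norm_nonneg _) (by positivity), D.soddy_sub_cent j]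
  set e := (D (j + 1)).cent - (D j).cent with he
  set f := (D (j + 2)).cent - (D j).cent with hf
  have expand : ‖(D.inWeight (j + 1) : ℂ) * e + D.inWeight (j + 2) * f‖ ^ 2 =
      D.inWeight (j + 1) ^ 2 * ‖e‖ ^ 2 + D.inWeight (j + 2) ^ 2 * ‖f‖ ^ 2 +
      2 * D.inWeight (j + 1) * D.inWeight (j + 2) * dot e f := by
    simp only [norm_sq_eq_dot, dot, Complex.add_re, Complex.add_im, Complex.re_ofReal_mul,
      Complex.im_ofReal_mul]; ring
  rw [expand, h.two_dot j, h.dist _ _ (fin3_ne j).1, h.dist _ _ (fin3_ne j).2.1]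
  have hk2 := D.kappa_sq j
  simp only [inWeight, e1, e2, e3, e4, soddy, D.rad_eq]
  have hdd := D.inCurv_eq j
  set a := (D j).curv
  set b := (D (j + 1)).curv
  set c := (D (j + 2)).curv
  set k := D.kappa
  set d := D.inCurv
  have main : ((a + c + k) * (a + b)) ^ 2 + ((a + b + k) * (a + c)) ^ 2 +
      2 * (a + c + k) * (a + b + k) * (b * c + a * c + a * b - a ^ 2) = (k * (a + d)) ^ 2 := by
    rw [hdd]
    linear_combination (-4 * k ^ 2 - 4 * (2 * a + b + c) * k - 4 * a ^ 2 -
      4 * (a * b + b * c + c * a)) * hk2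
  have l : (b * (c + a + k) / (k * d)) ^ 2 * (1 / a + 1 / b) ^ 2 +
      (c * (a + b + k) / (k * d)) ^ 2 * (1 / a + 1 / c) ^ 2 +
      2 * (b * (c + a + k) / (k * d)) * (c * (a + b + k) / (k * d)) *
        ((1 / a) ^ 2 + 1 / a * (1 / b) + 1 / a * (1 / c) - 1 / b * (1 / c)) =
      (((a + c + k) * (a + b)) ^ 2 + ((a + b + k) * (a + c)) ^ 2 +
      2 * (a + c + k) * (a + b + k) * (b * c + a * c + a * b - a ^ 2)) / (k * d * a) ^ 2 := by
    field_simp; ring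
  rw [l, main]
  field_simp

end Kissing

end Triple

/-! ### Uniqueness of the inscribed disk, and the three children -/

namespace Triple

namespace Kissing

variable {D : Triple}

theorem norm_sub_soddy (h : D.Kissing) (j : Fin 3) :
    ‖(D j).cent - D.soddy.cent‖ = D.soddy.rad + (D j).rad := by
  rw [norm_sub_rev, h.norm_soddy_sub]

theorem isInscribed_soddy (h : D.Kissing) : D.IsInscribed D.soddy := by
  have hsub : D.soddy.interior ⊆ D.outside := fun z hz j =>
    Disk.lt_norm_sub_of_mem_interior (h.norm_sub_soddy j) (Disk.mem_interior.1 hz)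
  have hc : D.soddy.cent ∈ D.soddy.interior := by
    rw [Disk.mem_interior, sub_self, norm_zero]; exact D.soddy.rad_pos
  have hb : ∀ j, 0 < D.bary j D.soddy.cent := fun j => by
    rw [D.bary_soddy]; exact mul_pos (D.inWeight_pos j) h.area_pos
  refine ⟨fun z hz => ?_, fun j => Disk.tangent_iff.2 (h.norm_sub_soddy j)⟩
  rw [h.idealTriangle_eq]
  exact ⟨hsub hz, h.bary_pos_of_isPreconnected (convex_ball _ _).isPreconnected hsub hc
    (fun j => (hb j).le) z hz⟩

/-- Leibniz' identity with the barycentric coordinates of y as weights: area times |x - y|² is the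
weighted sum of |x - c_j|² - |y - c_j|². No term is positive when s ≤ t. -/
theorem eq_of_norm_sub_cent (h : D.Kissing) {x y : ℂ} {s t : ℝ} (hst : s ≤ t)
    (hx : ∀ j, ‖x - (D j).cent‖ = s + (D j).rad) (hy : ∀ j, ‖y - (D j).cent‖ = t + (D j).rad)
    (hb : ∀ j, 0 ≤ D.bary j y) : x = y := by
  have ha := h.area_pos
  have key : D.area * ‖x - y‖ ^ 2 = D.bary 0 y * (‖x - (D 0).cent‖ ^ 2 - ‖y - (D 0).cent‖ ^ 2) +
      D.bary 1 y * (‖x - (D 1).cent‖ ^ 2 - ‖y - (D 1).cent‖ ^ 2) +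
      D.bary 2 y * (‖x - (D 2).cent‖ ^ 2 - ‖y - (D 2).cent‖ ^ 2) := by
    change _ = cross ((D 1).cent - y) ((D 2).cent - y) * _ +
      cross ((D 2).cent - y) ((D 0).cent - y) * _ + cross ((D 0).cent - y) ((D 1).cent - y) * _
    simp only [area, norm_sq_eq_dot, dot, cross, Complex.sub_re, Complex.sub_im]; ring
  have hle : ∀ j, D.bary j y * (‖x - (D j).cent‖ ^ 2 - ‖y - (D j).cent‖ ^ 2) ≤ 0 := fun j => by
    refine mul_nonpos_of_nonneg_of_nonpos (hb j) (sub_nonpos.2 ?_)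
    exact pow_le_pow_left₀ (norm_nonneg _) (by rw [hx, hy]; linarith) 2
  have h2 : ‖x - y‖ ^ 2 ≤ 0 := by
    by_contra hn
    push Not at hn
    have := mul_pos ha hn
    linarith [hle 0, hle 1, hle 2]
  have : ‖x - y‖ = 0 := pow_eq_zero_iff two_ne_zero |>.1 (le_antisymm h2 (sq_nonneg _))
  exact sub_eq_zero.1 (norm_eq_zero.1 this)

theorem inscribed_eq (h : D.Kissing) : D.inscribed = D.soddy := by
  have hi : D.IsInscribed D.inscribed := Classical.epsilon_spec ⟨_, h.isInscribed_soddy⟩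
  have key : ∀ B, D.IsInscribed B → (∀ j, ‖B.cent - (D j).cent‖ = B.rad + (D j).rad) ∧
      ∀ j, 0 ≤ D.bary j B.cent := by
    intro B hB
    refine ⟨fun j => by rw [norm_sub_rev]; exact Disk.tangent_iff.1 (hB.2 j), fun j => ?_⟩
    have : B.cent ∈ D.idealTriangle :=
      hB.1 (by rw [Disk.mem_interior, sub_self, norm_zero]; exact B.rad_pos)
    rw [h.idealTriangle_eq] at this
    exact (this.2 j).le
  obtain ⟨a1, a2⟩ := key _ hi
  obtain ⟨b1, b2⟩ := key _ h.isInscribed_soddy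
  have hc : D.inscribed.cent = D.soddy.cent := by
    rcases le_total D.inscribed.rad D.soddy.rad with hle | hle
    · exact h.eq_of_norm_sub_cent hle a1 b1 b2
    · exact (h.eq_of_norm_sub_cent hle b1 a1 a2).symm
  have hr : D.inscribed.rad = D.soddy.rad := by
    have := a1 0; rw [hc, b1 0] at this; linarith
  revert hc hr
  generalize D.inscribed = B
  generalize D.soddy = B'
  cases B; cases B'
  rintro rfl rfl; rfl

theorem isInscribed (h : D.Kissing) : D.IsInscribed D.inscribed := by
  rw [h.inscribed_eq]; exact h.isInscribed_soddy

theorem norm_sub_inscribed (h : D.Kissing) (j : Fin 3) :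
    ‖(D j).cent - D.inscribed.cent‖ = D.inscribed.rad + (D j).rad := by
  rw [h.inscribed_eq, h.norm_sub_soddy]

theorem norm_inscribed_sub (h : D.Kissing) (j : Fin 3) :
    ‖D.inscribed.cent - (D j).cent‖ = (D j).rad + D.inscribed.rad := by
  rw [h.inscribed_eq, h.norm_soddy_sub, add_comm]

theorem curv_inscribed (h : D.Kissing) : D.inscribed.curv = D.inCurv := by
  rw [h.inscribed_eq, Disk.curv, soddy, inv_inv]

end Kissing

theorem step_self (D : Triple) (j : Fin 3) : D.step j j = D.inscribed := Function.update_self ..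

theorem step_of_ne (D : Triple) {j k : Fin 3} (h : k ≠ j) : D.step j k = D k :=
  Function.update_of_ne h ..

theorem step_fst (D : Triple) (j : Fin 3) : D.step j (j + 1) = D (j + 1) :=
  D.step_of_ne (fin3_ne j).1.symm

theorem step_snd (D : Triple) (j : Fin 3) : D.step j (j + 2) = D (j + 2) :=
  D.step_of_ne (fin3_ne j).2.1.symm

theorem bary_step_self (D : Triple) (j : Fin 3) (z : ℂ) : (D.step j).bary j z = D.bary j z := by
  rw [bary, step_fst, step_snd, bary]

namespace Kissing

variable {D : Triple}

/-- The right-hand side is antisymmetric in j and k. This puts the children j and k on opposite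
sides of the line through the new centre and the third centre. -/
theorem bary_step_of_ne (h : D.Kissing) {j k : Fin 3} (hk : k ≠ j) (z : ℂ) :
    (D.step j).bary k z = D.inWeight j * D.bary k z - D.inWeight k * D.bary j z := by
  obtain ⟨e1, e2, e3, e4⟩ := fin3_add j
  have w : D.inWeight j = 1 - D.inWeight (j + 1) - D.inWeight (j + 2) := by
    linarith [D.inWeight_add j]
  have e : D.soddy.cent = D.inWeight j * (D j).cent + D.inWeight (j + 1) * (D (j + 1)).cent +
    D.inWeight (j + 2) * (D (j + 2)).cent := by rw [soddy, sum_fin3 j]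
  rcases fin3_cases j k with rfl | rfl | rfl
  · exact absurd rfl hk
  all_goals
    simp only [bary, e1, e2, e3, e4, step_self, step_fst, step_snd, h.inscribed_eq, e, w, cross,
      Complex.add_re, Complex.add_im, Complex.sub_re, Complex.sub_im, Complex.re_ofReal_mul,
      Complex.im_ofReal_mul]
    ring

theorem step (h : D.Kissing) (j : Fin 3) : (D.step j).Kissing := by
  constructor
  · intro k l hkl
    by_cases hk : k = j
    · subst hk
      rw [step_self, step_of_ne _ hkl.symm, h.norm_sub_inscribed]
    · by_cases hl : l = j
      · subst hl
        rw [step_self, step_of_ne _ hk, h.norm_inscribed_sub]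
      · rw [step_of_ne _ hk, step_of_ne _ hl, h.dist _ _ hkl]
  · change 0 < (D.step j).area
    rw [area_eq _ j, step_self, step_fst, step_snd]
    change 0 < D.bary j D.inscribed.cent
    rw [h.inscribed_eq, D.bary_soddy]
    exact mul_pos (D.inWeight_pos j) h.area_pos

theorem word (h : D.Kissing) (w : List (Fin 3)) : (D.word w).Kissing := by
  induction w generalizing D with
  | nil => exact h
  | cons j w ih => exact ih (h.step j)

/-- Squaring the right-hand side gives κ² of the child, once its new curvature is known to be a + b
+ c + 2κ. -/
theorem kappa_step (h : D.Kissing) (j : Fin 3) :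
    (D.step j).kappa = D.kappa + (D (j + 1)).curv + (D (j + 2)).curv := by
  have h1 := D.curv_pos (j + 1); have h2 := D.curv_pos (j + 2); have hk := D.kappa_pos
  rw [← sq_eq_sq₀ (D.step j).kappa_pos.le (by positivity), (D.step j).kappa_sq j, step_self,
    step_fst, step_snd, h.curv_inscribed, D.inCurv_eq j]
  linear_combination - D.kappa_sq j

/-- The open disk `D j` is connected and avoids the closed disks of the child. If it met the child's
triangle of centres it would lie inside it, its own centre included; but that centre has a negative
coordinate. -/
theorem not_bary_step_nonneg (h : D.Kissing) {j : Fin 3} {z : ℂ} (hz : ‖z - (D j).cent‖ < (D j).rad) :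
    ¬ ∀ k, 0 ≤ (D.step j).bary k z := by
  intro hb
  obtain ⟨n1, n2, n3⟩ := fin3_ne j
  obtain ⟨e1, e2, e3, e4⟩ := fin3_add j
  have hsub : (D j).interior ⊆ (D.step j).outside := by
    intro x hx
    have hx := Disk.mem_interior.1 hx
    refine (forall_fin3 j).2 ⟨?_, ?_, ?_⟩
    · rw [step_self]
      exact Disk.lt_norm_sub_of_mem_interior (h.norm_inscribed_sub j) hx
    · rw [step_fst]; exact Disk.lt_norm_sub_of_mem_interior (h.dist _ _ n1) hx
    · rw [step_snd]; exact Disk.lt_norm_sub_of_mem_interior (h.dist _ _ n2) hx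
  have := (h.step j).bary_pos_of_isPreconnected (convex_ball _ _).isPreconnected hsub
    (Disk.mem_interior.2 hz) hb (D j).cent
    (Metric.mem_ball_self (D j).rad_pos) (j + 1)
  rw [h.bary_step_of_ne n1.symm] at this
  have b0 : D.bary (j + 1) (D j).cent = 0 := by simp [bary, cross, e2]
  have b1 : D.bary j (D j).cent = D.area := by rw [D.area_eq j, bary]
  rw [b0, b1] at this
  have := mul_pos (D.inWeight_pos (j + 1)) h.area_pos
  linarith

theorem bary_nonneg_of_step (h : D.Kissing) {j : Fin 3} {z : ℂ} (hz : ∀ k, 0 ≤ (D.step j).bary k z)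
    (k : Fin 3) : 0 ≤ D.bary k z := by
  have h0 := hz j
  rw [bary_step_self] at h0
  by_cases hk : k = j
  · subst hk; exact h0
  · have h1 := hz k
    rw [h.bary_step_of_ne hk] at h1
    have := mul_nonneg (D.inWeight_pos k).le h0
    exact nonneg_of_mul_nonneg_right (by linarith : 0 ≤ D.inWeight j * D.bary k z) (D.inWeight_pos j)

theorem curvTriangle_step_subset (h : D.Kissing) (j : Fin 3) :
    (D.step j).curvTriangle ⊆ D.curvTriangle := by
  intro z hz k
  refine ⟨?_, h.bary_nonneg_of_step (fun k => (hz k).2) k⟩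
  by_cases hk : k = j
  · subst hk
    by_contra hlt
    exact h.not_bary_step_nonneg (not_le.1 hlt) fun k => (hz k).2
  · have := (hz k).1
    rwa [step_of_ne _ hk] at this

theorem idealTriangle_step_subset (h : D.Kissing) (j : Fin 3) :
    (D.step j).idealTriangle ⊆ D.idealTriangle := by
  intro z hz
  have hX := h.curvTriangle_step_subset j ((h.step j).subset_curvTriangle hz)
  rw [h.idealTriangle_eq]
  have hz' := hz
  rw [(h.step j).idealTriangle_eq] at hz'
  have ho : z ∈ D.outside := by
    intro k
    by_cases hk : k = j
    · subst hk
      refine lt_of_le_of_ne (hX k).1 fun he => ?_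
      have hcl : z ∈ closure (Metric.ball (D k).cent (D k).rad) := by
        rw [closure_ball _ (D k).rad_pos.ne', Metric.mem_closedBall, dist_eq_norm, he]
      obtain ⟨x, hx1, hx2⟩ := mem_closure_iff.1 hcl _ (h.step k).isOpen_idealTriangle hz
      have := (h.curvTriangle_step_subset k ((h.step k).subset_curvTriangle hx1) k).1
      rw [Metric.mem_ball, dist_eq_norm] at hx2
      linarith
    · have := hz'.1 k
      rwa [step_of_ne _ hk] at this
  exact ⟨ho, h.bary_pos_of_nonneg ho fun j => (hX j).2⟩

/-- The segments from the new centre to the three old ones cut the triangle of centres into three.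
The part containing z is found by minimising `bary j z / inWeight j`, since then all differences in
`bary_step_of_ne` are nonnegative. -/
theorem exists_step_of_mem (h : D.Kissing) {z : ℂ} (hz : z ∈ D.curvTriangle)
    (hi : z ∉ D.inscribed.interior) : ∃ j, z ∈ (D.step j).curvTriangle := by
  obtain ⟨j, -, hj⟩ := Finset.exists_min_image Finset.univ (fun j => D.bary j z / D.inWeight j)
    ⟨0, Finset.mem_univ _⟩
  refine ⟨j, fun k => ?_⟩
  by_cases hk : k = j
  · subst hk
    rw [bary_step_self, step_self]
    exact ⟨not_lt.1 fun hlt => hi (Disk.mem_interior.2 hlt), (hz k).2⟩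
  · rw [step_of_ne _ hk, h.bary_step_of_ne hk]
    refine ⟨(hz k).1, ?_⟩
    have := hj k (Finset.mem_univ _)
    rw [div_le_div_iff₀ (D.inWeight_pos j) (D.inWeight_pos k)] at this
    linarith

theorem disjoint_step (h : D.Kissing) {j k : Fin 3} (hjk : j ≠ k) :
    Disjoint (D.step j).idealTriangle (D.step k).curvTriangle := by
  refine Set.disjoint_left.2 fun z hz hz' => ?_
  rw [(h.step j).idealTriangle_eq] at hz
  have a := hz.2 k
  have b := (hz' j).2
  rw [h.bary_step_of_ne hjk.symm] at a
  rw [h.bary_step_of_ne hjk] at b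
  linarith

theorem interior_inscribed_word_subset (h : D.Kissing) (w : List (Fin 3)) :
    (D.word w).inscribed.interior ⊆ D.idealTriangle := by
  induction w generalizing D with
  | nil => exact h.isInscribed.1
  | cons j w ih => exact (ih (h.step j)).trans (h.idealTriangle_step_subset j)

theorem mem_gasket (h : D.Kissing) {z : ℂ} : z ∈ D.gasket ↔
    z ∈ D.curvTriangle ∧ ∀ w, z ∉ (D.word w).inscribed.interior := by
  simp [gasket, h.closure_idealTriangle]

/-- Self-similarity: the gasket is the union of the gaskets of its children. For the converse, the
disks of words with another first letter lie in the open ideal triangle of another child, which is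
disjoint from the closed cell `j`. -/
theorem mem_gasket_iff_step (h : D.Kissing) {z : ℂ} :
    z ∈ D.gasket ↔ ∃ j, z ∈ (D.step j).gasket := by
  rw [h.mem_gasket]
  constructor
  · rintro ⟨hz, hw⟩
    obtain ⟨j, hj⟩ := h.exists_step_of_mem hz (hw [])
    exact ⟨j, (h.step j).mem_gasket.2 ⟨hj, fun w => hw (j :: w)⟩⟩
  · rintro ⟨j, hj⟩
    obtain ⟨hX, hw⟩ := (h.step j).mem_gasket.1 hj
    refine ⟨h.curvTriangle_step_subset j hX, fun w => ?_⟩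
    match w with
    | [] =>
      have := (hX j).1
      rw [step_self] at this
      exact fun hlt => absurd (Disk.mem_interior.1 hlt) this.not_gt
    | k :: w =>
      by_cases hk : k = j
      · subst hk; exact hw w
      · exact fun hlt => Set.disjoint_left.1 (h.disjoint_step hk)
          ((h.step k).interior_inscribed_word_subset w hlt) hX

theorem gasket_word_subset (h : D.Kissing) (w : List (Fin 3)) : (D.word w).gasket ⊆ D.gasket := by
  induction w generalizing D with
  | nil => exact subset_rfl
  | cons j w ih => exact (ih (h.step j)).trans fun z hz => h.mem_gasket_iff_step.2 ⟨j, hz⟩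

theorem isCompact_gasket (h : D.Kissing) : IsCompact D.gasket := by
  rw [gasket, h.closure_idealTriangle]
  exact h.isCompact_curvTriangle.diff (isOpen_iUnion fun w => Metric.isOpen_ball)

theorem boundary_inscribed_subset (h : D.Kissing) : D.inscribed.boundary ⊆ D.gasket := by
  intro z hz
  have hz' := Disk.mem_boundary.1 hz
  refine h.mem_gasket.2 ⟨?_, fun w => ?_⟩
  · rw [← h.closure_idealTriangle]
    refine closure_mono h.isInscribed.1 ?_
    rw [Disk.interior, closure_ball _ D.inscribed.rad_pos.ne', Metric.mem_closedBall, dist_eq_norm]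
    exact hz'.le
  · match w with
    | [] => exact fun hlt => absurd hz' (Disk.mem_interior.1 hlt).ne
    | k :: w =>
      intro hlt
      have := (h.step k).interior_inscribed_word_subset w hlt
      rw [(h.step k).idealTriangle_eq] at this
      have := this.1 k
      rw [step_self] at this
      linarith

theorem arc_subset_gasket (h : D.Kissing) (i : ArcIndex) : D.arc i ⊆ D.gasket := by
  match i with
  | Sum.inr w => exact (h.word w).boundary_inscribed_subset.trans (h.gasket_word_subset w)
  | Sum.inl j =>
    rintro z ⟨hz, hz'⟩
    rw [h.closure_idealTriangle] at hz
    refine h.mem_gasket.2 ⟨hz, fun w hlt => ?_⟩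
    have := h.interior_inscribed_word_subset w hlt
    rw [h.idealTriangle_eq] at this
    have := this.1 j
    rw [Disk.mem_boundary.1 hz'] at this
    exact lt_irrefl _ this

theorem arcUnion_subset_gasket (h : D.Kissing) : D.arcUnion ⊆ D.gasket :=
  Set.iUnion_subset h.arc_subset_gasket

theorem le_kappa_word (h : D.Kissing) {s : ℝ} (hs : ∀ j, s ≤ (D j).curv) (w : List (Fin 3)) :
    D.kappa + 2 * w.length * s ≤ (D.word w).kappa := by
  induction w generalizing D with
  | nil => simp [Triple.word]
  | cons j w ih =>
    have h1 : ∀ k, s ≤ (D.step j k).curv := by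
      intro k
      by_cases hk : k = j
      · subst hk
        rw [step_self, h.curv_inscribed, D.inCurv_eq k]
        have := D.curv_pos (k + 1); have := D.curv_pos (k + 2); have := D.kappa_pos
        linarith [hs k]
      · rw [step_of_ne _ hk]; exact hs k
    have := ih (h.step j) h1
    rw [h.kappa_step] at this
    change _ ≤ ((D.step j).word w).kappa
    push_cast [List.length_cons]
    linarith [hs (j + 1), hs (j + 2)]

end Kissing

end Triple

/-! ### Angles between directions, and integrals over circles -/

open Real in
theorem arg_div_mem_Ioo {a b : ℂ} (h : 0 < cross a b) : (b / a).arg ∈ Set.Ioo 0 π := by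
  have ha : a ≠ 0 := by rintro rfl; simp [cross] at h
  have him : 0 < (b / a).im := by
    have : (b / a).im = cross a b / Complex.normSq a := by
      rw [Complex.div_im, cross]; ring
    rw [this]; exact div_pos h (Complex.normSq_pos.2 ha)
  have h1 : 0 ≤ (b / a).arg := Complex.arg_nonneg_iff.2 him.le
  refine ⟨lt_of_le_of_ne h1 fun h0 => ?_, lt_of_le_of_ne (Complex.arg_le_pi _) fun h0 => ?_⟩
  · exact him.ne' (Complex.arg_eq_zero_iff.1 h0.symm).2
  · exact him.ne' (Complex.arg_eq_pi_iff.1 h0).2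

/-- The unit vector in the direction of `a`. -/
def unitVec (a : ℂ) : ℂ := a / ‖a‖

theorem norm_unitVec {a : ℂ} (h : a ≠ 0) : ‖unitVec a‖ = 1 := by
  rw [unitVec, norm_div, Complex.norm_real, norm_norm, div_self (norm_ne_zero_iff.2 h)]

theorem unitVec_mul_exp {a b : ℂ} (ha : a ≠ 0) (hb : b ≠ 0) :
    unitVec a * Complex.exp ((b / a).arg * Complex.I) = unitVec b := by
  have h1 : (‖a‖ : ℂ) ≠ 0 := by exact_mod_cast norm_ne_zero_iff.2 ha
  have h2 : (‖b‖ : ℂ) ≠ 0 := by exact_mod_cast norm_ne_zero_iff.2 hb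
  have := Complex.norm_mul_exp_arg_mul_I (b / a)
  rw [norm_div, Complex.ofReal_div, mul_comm] at this
  rw [unitVec, unitVec]
  have e : Complex.exp ((b / a).arg * Complex.I) = b / a * ‖a‖ / ‖b‖ := by
    rw [← eq_div_iff (div_ne_zero h2 h1)] at this
    rw [this]; field_simp
  rw [e]; field_simp

/-- Arguments add modulo 2π; as all three lie in (0, π), the multiple of 2π vanishes. In the cyclic
version below the same size count leaves exactly one full turn. -/
theorem arg_div_add {a b c : ℂ} (hab : 0 < cross a b) (hbc : 0 < cross b c) (hac : 0 < cross a c) :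
    (b / a).arg + (c / b).arg = (c / a).arg := by
  have ha : a ≠ 0 := by rintro rfl; simp [cross] at hab
  have hb : b ≠ 0 := by rintro rfl; simp [cross] at hab
  have hc : c ≠ 0 := by rintro rfl; simp [cross] at hbc
  have h1 := arg_div_mem_Ioo hab
  have h2 := arg_div_mem_Ioo hbc
  have h3 := arg_div_mem_Ioo hac
  have e : c / a = (b / a) * (c / b) := by field_simp
  have key := Complex.arg_mul_coe_angle (div_ne_zero hb ha) (div_ne_zero hc hb)
  rw [← e, ← Real.Angle.coe_add, Real.Angle.angle_eq_iff_two_pi_dvd_sub] at key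
  obtain ⟨k, hk⟩ := key
  have hp := Real.pi_pos
  have k1 : (-1 : ℝ) < k := by
    by_contra hh; push Not at hh; nlinarith [h1.1, h1.2, h2.1, h2.2, h3.1, h3.2]
  have k2 : (k : ℝ) < 1 := by
    by_contra hh; push Not at hh; nlinarith [h1.1, h1.2, h2.1, h2.2, h3.1, h3.2]
  have : k = 0 := by
    have k1 : (-1 : ℤ) < k := by exact_mod_cast k1
    have k2 : k < 1 := by exact_mod_cast k2
    omega
  rw [this] at hk; simp at hk; linarith

open Real in
theorem arg_div_add_add {a b c : ℂ} (hab : 0 < cross a b) (hbc : 0 < cross b c)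
    (hca : 0 < cross c a) : (b / a).arg + (c / b).arg + (a / c).arg = 2 * π := by
  have ha : a ≠ 0 := by rintro rfl; simp [cross] at hab
  have hb : b ≠ 0 := by rintro rfl; simp [cross] at hab
  have hc : c ≠ 0 := by rintro rfl; simp [cross] at hbc
  have h1 := arg_div_mem_Ioo hab
  have h2 := arg_div_mem_Ioo hbc
  have h3 := arg_div_mem_Ioo hca
  have e : (b / a) * (c / b) * (a / c) = 1 := by field_simp
  have key := Complex.arg_mul_coe_angle (mul_ne_zero (div_ne_zero hb ha) (div_ne_zero hc hb))
    (div_ne_zero ha hc)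
  rw [e, Complex.arg_mul_coe_angle (div_ne_zero hb ha) (div_ne_zero hc hb), Complex.arg_one,
    ← Real.Angle.coe_add, ← Real.Angle.coe_add, Real.Angle.angle_eq_iff_two_pi_dvd_sub] at key
  obtain ⟨k, hk⟩ := key
  have hp := Real.pi_pos
  have k1 : (-2 : ℝ) < k := by
    by_contra hh; push Not at hh; nlinarith [h1.1, h1.2, h2.1, h2.2, h3.1, h3.2]
  have k2 : (k : ℝ) < 0 := by
    by_contra hh; push Not at hh; nlinarith [h1.1, h1.2, h2.1, h2.2, h3.1, h3.2]
  have : k = -1 := by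
    have k1 : (-2 : ℤ) < k := by exact_mod_cast k1
    have k2 : k < 0 := by exact_mod_cast k2
    omega
  rw [this] at hk; simp at hk; linarith

namespace Disk

/-- The point of the boundary circle reached from the direction `v` by a rotation of angle `t`. -/
def pt (B : Disk) (v : ℂ) (t : ℝ) : ℂ := B.cent + B.rad * v * Complex.exp (t * Complex.I)

theorem pt_add (B : Disk) (v : ℂ) (s t : ℝ) :
    B.pt v (s + t) = B.pt (v * Complex.exp (s * Complex.I)) t := by
  simp only [pt, Complex.ofReal_add, add_mul, Complex.exp_add]; ring

theorem pt_sub_cent (B : Disk) (v : ℂ) (t : ℝ) :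
    B.pt v t - B.cent = B.rad * v * Complex.exp (t * Complex.I) := by rw [pt]; ring

theorem norm_pt_sub_cent (B : Disk) {v : ℂ} (hv : ‖v‖ = 1) (t : ℝ) : ‖B.pt v t - B.cent‖ = B.rad := by
  rw [pt_sub_cent, norm_mul, norm_mul, hv, Complex.norm_exp_ofReal_mul_I, Complex.norm_real,
    Real.norm_eq_abs, abs_of_pos B.rad_pos, mul_one, mul_one]

theorem pt_mem_boundary (B : Disk) {v : ℂ} (hv : ‖v‖ = 1) (t : ℝ) : B.pt v t ∈ B.boundary :=
  mem_boundary.2 (B.norm_pt_sub_cent hv t)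

theorem continuous_pt (B : Disk) (v : ℂ) : Continuous (B.pt v) := by unfold pt; fun_prop

theorem periodic_pt (B : Disk) (v : ℂ) : Function.Periodic (B.pt v) (2 * Real.pi) := fun t => by
  simp only [pt]
  congr 2
  push_cast
  exact Complex.exp_mul_I_periodic _

theorem exists_pt_eq (B : Disk) {v : ℂ} (hv : ‖v‖ = 1) {x : ℂ} (hx : x ∈ B.boundary) :
    ∃ t ∈ Set.Ioc (-Real.pi) Real.pi, B.pt v t = x := by
  have hr : (B.rad : ℂ) ≠ 0 := by exact_mod_cast B.rad_pos.ne'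
  have hv0 : v ≠ 0 := by rintro rfl; simp at hv
  refine ⟨((x - B.cent) / (B.rad * v)).arg, Complex.arg_mem_Ioc _, ?_⟩
  have := Complex.norm_mul_exp_arg_mul_I ((x - B.cent) / (B.rad * v))
  rw [norm_div, mem_boundary.1 hx, norm_mul, hv, Complex.norm_real, Real.norm_eq_abs,
    abs_of_pos B.rad_pos, mul_one, div_self B.rad_pos.ne', Complex.ofReal_one, one_mul] at this
  rw [pt, this]; field_simp; ring

end Disk

/-- Translation of a Lebesgue integral over an interval. -/
theorem setLIntegral_Ioc_add (G : ℝ → ℝ≥0∞) (a b c : ℝ) :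
    ∫⁻ t in Set.Ioc a b, G (c + t) = ∫⁻ t in Set.Ioc (c + a) (c + b), G t := by
  have h := (measurePreserving_add_left volume c).setLIntegral_comp_preimage_emb
    (MeasurableEquiv.addLeft c).measurableEmbedding G (Set.Ioc (c + a) (c + b))
  rw [← h]; congr 2; ext x; simp

theorem setLIntegral_Ioc_add_Ioc (G : ℝ → ℝ≥0∞) {a b : ℝ} (ha : 0 ≤ a) (hb : 0 ≤ b) :
    (∫⁻ t in Set.Ioc 0 a, G t) + ∫⁻ t in Set.Ioc 0 b, G (a + t) = ∫⁻ t in Set.Ioc 0 (a + b), G t := by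
  rw [setLIntegral_Ioc_add, add_zero, ← lintegral_union measurableSet_Ioc
    (Set.Ioc_disjoint_Ioc_of_le le_rfl), Set.Ioc_union_Ioc_eq_Ioc ha (by linarith)]

theorem setLIntegral_Ioc_periodic {G : ℝ → ℝ≥0∞} (hG : Function.Periodic G (2 * Real.pi)) (a b : ℝ) :
    ∫⁻ t in Set.Ioc a (a + 2 * Real.pi), G t = ∫⁻ t in Set.Ioc b (b + 2 * Real.pi), G t := by
  refine (isAddFundamentalDomain_Ioc Real.two_pi_pos a).setLIntegral_eq
    (isAddFundamentalDomain_Ioc Real.two_pi_pos b) _ ?_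
  rintro ⟨g, hg⟩ x
  obtain ⟨k, rfl⟩ := hg
  change G (k • (2 * Real.pi) + x) = G x
  rw [add_comm]; exact hG.zsmul k x

/-- The integral, in the angular variable, of `F B` over the boundary circle of `B`. -/
def circInt (F : Disk → ℂ → ℝ≥0∞) (B : Disk) : ℝ≥0∞ :=
  ∫⁻ t in Set.Ioc 0 (2 * Real.pi), F B (B.pt 1 t)

theorem circInt_eq (F : Disk → ℂ → ℝ≥0∞) (B : Disk) {v : ℂ} (hv : ‖v‖ = 1) :
    circInt F B = ∫⁻ t in Set.Ioc 0 (2 * Real.pi), F B (B.pt v t) := by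
  have e : v = 1 * Complex.exp (v.arg * Complex.I) := by
    have := Complex.norm_mul_exp_arg_mul_I v
    rw [hv] at this; rw [one_mul]; simpa using this.symm
  have h : ∀ t, F B (B.pt v t) = F B (B.pt 1 (v.arg + t)) := fun t => by rw [Disk.pt_add, ← e]
  simp only [h]
  rw [setLIntegral_Ioc_add (fun t => F B (B.pt 1 t)), add_zero, circInt]
  have := setLIntegral_Ioc_periodic (G := fun t => F B (B.pt 1 t))
    (fun t => by simp only [B.periodic_pt 1 t]) 0 v.arg
  rwa [zero_add] at this

theorem tsum_list_eq {α : Type*} [Fintype α] (g : List α → ℝ≥0∞) :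
    ∑' w, g w = g [] + ∑ k, ∑' w, g (k :: w) := by
  let e : Unit ⊕ (α × List α) ≃ List α :=
    { toFun := Sum.elim (fun _ => []) fun p => p.1 :: p.2
      invFun := fun w => match w with
        | [] => Sum.inl ()
        | a :: w => Sum.inr (a, w)
      left_inv := by rintro (_ | ⟨a, w⟩) <;> rfl
      right_inv := by rintro (_ | ⟨a, w⟩) <;> rfl }
  rw [← e.tsum_eq, Summable.tsum_sum ENNReal.summable ENNReal.summable]
  congr 1
  · simp [e]
  · rw [ENNReal.tsum_prod', tsum_fintype]; rfl

/-! ### Subdivision of arcs and additivity of integrals -/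

namespace Triple

/-- The angle of the triangle of centres at the `j`-th centre. -/
def angle (D : Triple) (j : Fin 3) : ℝ :=
  (((D (j + 2)).cent - (D j).cent) / ((D (j + 1)).cent - (D j).cent)).arg

/-- The direction from the `j`-th centre to the following one. -/
def dir (D : Triple) (j : Fin 3) : ℂ := unitVec ((D (j + 1)).cent - (D j).cent)

/-- The point of the `j`-th side with angular parameter `t`. -/
def sidePt (D : Triple) (j : Fin 3) (t : ℝ) : ℂ := (D j).pt (D.dir j) t

/-- The integral, in the angular variable, of `F` over the `j`-th side. -/
def sideInt (F : Disk → ℂ → ℝ≥0∞) (D : Triple) (j : Fin 3) : ℝ≥0∞ :=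
  ∫⁻ t in Set.Ioc 0 (D.angle j), F (D j) (D.sidePt j t)

/-- The integral of `F` over the circles of the gasket. -/
def innerInt (F : Disk → ℂ → ℝ≥0∞) (D : Triple) : ℝ≥0∞ := ∑' w, circInt F (D.word w).inscribed

/-- The integral of `F` over all arcs of the gasket. -/
def totalInt (F : Disk → ℂ → ℝ≥0∞) (D : Triple) : ℝ≥0∞ := ∑ j, sideInt F D j + innerInt F D

theorem innerInt_eq (F : Disk → ℂ → ℝ≥0∞) (D : Triple) :
    innerInt F D = circInt F D.inscribed + ∑ k, innerInt F (D.step k) := tsum_list_eq _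

namespace Kissing

variable {D : Triple}

theorem cent_sub_ne_zero (h : D.Kissing) {j k : Fin 3} (hjk : j ≠ k) : (D k).cent - (D j).cent ≠ 0 := by
  rw [← norm_pos_iff, h.dist _ _ hjk]
  have := (D j).rad_pos; have := (D k).rad_pos; positivity

theorem norm_dir (h : D.Kissing) (j : Fin 3) : ‖D.dir j‖ = 1 :=
  norm_unitVec (h.cent_sub_ne_zero (fin3_ne j).1)

theorem angle_mem (h : D.Kissing) (j : Fin 3) : D.angle j ∈ Set.Ioo 0 Real.pi :=
  arg_div_mem_Ioo (by rw [← D.area_eq j]; exact h.area_pos)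

theorem cross_snd (h : D.Kissing) (j : Fin 3) :
    0 < cross ((D (j + 1)).cent - (D j).cent) (D.inscribed.cent - (D j).cent) := by
  have := (h.step (j + 2)).area_pos
  obtain ⟨n1, n2, n3⟩ := fin3_ne j
  rwa [area_eq _ j, step_of_ne _ n2, step_of_ne _ n3, step_self] at this

theorem cross_fst (h : D.Kissing) (j : Fin 3) :
    0 < cross (D.inscribed.cent - (D j).cent) ((D (j + 2)).cent - (D j).cent) := by
  have := (h.step (j + 1)).area_pos
  obtain ⟨n1, n2, n3⟩ := fin3_ne j
  rwa [area_eq _ j, step_of_ne _ n1, step_of_ne _ n3.symm, step_self] at this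

theorem cross_self (h : D.Kissing) (j : Fin 3) :
    0 < cross ((D (j + 1)).cent - D.inscribed.cent) ((D (j + 2)).cent - D.inscribed.cent) := by
  have := (h.step j).area_pos
  rwa [area_eq _ j, step_self, step_fst, step_snd] at this

theorem sidePt_step_snd (j : Fin 3) : (D.step (j + 2)).sidePt j = D.sidePt j := by
  obtain ⟨n1, n2, n3⟩ := fin3_ne j
  ext t; rw [sidePt, sidePt, dir, dir, step_of_ne _ n2, step_of_ne _ n3]

theorem angle_add (h : D.Kissing) (j : Fin 3) :
    (D.step (j + 2)).angle j + (D.step (j + 1)).angle j = D.angle j := by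
  obtain ⟨n1, n2, n3⟩ := fin3_ne j
  rw [angle, angle, angle, step_of_ne _ n1, step_of_ne _ n2, step_of_ne _ n3, step_of_ne _ n3.symm,
    step_self, step_self]
  exact arg_div_add (h.cross_snd j) (h.cross_fst j) (by rw [← D.area_eq j]; exact h.area_pos)

theorem sidePt_step_fst (h : D.Kissing) (j : Fin 3) (t : ℝ) :
    (D.step (j + 1)).sidePt j t = D.sidePt j ((D.step (j + 2)).angle j + t) := by
  obtain ⟨n1, n2, n3⟩ := fin3_ne j
  rw [sidePt, sidePt, Disk.pt_add, dir, dir, angle, step_of_ne _ n1, step_of_ne _ n2,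
    step_of_ne _ n3, step_self, step_self, 
    unitVec_mul_exp (h.cent_sub_ne_zero n1)
      (by rw [← norm_pos_iff, h.norm_inscribed_sub]; have := (D j).rad_pos; have := D.inscribed.rad_pos; positivity)]

/-- The ray from the `j`-th centre to the new centre splits the angle: the first piece of the side
belongs to the child `j + 2`, the remaining one to the child `j + 1`. -/
theorem sideInt_step (h : D.Kissing) (F : Disk → ℂ → ℝ≥0∞) (j : Fin 3) :
    sideInt F (D.step (j + 2)) j + sideInt F (D.step (j + 1)) j = sideInt F D j := by
  obtain ⟨n1, n2, n3⟩ := fin3_ne j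
  have h1 := (h.step (j + 2)).angle_mem j
  have h2 := (h.step (j + 1)).angle_mem j
  rw [sideInt, sideInt, sideInt, sidePt_step_snd, step_of_ne _ n1, step_of_ne _ n2, ← h.angle_add j,
    ← setLIntegral_Ioc_add_Ioc _ h1.1.le h2.1.le]
  simp only [h.sidePt_step_fst]

theorem angle_step_self_add (h : D.Kissing) :
    (D.step 0).angle 0 + (D.step 1).angle 1 + (D.step 2).angle 2 = 2 * Real.pi := by
  have e : ∀ j, (D.step j).angle j = (((D (j + 2)).cent - D.inscribed.cent) /
      ((D (j + 1)).cent - D.inscribed.cent)).arg := fun j => by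
    rw [angle, step_self, step_fst, step_snd]
  rw [e, e, e]
  exact arg_div_add_add (h.cross_self 0) (h.cross_self 1) (h.cross_self 2)

theorem sidePt_step_self (j : Fin 3) (t : ℝ) : (D.step j).sidePt j t =
    D.inscribed.pt (unitVec ((D (j + 1)).cent - D.inscribed.cent)) t := by
  rw [sidePt, dir, step_self, step_fst]

theorem cent_sub_inscribed_ne_zero (h : D.Kissing) (j : Fin 3) :
    (D j).cent - D.inscribed.cent ≠ 0 := by
  rw [← norm_pos_iff, h.norm_sub_inscribed]
  have := (D j).rad_pos; have := D.inscribed.rad_pos; positivity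

theorem sidePt_step_self_add (h : D.Kissing) (j : Fin 3) (t : ℝ) :
    (D.step (j + 1)).sidePt (j + 1) t = (D.step j).sidePt j ((D.step j).angle j + t) := by
  obtain ⟨e1, e2, e3, e4⟩ := fin3_add j
  rw [sidePt_step_self, sidePt_step_self, Disk.pt_add, e1, angle, step_self, step_fst, step_snd,
    unitVec_mul_exp (h.cent_sub_inscribed_ne_zero _) (h.cent_sub_inscribed_ne_zero _)]

/-- Seen from the new centre, the three old centres divide the full turn, so the inscribed circle is
made up of one side of each child. -/
theorem circInt_step (h : D.Kissing) (F : Disk → ℂ → ℝ≥0∞) :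
    ∑ j, sideInt F (D.step j) j = circInt F D.inscribed := by
  have h0 := (h.step 0).angle_mem 0
  have h1 := (h.step 1).angle_mem 1
  have h2 := (h.step 2).angle_mem 2
  rw [circInt_eq F D.inscribed (norm_unitVec (h.cent_sub_inscribed_ne_zero (0 + 1))),
    ← h.angle_step_self_add, ← setLIntegral_Ioc_add_Ioc _ (by linarith [h0.1, h1.1]) h2.1.le,
    ← setLIntegral_Ioc_add_Ioc _ h0.1.le h1.1.le, Fin.sum_univ_three]
  simp only [sideInt, step_self, ← sidePt_step_self]
  congr 2
  · refine lintegral_congr fun t => ?_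
    rw [← h.sidePt_step_self_add 0]; rfl
  · funext t
    rw [add_assoc, ← h.sidePt_step_self_add 0]
    exact congrArg _ (h.sidePt_step_self_add 1 t)

/-- Six of the nine sides of the children reassemble the three old sides, the other three the
inscribed circle. This exact additivity carries the inductions over words in the Lipschitz
approximation and in the compactness proof. -/
theorem totalInt_step (h : D.Kissing) (F : Disk → ℂ → ℝ≥0∞) :
    totalInt F D = ∑ k, totalInt F (D.step k) := by
  simp only [totalInt]
  rw [Finset.sum_add_distrib, innerInt_eq, ← h.circInt_step F, ← add_assoc]
  congr 1
  simp only [← h.sideInt_step F]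
  simp only [Fin.sum_univ_three]
  change _ = sideInt F (D.step 0) 0 + sideInt F (D.step 0) 1 + sideInt F (D.step 0) 2 + _ + _
  change sideInt F (D.step 2) 0 + sideInt F (D.step 1) 0 + (sideInt F (D.step 0) 1 +
    sideInt F (D.step 2) 1) + (sideInt F (D.step 1) 2 + sideInt F (D.step 0) 2) + _ = _
  ring

end Kissing

end Triple

/-! ### Inequalities between curvatures, and sums over words -/

theorem area_supersolution {a b c k d : ℝ} (ha : 0 < a) (hb : 0 < b) (hc : 0 < c) (hk : 0 < k)
    (h : k ^ 2 = a * b + b * c + c * a) (hd : d = a + b + c + 2 * k) :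
    (d⁻¹) ^ 2 + ((k + b + c) / (2 * ((b + c) * (c + d) * (d + b))) +
      (k + c + a) / (2 * ((d + c) * (c + a) * (a + d))) +
      (k + a + b) / (2 * ((b + d) * (d + a) * (a + b)))) ≤ k / (2 * ((b + c) * (c + a) * (a + b))) := by
  -- Modulo k² = ab + bc + ca the symmetric polynomials below depend only on p = a + b + c, e = abc
  -- and k, and in these variables the cleared numerator has nonnegative coefficients. The
  -- inequality says that the squared inscribed radius plus the values of `radBound` at the children
  -- is at most `radBound` of the parent.
  obtain ⟨p, hp⟩ : ∃ p, p = a + b + c := ⟨_, rfl⟩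
  obtain ⟨e, he⟩ : ∃ e, e = a * b * c := ⟨_, rfl⟩
  have hp0 : 0 < p := by rw [hp]; positivity
  have he0 : 0 < e := by rw [he]; positivity
  have hd0 : 0 < d := by rw [hd]; positivity
  have hm : (b + c) * (c + a) * (a + b) = p * k ^ 2 - e := by rw [hp, he, h]; ring
  have hdp : d = p + 2 * k := by rw [hd, hp]
  have hT : (d + a) * (d + b) * (d + c) =
      (2 * p + 3 * k) * (p + 2 * k) ^ 2 -
      (k ^ 3 + 2 * p * k ^ 2 + (p ^ 2 + k ^ 2) * k + (p * k ^ 2 - e)) := by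
    rw [hdp, hp, he]; linear_combination (-a - b - c - 2 * k) * h
  have hS : (k + b + c) * (d + a) * ((c + a) * (a + b)) + (k + c + a) * (d + b) * ((b + c) * (a + b)) +
      (k + a + b) * (d + c) * ((b + c) * (c + a)) =
      (p ^ 2 + k ^ 2) * (p + 2 * k) ^ 2 - (k ^ 2 * (p ^ 2 + k ^ 2) +
      k * (2 * p * (p ^ 2 + k ^ 2) - 3 * (p * k ^ 2 - e)) + (p ^ 2 + k ^ 2) ^ 2 -
        4 * p * (p * k ^ 2 - e)) := by
    rw [hdp, hp, he]
    linear_combination (-4 * (a + b + c) ^ 2 - 5 * k * (a + b + c) - 2 * k ^ 2) * h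
  have hN : 0 ≤ k * ((d + a) * (d + b) * (d + c)) * d ^ 2 -
      ((k + b + c) * (d + a) * ((c + a) * (a + b)) + (k + c + a) * (d + b) * ((b + c) * (a + b)) +
      (k + a + b) * (d + c) * ((b + c) * (c + a))) * d ^ 2 -
      2 * ((d + a) * (d + b) * (d + c)) * ((b + c) * (c + a) * (a + b)) := by
    rw [hm, hT, hS, hdp]
    have : 0 ≤ 8*p^3*e + 8*p^3*k^3 + 40*p^2*e*k + 38*p^2*k^4 + 64*p*e*k^2 + 60*p*k^5 + 2*e^2 +
      36*e*k^3 + 32*k^6 := by positivity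
    refine this.trans (le_of_eq ?_)
    ring
  rw [← sub_nonneg]
  have : k / (2 * ((b + c) * (c + a) * (a + b))) -
      ((d⁻¹) ^ 2 + ((k + b + c) / (2 * ((b + c) * (c + d) * (d + b))) +
      (k + c + a) / (2 * ((d + c) * (c + a) * (a + d))) +
      (k + a + b) / (2 * ((b + d) * (d + a) * (a + b))))) =
      (k * ((d + a) * (d + b) * (d + c)) * d ^ 2 -
      ((k + b + c) * (d + a) * ((c + a) * (a + b)) + (k + c + a) * (d + b) * ((b + c) * (a + b)) +
      (k + a + b) * (d + c) * ((b + c) * (c + a))) * d ^ 2 -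
      2 * ((d + a) * (d + b) * (d + c)) * ((b + c) * (c + a) * (a + b))) /
      (2 * ((d + a) * (d + b) * (d + c)) * ((b + c) * (c + a) * (a + b)) * d ^ 2) := by
    rw [add_comm c d, add_comm a d, add_comm b d]
    generalize hx : d + a = x at *
    generalize hy : d + b = y at *
    generalize hz : d + c = z at *
    generalize hu : b + c = u at *
    generalize hv : c + a = v at *
    generalize hw : a + b = w at *
    have : 0 < x := by rw [← hx]; positivity
    have : 0 < y := by rw [← hy]; positivity
    have : 0 < z := by rw [← hz]; positivity
    have : 0 < u := by rw [← hu]; positivity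
    have : 0 < v := by rw [← hv]; positivity
    have : 0 < w := by rw [← hw]; positivity
    field_simp
    ring
  rw [this]
  exact div_nonneg hN (by positivity)

theorem le_mul_sums {a b c k : ℝ} (ha : 0 < a) (hb : 0 < b) (hc : 0 < c)
    (h : k ^ 2 = a * b + b * c + c * a) :
    8 / 9 * (a + b + c) * k ^ 2 ≤ (b + c) * (c + a) * (a + b) := by
  rw [h]
  nlinarith [mul_nonneg ha.le (sq_nonneg (b - c)), mul_nonneg hb.le (sq_nonneg (c - a)),
    mul_nonneg hc.le (sq_nonneg (a - b))]

/-- 27/16 is a rational number below √3. Combined with the factor 8/9 of `le_mul_sums` it makes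
(b+c)(c+a)(a+b) at least (3/2)k³. -/
theorem mul_le_sum {a b c k : ℝ} (ha : 0 < a) (hb : 0 < b) (hc : 0 < c) (hk : 0 < k)
    (h : k ^ 2 = a * b + b * c + c * a) : 27 / 16 * k ≤ a + b + c := by
  refine (sq_le_sq₀ (by positivity) (by positivity)).1 ?_
  nlinarith [sq_nonneg (a - b), sq_nonneg (b - c), sq_nonneg (c - a)]

/-- Makes (3/2)κ⁻² a supersolution whose source term is `radBound`; the curvature sums k+b+c, k+c+a,
k+a+b are the values of κ at the children. -/
theorem kappa_supersolution {a b c k : ℝ} (ha : 0 < a) (hb : 0 < b) (hc : 0 < c) (hk : 0 < k)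
    (h : k ^ 2 = a * b + b * c + c * a) :
    k / (2 * ((b + c) * (c + a) * (a + b))) + 3 / 2 * ((k + b + c)⁻¹ ^ 2 + (k + c + a)⁻¹ ^ 2 +
      (k + a + b)⁻¹ ^ 2) ≤ 3 / 2 * k⁻¹ ^ 2 := by
  -- Shifting a + b + c and (b+c)(c+a)(a+b) by their lower bounds leaves slacks r, q ≥ 0. Expressed
  -- in r, q and k, the cleared numerator has nonnegative coefficients.
  obtain ⟨r, hr⟩ : ∃ r, r = a + b + c - 3 / 2 * k := ⟨_, rfl⟩
  obtain ⟨q, hq⟩ : ∃ q, q = (b + c) * (c + a) * (a + b) - 8 / 9 * (a + b + c) * k ^ 2 := ⟨_, rfl⟩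
  have hr0 : 0 ≤ r := by have := mul_le_sum ha hb hc hk h; linarith
  have hq0 : 0 ≤ q := by have := le_mul_sums ha hb hc h; linarith
  have hp : a + b + c = 3 / 2 * k + r := by rw [hr]; ring
  have hm : (b + c) * (c + a) * (a + b) = 8 / 9 * (3 / 2 * k + r) * k ^ 2 + q := by
    rw [hq, ← hp]; ring
  have hT : (k + b + c) * (k + c + a) * (k + a + b) = k ^ 3 + 2 * (a + b + c) * k ^ 2 +
      ((a + b + c) ^ 2 + k ^ 2) * k + (b + c) * (c + a) * (a + b) := by
    linear_combination (-k) * h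
  have hQ : ((k + c + a) * (k + a + b)) ^ 2 + ((k + b + c) * (k + a + b)) ^ 2 +
      ((k + b + c) * (k + c + a)) ^ 2 = (a + b + c + 2 * k) ^ 4 -
      2 * (k ^ 3 + 2 * (a + b + c) * k ^ 2 +
      ((a + b + c) ^ 2 + k ^ 2) * k + (b + c) * (c + a) * (a + b)) * (2 * (a + b + c) + 3 * k) := by
    linear_combination (-2 * (a + b + c) ^ 2 - (a * b + b * c + c * a) - 4 * (a + b + c) * k - k ^ 2) * h
  have hN : 0 ≤ 3 * ((b + c) * (c + a) * (a + b)) * (((k + b + c) * (k + c + a) * (k + a + b)) ^ 2 -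
      k ^ 2 * (((k + c + a) * (k + a + b)) ^ 2 + ((k + b + c) * (k + a + b)) ^ 2 +
      ((k + b + c) * (k + c + a)) ^ 2)) - k ^ 3 * ((k + b + c) * (k + c + a) * (k + a + b)) ^ 2 := by
    rw [hQ, hT, hm, hp]
    have : 0 ≤ 101/27*r^4*k^5 + 32/3*r^3*q*k^3 + 7874/243*r^3*k^6 + 6*r^2*q^2*k +
      808/9*r^2*q*k^4 + 15553/162*r^2*k^7 + 50*r*q^2*k^2 + 2096/9*r*q*k^5 + 5845/54*r*k^8 + 3*q^3 +
      181/2*q^2*k^3 + 538/3*q*k^6 + 1573/48*k^9 := by positivity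
    refine this.trans (le_of_eq ?_)
    ring
  rw [← sub_nonneg]
  have : 3 / 2 * k⁻¹ ^ 2 - (k / (2 * ((b + c) * (c + a) * (a + b))) + 3 / 2 * ((k + b + c)⁻¹ ^ 2 +
      (k + c + a)⁻¹ ^ 2 + (k + a + b)⁻¹ ^ 2)) =
      (3 * ((b + c) * (c + a) * (a + b)) * (((k + b + c) * (k + c + a) * (k + a + b)) ^ 2 -
      k ^ 2 * (((k + c + a) * (k + a + b)) ^ 2 + ((k + b + c) * (k + a + b)) ^ 2 +
      ((k + b + c) * (k + c + a)) ^ 2)) - k ^ 3 * ((k + b + c) * (k + c + a) * (k + a + b)) ^ 2) /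
      (2 * ((b + c) * (c + a) * (a + b)) * ((k + b + c) * (k + c + a) * (k + a + b)) ^ 2 * k ^ 2) := by
    generalize hx : k + b + c = x at *
    generalize hy : k + c + a = y at *
    generalize hz : k + a + b = z at *
    generalize hu : b + c = u at *
    generalize hv : c + a = v at *
    generalize hw : a + b = w at *
    have : 0 < x := by rw [← hx]; positivity
    have : 0 < y := by rw [← hy]; positivity
    have : 0 < z := by rw [← hz]; positivity
    have : 0 < u := by rw [← hu]; positivity
    have : 0 < v := by rw [← hv]; positivity
    have : 0 < w := by rw [← hw]; positivity
    field_simp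
    ring
  rw [this]
  exact div_nonneg hN (by positivity)

/-- Weighted tree sums are bounded by means of supersolutions. -/
theorem Triple.tsum_length_mul_le {P : Triple → Prop} (hP : ∀ D, P D → ∀ j, P (D.step j))
    {g A B : Triple → ℝ≥0∞} (hA : ∀ D, P D → g D + ∑ j, A (D.step j) ≤ A D)
    (hB : ∀ D, P D → A D + ∑ j, B (D.step j) ≤ B D) {D : Triple} (hD : P D) (c : ℕ) :
    ∑' w, ((w.length + 1 + c : ℕ) : ℝ≥0∞) * g (D.word w) ≤ B D + c * A D := by
  -- Truncation at words shorter than n permits induction on n. Removing the first letter shortens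
  -- the word by one, so the same weight reads as length plus 1 plus (c + 1) for the child.
  have key : ∀ (n : ℕ) (D : Triple) (c : ℕ), P D →
      ∑' w, (if w.length < n then ((w.length + 1 + c : ℕ) : ℝ≥0∞) * g (D.word w) else 0) ≤
        B D + c * A D := by
    intro n
    induction n with
    | zero => intro D c _; simp
    | succ n ih =>
      intro D c hD
      rw [tsum_list_eq]
      have h1 : ∀ k, ∑' w : List (Fin 3), (if (k :: w).length < n + 1 then
          (((k :: w).length + 1 + c : ℕ) : ℝ≥0∞) * g (D.word (k :: w)) else 0) ≤
          B (D.step k) + ((c + 1 : ℕ) : ℝ≥0∞) * A (D.step k) := by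
        intro k
        refine le_trans (le_of_eq ?_) (ih (D.step k) (c + 1) (hP D hD k))
        refine tsum_congr fun w => ?_
        simp only [List.length_cons, add_lt_add_iff_right]
        rw [show w.length + 1 + 1 + c = w.length + 1 + (c + 1) by ring]
        rfl
      calc _ ≤ ((c + 1 : ℕ) : ℝ≥0∞) * g D + ∑ k, (B (D.step k) + ((c + 1 : ℕ) : ℝ≥0∞) * A (D.step k)) := by
            refine add_le_add (le_of_eq ?_) (Finset.sum_le_sum fun k _ => h1 k)
            simp [Triple.word, add_comm]
        _ = ((c + 1 : ℕ) : ℝ≥0∞) * (g D + ∑ k, A (D.step k)) + ∑ k, B (D.step k) := by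
            rw [Finset.sum_add_distrib, ← Finset.mul_sum]; ring
        _ ≤ ((c + 1 : ℕ) : ℝ≥0∞) * A D + ∑ k, B (D.step k) := by gcongr; exact hA D hD
        _ = c * A D + (A D + ∑ k, B (D.step k)) := by push_cast; ring
        _ ≤ c * A D + B D := by gcongr; exact hB D hD
        _ = _ := add_comm _ _
  rw [ENNReal.tsum_eq_iSup_sum]
  refine iSup_le fun s => ?_
  refine le_trans ?_ (key (s.sup List.length + 1) D c hD)
  refine le_trans (Finset.sum_le_sum fun w hw => ?_) (ENNReal.sum_le_tsum s)
  rw [if_pos (Nat.lt_succ_of_le (Finset.le_sup (f := List.length) hw))]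

theorem Triple.tsum_word_le {P : Triple → Prop} (hP : ∀ D, P D → ∀ j, P (D.step j))
    {g A : Triple → ℝ≥0∞} (hA : ∀ D, P D → g D + ∑ j, A (D.step j) ≤ A D)
    {D : Triple} (hD : P D) : ∑' w, g (D.word w) ≤ A D := by
  have key : ∀ (n : ℕ) (D : Triple), P D →
      ∑' w, (if w.length < n then g (D.word w) else 0) ≤ A D := by
    intro n
    induction n with
    | zero => intro D _; simp
    | succ n ih =>
      intro D hD
      rw [tsum_list_eq]
      refine le_trans (add_le_add (le_of_eq (by simp [Triple.word]))
        (Finset.sum_le_sum fun k _ => ?_)) (hA D hD)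
      refine le_trans (le_of_eq ?_) (ih (D.step k) (hP D hD k))
      refine tsum_congr fun w => ?_
      simp only [List.length_cons, add_lt_add_iff_right]
      rfl
  rw [ENNReal.tsum_eq_iSup_sum]
  refine iSup_le fun s => ?_
  refine le_trans ?_ (key (s.sup List.length + 1) D hD)
  refine le_trans (Finset.sum_le_sum fun w hw => ?_) (ENNReal.sum_le_tsum s)
  rw [if_pos (Nat.lt_succ_of_le (Finset.le_sup (f := List.length) hw))]

/-! ### Bounds for the squared radii of the inscribed disks -/

namespace Triple

/-- A quarter of the area of the triangle with vertices `q_1, q_2, q_3`, an upper bound for the sum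
of the squares of the radii of the inscribed disks. -/
def radBound (D : Triple) : ℝ :=
  D.kappa / (2 * (((D 1).curv + (D 2).curv) * ((D 2).curv + (D 0).curv) *
    ((D 0).curv + (D 1).curv)))

namespace Kissing

variable {D : Triple}

theorem radBound_step (h : D.Kissing) : D.inscribed.rad ^ 2 + ∑ j, (D.step j).radBound ≤ D.radBound := by
  have h0 := D.curv_pos 0; have h1 := D.curv_pos 1; have h2 := D.curv_pos 2
  have := area_supersolution h0 h1 h2 D.kappa_pos (D.kappa_sq 0) rfl
  change _ ≤ D.radBound at this
  refine le_trans (le_of_eq ?_) this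
  rw [h.inscribed_eq, Fin.sum_univ_three]
  simp only [radBound, h.kappa_step]
  have e : ∀ j, (D.step j j).curv = D.inCurv := fun j => by rw [step_self, h.curv_inscribed]
  have e' : ∀ {j k}, k ≠ j → (D.step j k).curv = (D k).curv := fun hk => by rw [step_of_ne _ hk]
  rw [e, e, e, e' (show (1 : Fin 3) ≠ 0 by decide), e' (show (2 : Fin 3) ≠ 0 by decide),
    e' (show (0 : Fin 3) ≠ 1 by decide), e' (show (2 : Fin 3) ≠ 1 by decide),
    e' (show (0 : Fin 3) ≠ 2 by decide), e' (show (1 : Fin 3) ≠ 2 by decide)]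
  rfl

theorem radBound_add (h : D.Kissing) :
    D.radBound + ∑ j, 3 / 2 * (D.step j).kappa⁻¹ ^ 2 ≤ 3 / 2 * D.kappa⁻¹ ^ 2 := by
  have h0 := D.curv_pos 0; have h1 := D.curv_pos 1; have h2 := D.curv_pos 2
  have := kappa_supersolution h0 h1 h2 D.kappa_pos (D.kappa_sq 0)
  refine le_trans (le_of_eq ?_) this
  rw [← Finset.mul_sum, Fin.sum_univ_three, h.kappa_step, h.kappa_step, h.kappa_step]
  rfl

end Kissing

theorem radBound_pos (D : Triple) : 0 < D.radBound := by
  have h0 := D.curv_pos 0; have h1 := D.curv_pos 1; have h2 := D.curv_pos 2; have := D.kappa_pos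
  unfold radBound; positivity

theorem radBound_le (D : Triple) : D.radBound ≤ 1 / 3 * D.kappa⁻¹ ^ 2 := by
  have h0 := D.curv_pos 0; have h1 := D.curv_pos 1; have h2 := D.curv_pos 2; have hk := D.kappa_pos
  have a1 := le_mul_sums h0 h1 h2 (D.kappa_sq 0)
  have a2 := mul_le_sum h0 h1 h2 hk (D.kappa_sq 0)
  have a3 : 3 * D.kappa ^ 3 ≤ 2 * (((D 1).curv + (D 2).curv) * ((D 2).curv + (D 0).curv) *
    ((D 0).curv + (D 1).curv)) := by
    nlinarith [mul_le_mul_of_nonneg_right a2 (sq_nonneg D.kappa)]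
  rw [radBound, div_le_iff₀ (by positivity)]
  calc D.kappa = 1 / 3 * D.kappa⁻¹ ^ 2 * (3 * D.kappa ^ 3) := by field_simp
    _ ≤ _ := by gcongr

theorem kissing_step_ofReal {D : Triple} (h : D.Kissing) : ENNReal.ofReal (D.inscribed.rad ^ 2) +
    ∑ j, ENNReal.ofReal (D.step j).radBound ≤ ENNReal.ofReal D.radBound := by
  rw [← ENNReal.ofReal_sum_of_nonneg fun j _ => (D.step j).radBound_pos.le,
    ← ENNReal.ofReal_add (sq_nonneg _) (Finset.sum_nonneg fun j _ => (D.step j).radBound_pos.le)]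
  exact ENNReal.ofReal_le_ofReal h.radBound_step

theorem Kissing.tsum_rad_sq_le {D : Triple} (h : D.Kissing) :
    ∑' w, ENNReal.ofReal ((D.word w).inscribed.rad ^ 2) ≤ ENNReal.ofReal D.radBound :=
  tsum_word_le (P := Kissing) (g := fun D => ENNReal.ofReal (D.inscribed.rad ^ 2))
    (A := fun D => ENNReal.ofReal D.radBound) (fun _ h j => h.step j)
    (fun _ h => kissing_step_ofReal h) h

/-- Here B = (3/2)κ⁻², A = `radBound` ≤ (1/3)κ⁻² and c = 1, whence 3/2 + 1/3 = 11/6. The weight |w|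
+ 2 counts the arcs of a chain from a side to the circle of w. -/
theorem Kissing.tsum_length_mul_rad_sq_le {D : Triple} (h : D.Kissing) :
    ∑' w, ((w.length + 2 : ℕ) : ℝ≥0∞) * ENNReal.ofReal ((D.word w).inscribed.rad ^ 2) ≤
      ENNReal.ofReal (11 / 6 * D.kappa⁻¹ ^ 2) := by
  have hB : ∀ D : Triple, D.Kissing → ENNReal.ofReal D.radBound +
      ∑ j, ENNReal.ofReal (3 / 2 * (D.step j).kappa⁻¹ ^ 2) ≤ ENNReal.ofReal (3 / 2 * D.kappa⁻¹ ^ 2) := by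
    intro D h
    rw [← ENNReal.ofReal_sum_of_nonneg fun j _ => by positivity,
      ← ENNReal.ofReal_add D.radBound_pos.le (Finset.sum_nonneg fun j _ => by positivity)]
    exact ENNReal.ofReal_le_ofReal h.radBound_add
  refine (tsum_length_mul_le (P := Kissing) (g := fun D => ENNReal.ofReal (D.inscribed.rad ^ 2))
    (A := fun D => ENNReal.ofReal D.radBound) (fun _ h j => h.step j)
    (fun _ h => kissing_step_ofReal h) hB h 1).trans ?_
  rw [Nat.cast_one, one_mul, ← ENNReal.ofReal_add (by positivity) D.radBound_pos.le]
  refine ENNReal.ofReal_le_ofReal ?_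
  have := D.radBound_le
  linarith

end Triple

/-! ### The sides as circular arcs: angles, end points, coordinates -/

theorem norm_mul_unitVec {a : ℂ} : (‖a‖ : ℂ) * unitVec a = a := by
  rcases eq_or_ne a 0 with rfl | ha
  · simp
  · have : (‖a‖ : ℂ) ≠ 0 := by exact_mod_cast norm_ne_zero_iff.2 ha
    rw [unitVec]; field_simp

theorem cross_mul_exp (v : ℂ) (s t : ℝ) : cross (v * Complex.exp (s * Complex.I))
    (v * Complex.exp (t * Complex.I)) = ‖v‖ ^ 2 * Real.sin (t - s) := by
  rw [Real.sin_sub, norm_sq_eq_dot]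
  simp only [cross, dot, Complex.mul_re, Complex.mul_im, Complex.exp_ofReal_mul_I_re,
    Complex.exp_ofReal_mul_I_im]
  ring

theorem dot_mul_exp (v : ℂ) (s t : ℝ) : dot (v * Complex.exp (s * Complex.I))
    (v * Complex.exp (t * Complex.I)) = ‖v‖ ^ 2 * Real.cos (t - s) := by
  rw [Real.cos_sub, norm_sq_eq_dot]
  simp only [dot, Complex.mul_re, Complex.mul_im, Complex.exp_ofReal_mul_I_re,
    Complex.exp_ofReal_mul_I_im]
  ring

theorem cross_ofReal_mul (s t : ℝ) (a b : ℂ) : cross (s * a) (t * b) = s * t * cross a b := by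
  simp only [cross, Complex.re_ofReal_mul, Complex.im_ofReal_mul]; ring

theorem dot_ofReal_mul (s t : ℝ) (a b : ℂ) : dot (s * a) (t * b) = s * t * dot a b := by
  simp only [dot, Complex.re_ofReal_mul, Complex.im_ofReal_mul]; ring

namespace Triple.Kissing

variable {D : Triple}

theorem cent_fst_sub (h : D.Kissing) (j : Fin 3) : (D (j + 1)).cent - (D j).cent =
    (((D j).rad + (D (j + 1)).rad : ℝ) : ℂ) * (D.dir j * Complex.exp ((0 : ℝ) * Complex.I)) := by
  rw [← h.dist _ _ (fin3_ne j).1, dir, Complex.ofReal_zero, zero_mul, Complex.exp_zero, mul_one,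
    norm_mul_unitVec]

theorem cent_snd_sub (h : D.Kissing) (j : Fin 3) : (D (j + 2)).cent - (D j).cent =
    (((D j).rad + (D (j + 2)).rad : ℝ) : ℂ) * (D.dir j * Complex.exp (D.angle j * Complex.I)) := by
  rw [← h.dist _ _ (fin3_ne j).2.1, dir, angle, unitVec_mul_exp (h.cent_sub_ne_zero (fin3_ne j).1)
    (h.cent_sub_ne_zero (fin3_ne j).2.1), norm_mul_unitVec]

theorem sidePt_zero (h : D.Kissing) (j : Fin 3) : D.sidePt j 0 = D.q (j + 2) := by
  obtain ⟨e1, e2, e3, e4⟩ := fin3_add j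
  have hr := (D j).rad_pos; have hr1 := (D (j + 1)).rad_pos
  rw [← sub_left_inj (a := (D j).cent), sidePt, Disk.pt_sub_cent, h.q_eq, e3, e4,
    Disk.contact_sub_cent, h.cent_fst_sub, ← mul_assoc, ← Complex.ofReal_mul, mul_assoc]
  congr 2; field_simp

theorem sidePt_angle (h : D.Kissing) (j : Fin 3) : D.sidePt j (D.angle j) = D.q (j + 1) := by
  obtain ⟨e1, e2, e3, e4⟩ := fin3_add j
  have hr := (D j).rad_pos; have hr1 := (D (j + 2)).rad_pos
  rw [← sub_left_inj (a := (D j).cent), sidePt, Disk.pt_sub_cent, h.q_eq, e1, e2,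
    Disk.contact_comm, Disk.contact_sub_cent, h.cent_snd_sub, ← mul_assoc, ← Complex.ofReal_mul,
    mul_assoc]
  congr 2; field_simp

theorem sidePt_contact (h : D.Kissing) (j : Fin 3) :
    D.sidePt j ((D.step (j + 2)).angle j) ∈ D.inscribed.boundary := by
  obtain ⟨e1, e2, e3, e4⟩ := fin3_add j
  rw [← sidePt_step_snd, (h.step (j + 2)).sidePt_angle, Disk.mem_boundary]
  have := (h.step (j + 2)).norm_q_sub_fst (j + 1)
  rwa [e1, step_self] at this

theorem mul_cos_angle (h : D.Kissing) (j : Fin 3) :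
    ((D j).rad + (D (j + 1)).rad) * ((D j).rad + (D (j + 2)).rad) * Real.cos (D.angle j) =
      (D j).rad ^ 2 + (D j).rad * (D (j + 1)).rad + (D j).rad * (D (j + 2)).rad -
        (D (j + 1)).rad * (D (j + 2)).rad := by
  rw [← h.two_dot j, h.cent_fst_sub j, h.cent_snd_sub j, dot_ofReal_mul, dot_mul_exp, h.norm_dir,
    sub_zero]
  ring

theorem sin_half_sq (h : D.Kissing) (j : Fin 3) :
    ((D j).rad + (D (j + 1)).rad) * ((D j).rad + (D (j + 2)).rad) * Real.sin (D.angle j / 2) ^ 2 =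
      (D (j + 1)).rad * (D (j + 2)).rad := by
  have := h.mul_cos_angle j
  rw [Real.sin_sq_eq_half_sub]
  have e : 2 * (D.angle j / 2) = D.angle j := by ring
  rw [e]; linarith

/-- That is, tan(angle/2) = curv/κ: the incircle of the triangle of centres has radius 1/κ and
touches the edges at the tangency points, at distance `(D j).rad` from the `j`-th centre. -/
theorem sin_half (h : D.Kissing) (j : Fin 3) :
    D.kappa * Real.sin (D.angle j / 2) = (D j).curv * Real.cos (D.angle j / 2) := by
  have h0 := (D j).rad_pos; have h1 := (D (j + 1)).rad_pos; have h2 := (D (j + 2)).rad_pos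
  have ha := h.angle_mem j
  have hk := D.kappa_pos
  have hs : 0 < Real.sin (D.angle j / 2) :=
    Real.sin_pos_of_pos_of_lt_pi (by linarith [ha.1]) (by linarith [ha.2, Real.pi_pos])
  have hc : 0 < Real.cos (D.angle j / 2) :=
    Real.cos_pos_of_mem_Ioo ⟨by linarith [ha.1, Real.pi_pos], by linarith [ha.2]⟩
  rw [← sq_eq_sq₀ (by positivity) (mul_nonneg (D.curv_pos j).le hc.le), mul_pow, mul_pow,
    D.kappa_sq j, Real.cos_sq']
  have e := h.sin_half_sq j
  simp only [Disk.curv]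
  field_simp
  linear_combination e

theorem angle_le (h : D.Kissing) (j : Fin 3) : D.angle j ≤ 2 * ((D j).curv / D.kappa) := by
  have ha := h.angle_mem j
  have hc : 0 < Real.cos (D.angle j / 2) :=
    Real.cos_pos_of_mem_Ioo ⟨by linarith [ha.1, Real.pi_pos], by linarith [ha.2]⟩
  have h1 := Real.le_tan (x := D.angle j / 2) (by linarith [ha.1]) (by linarith [ha.2])
  have h2 : Real.tan (D.angle j / 2) = (D j).curv / D.kappa := by
    rw [Real.tan_eq_sin_div_cos, div_eq_div_iff hc.ne' D.kappa_pos.ne', mul_comm, h.sin_half j]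
  linarith

theorem rad_mul_angle_le (h : D.Kissing) (j : Fin 3) : (D j).rad * D.angle j ≤ 2 / D.kappa := by
  have := mul_le_mul_of_nonneg_left (h.angle_le j) (D j).rad_pos.le
  refine this.trans (le_of_eq ?_)
  have h0 := (D j).rad_pos; have hk := D.kappa_pos
  rw [Disk.curv]; field_simp

theorem bary_fst_sidePt (h : D.Kissing) (j : Fin 3) (t : ℝ) : D.bary (j + 1) (D.sidePt j t) =
    (D j).rad * ((D j).rad + (D (j + 2)).rad) * Real.sin (D.angle j - t) := by
  obtain ⟨e1, e2, e3, e4⟩ := fin3_add j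
  have : D.bary (j + 1) (D.sidePt j t) =
      cross (D.sidePt j t - (D j).cent) ((D (j + 2)).cent - (D j).cent) := by
    simp only [bary, e1, e2, cross, Complex.sub_re, Complex.sub_im]; ring
  rw [this, h.cent_snd_sub, sidePt, Disk.pt_sub_cent, mul_assoc, cross_ofReal_mul, cross_mul_exp,
    h.norm_dir]
  ring

theorem bary_snd_sidePt (h : D.Kissing) (j : Fin 3) (t : ℝ) : D.bary (j + 2) (D.sidePt j t) =
    (D j).rad * ((D j).rad + (D (j + 1)).rad) * Real.sin t := by
  obtain ⟨e1, e2, e3, e4⟩ := fin3_add j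
  have : D.bary (j + 2) (D.sidePt j t) =
      cross ((D (j + 1)).cent - (D j).cent) (D.sidePt j t - (D j).cent) := by
    simp only [bary, e3, e4, cross, Complex.sub_re, Complex.sub_im]; ring
  rw [this, h.cent_fst_sub, sidePt, Disk.pt_sub_cent, mul_assoc, cross_ofReal_mul, cross_mul_exp,
    h.norm_dir, sub_zero]
  ring

/-- Otherwise the segment from the `j`-th centre to z would cross the opposite edge at a point y
inside the open disk `D j`, although that edge is covered by the two other closed disks. -/
theorem bary_nonneg_of_mem_closed (h : D.Kissing) {j : Fin 3} {z : ℂ}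
    (hz : ‖z - (D j).cent‖ ≤ (D j).rad) (h1 : 0 ≤ D.bary (j + 1) z) (h2 : 0 ≤ D.bary (j + 2) z) :
    0 ≤ D.bary j z := by
  obtain ⟨e1, e2, e3, e4⟩ := fin3_add j
  by_contra hneg
  push Not at hneg
  have ha := h.area_pos
  set s : ℝ := D.area / (D.area - D.bary j z) with hs
  have hs0 : 0 < s := div_pos ha (by linarith)
  have hs1 : s < 1 := (div_lt_one (by linarith)).2 (by linarith)
  have hsm : s * (D.area - D.bary j z) = D.area := by rw [hs]; field_simp [(by linarith : D.area - D.bary j z ≠ 0)]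
  set y : ℂ := (D j).cent + s * (z - (D j).cent) with hy
  have b0 : D.bary j y = 0 := by
    have : D.bary j y = (1 - s) * D.area + s * D.bary j z := by
      rw [D.area_eq j]
      simp only [bary, cross, hy, Complex.add_re, Complex.add_im, Complex.sub_re, Complex.sub_im,
        Complex.re_ofReal_mul, Complex.im_ofReal_mul]; ring
    rw [this]; linarith
  have b1 : D.bary (j + 1) y = s * D.bary (j + 1) z := by
    simp only [bary, cross, hy, e1, e2, Complex.add_re, Complex.add_im, Complex.sub_re,
      Complex.sub_im, Complex.re_ofReal_mul, Complex.im_ofReal_mul]; ring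
  have b2 : D.bary (j + 2) y = s * D.bary (j + 2) z := by
    simp only [bary, cross, hy, e3, e4, Complex.add_re, Complex.add_im, Complex.sub_re,
      Complex.sub_im, Complex.re_ofReal_mul, Complex.im_ofReal_mul]; ring
  have hn := h.norm_sub_cent_of_bary_eq_zero b0 (by rw [b1]; positivity) (by rw [b2]; positivity)
  have hyj : ‖y - (D j).cent‖ < (D j).rad := by
    rw [hy, add_sub_cancel_left, norm_mul, Complex.norm_real, Real.norm_eq_abs, abs_of_pos hs0]
    have := (D j).rad_pos
    nlinarith [norm_nonneg (z - (D j).cent)]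
  have c1 := Disk.lt_norm_sub_of_mem_interior (h.dist _ _ (fin3_ne j).1) hyj
  have c2 := Disk.lt_norm_sub_of_mem_interior (h.dist _ _ (fin3_ne j).2.1) hyj
  linarith

theorem mem_side_iff (h : D.Kissing) {j : Fin 3} {z : ℂ} (hz : z ∈ (D j).boundary) :
    z ∈ D.curvTriangle ↔ 0 ≤ D.bary (j + 1) z ∧ 0 ≤ D.bary (j + 2) z := by
  have hz' := Disk.mem_boundary.1 hz
  refine ⟨fun hX => ⟨(hX _).2, (hX _).2⟩, fun ⟨h1, h2⟩ => ?_⟩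
  exact (forall_fin3 j).2 ⟨⟨hz'.ge, h.bary_nonneg_of_mem_closed hz'.le h1 h2⟩,
    ⟨Disk.le_norm_sub_of_mem_closed (h.dist _ _ (fin3_ne j).1) hz'.le, h1⟩,
    ⟨Disk.le_norm_sub_of_mem_closed (h.dist _ _ (fin3_ne j).2.1) hz'.le, h2⟩⟩

theorem sidePt_mem_boundary (h : D.Kissing) (j : Fin 3) (t : ℝ) : D.sidePt j t ∈ (D j).boundary :=
  (D j).pt_mem_boundary (h.norm_dir j) t

/-- On the circle `j` two of the coordinates are positive multiples of sin(angle - t) and sin t, and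
the third is then automatically nonnegative. In the branch (-π, π] the signs of the sines single out
[0, angle]. -/
theorem sidePt_mem_iff (h : D.Kissing) {j : Fin 3} {t : ℝ} (ht : t ∈ Set.Ioc (-Real.pi) Real.pi) :
    D.sidePt j t ∈ D.arc (Sum.inl j) ↔ t ∈ Set.Icc 0 (D.angle j) := by
  have h0 := (D j).rad_pos; have h1 := (D (j + 1)).rad_pos; have h2 := (D (j + 2)).rad_pos
  have ha := h.angle_mem j
  have : D.sidePt j t ∈ D.arc (Sum.inl j) ↔ D.sidePt j t ∈ D.curvTriangle := by
    rw [arc, h.closure_idealTriangle]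
    exact and_iff_left (h.sidePt_mem_boundary j t)
  rw [this, h.mem_side_iff (h.sidePt_mem_boundary j t), h.bary_fst_sidePt, h.bary_snd_sidePt,
    mul_nonneg_iff_of_pos_left (by positivity), mul_nonneg_iff_of_pos_left (by positivity)]
  constructor
  · rintro ⟨s1, s2⟩
    have ht0 : 0 ≤ t := by
      by_contra hn
      push Not at hn
      exact absurd s2 (Real.sin_neg_of_neg_of_neg_pi_lt hn ht.1).not_ge
    refine ⟨ht0, ?_⟩
    by_contra hn
    push Not at hn
    exact absurd s1 (Real.sin_neg_of_neg_of_neg_pi_lt (by linarith) (by linarith [ha.1, ht.2])).not_ge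
  · rintro ⟨s1, s2⟩
    exact ⟨Real.sin_nonneg_of_nonneg_of_le_pi (by linarith) (by linarith [ha.2]),
      Real.sin_nonneg_of_nonneg_of_le_pi s1 ht.2⟩

theorem sidePt_mem (h : D.Kissing) {j : Fin 3} {t : ℝ} (ht : t ∈ Set.Icc 0 (D.angle j)) :
    D.sidePt j t ∈ D.arc (Sum.inl j) := by
  have ha := h.angle_mem j
  exact (h.sidePt_mem_iff ⟨by linarith [ht.1, Real.pi_pos], by linarith [ht.2, ha.2]⟩).2 ht

theorem arc_inl_eq (h : D.Kissing) (j : Fin 3) :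
    D.arc (Sum.inl j) = D.sidePt j '' Set.Icc 0 (D.angle j) := by
  refine Set.Subset.antisymm (fun z hz => ?_) ?_
  · obtain ⟨t, ht, rfl⟩ := (D j).exists_pt_eq (h.norm_dir j) hz.2
    exact ⟨t, (h.sidePt_mem_iff ht).1 hz, rfl⟩
  · rintro _ ⟨t, ht, rfl⟩; exact h.sidePt_mem ht

theorem q_mem_arc_fst (h : D.Kissing) (j : Fin 3) : D.q (j + 2) ∈ D.arc (Sum.inl j) := by
  rw [← h.sidePt_zero]; exact h.sidePt_mem ⟨le_rfl, (h.angle_mem j).1.le⟩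

theorem q_mem_arc_snd (h : D.Kissing) (j : Fin 3) : D.q (j + 1) ∈ D.arc (Sum.inl j) := by
  rw [← h.sidePt_angle]; exact h.sidePt_mem ⟨(h.angle_mem j).1.le, le_rfl⟩

end Triple.Kissing

/-! ### Absolutely continuous functions of one variable -/

theorem ac_comp_lipschitz {g φ : ℝ → ℝ} {a b : ℝ} {K : ℝ≥0} (hφ : LipschitzWith K φ)
    (hg : AbsolutelyContinuousOnInterval g a b) :
    AbsolutelyContinuousOnInterval (fun t => φ (g t)) a b := by
  have h : Tendsto _ _ _ := hg
  have h' := h.const_mul (K : ℝ)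
  rw [mul_zero] at h'
  refine squeeze_zero (fun E => Finset.sum_nonneg fun _ _ => dist_nonneg) (fun E => ?_) h'
  rw [Finset.mul_sum]
  exact Finset.sum_le_sum fun i _ => hφ.dist_le_mul _ _

theorem ac_comp_const_add {g : ℝ → ℝ} {a b c : ℝ}
    (hg : AbsolutelyContinuousOnInterval g (c + a) (c + b)) :
    AbsolutelyContinuousOnInterval (fun t => g (c + t)) a b := by
  rw [absolutelyContinuousOnInterval_iff] at hg ⊢
  intro ε hε
  obtain ⟨δ, hδ, H⟩ := hg ε hε
  refine ⟨δ, hδ, fun E hE hl => ?_⟩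
  refine H (E.1, fun i => (c + (E.2 i).1, c + (E.2 i).2)) ?_ (by simpa using hl)
  obtain ⟨h1, h2⟩ := hE
  refine ⟨fun i hi => ?_, fun i hi j hj hij => ?_⟩
  · have := h1 i hi
    simp only [Set.mem_uIcc, add_le_add_iff_left] at this ⊢
    exact this
  · have := h2 hi hj hij
    simp only [Function.onFun, Set.disjoint_left] at this ⊢
    intro x hx hy
    have e : ∀ p q : ℝ, x ∈ Set.uIoc (c + p) (c + q) → x - c ∈ Set.uIoc p q := fun p q => by
      simp only [Set.mem_uIoc]; rintro (⟨h1, h2⟩ | ⟨h1, h2⟩)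
      · exact Or.inl ⟨by linarith, by linarith⟩
      · exact Or.inr ⟨by linarith, by linarith⟩
    exact this (e _ _ hx) (e _ _ hy)

theorem sq_lintegral_le {g : ℝ → ℝ≥0∞} (hg : Measurable g) (a b : ℝ) :
    (∫⁻ t in Set.Ioc a b, g t) ^ 2 ≤ ENNReal.ofReal (b - a) * ∫⁻ t in Set.Ioc a b, g t ^ 2 := by
  have h := ENNReal.lintegral_mul_le_Lp_mul_Lq (volume.restrict (Set.Ioc a b))
    Real.HolderConjugate.two_two (f := fun _ => 1) (g := g) aemeasurable_const hg.aemeasurable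
  simp only [Pi.mul_apply, one_mul, ENNReal.one_rpow, lintegral_one, Measure.restrict_apply_univ,
    Real.volume_Ioc] at h
  calc _ ≤ _ := pow_le_pow_left' h 2
    _ = _ := by
      rw [mul_pow, ← ENNReal.rpow_natCast, ← ENNReal.rpow_mul, ← ENNReal.rpow_natCast,
        ← ENNReal.rpow_mul]
      simp

theorem ofReal_sq_eq (x : ℝ) : ENNReal.ofReal (x ^ 2) = ‖x‖ₑ ^ 2 := by
  rw [← sq_abs, ← Real.norm_eq_abs, ENNReal.ofReal_pow (norm_nonneg _), ofReal_norm]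

theorem ac_sq_sub_le {g : ℝ → ℝ} {a b : ℝ} (hab : a ≤ b)
    (hg : AbsolutelyContinuousOnInterval g a b) :
    ‖g b - g a‖ₑ ^ 2 ≤ ENNReal.ofReal (b - a) * ∫⁻ t in Set.Ioc a b, ‖deriv g t‖ₑ ^ 2 := by
  refine le_trans ?_ (sq_lintegral_le (measurable_deriv g).enorm a b)
  refine pow_le_pow_left' ?_ 2
  rw [← hg.integral_deriv_eq_sub, intervalIntegral.integral_of_le hab]
  exact enorm_integral_le_lintegral_enorm _

/-- Both end values agree, so Cauchy–Schwarz can be applied from the nearer end, which halves the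
length. It is used on full circles and on sides with vanishing end values. -/
theorem ac_sq_sub_le_half {g : ℝ → ℝ} {a b t : ℝ} (hab : g a = g b) (ht : t ∈ Set.Icc a b)
    (hg : AbsolutelyContinuousOnInterval g a b) :
    ‖g t - g a‖ₑ ^ 2 ≤ ENNReal.ofReal ((b - a) / 2) * ∫⁻ t in Set.Ioc a b, ‖deriv g t‖ₑ ^ 2 := by
  have h1 : a ≤ b := ht.1.trans ht.2
  rcases le_total t ((a + b) / 2) with h | h
  · have hg' : AbsolutelyContinuousOnInterval g a t := hg.mono (by
      rw [Set.uIcc_of_le ht.1, Set.uIcc_of_le h1]; exact Set.Icc_subset_Icc_right ht.2)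
    refine (ac_sq_sub_le ht.1 hg').trans ?_
    gcongr
    · linarith
    · exact ht.2
  · have hg' : AbsolutelyContinuousOnInterval g t b := hg.mono (by
      rw [Set.uIcc_of_le ht.2, Set.uIcc_of_le h1]; exact Set.Icc_subset_Icc_left ht.1)
    rw [hab, ← enorm_neg, neg_sub]
    refine (ac_sq_sub_le ht.2 hg').trans ?_
    gcongr
    · linarith
    · exact ht.1

/-- The inductive step of Cauchy–Schwarz along a chain: the square of a sum of n + 1 increments is
at most n + 1 times the sum of their squares. For n = 0 the hypothesis forces A = 0. -/
theorem enorm_add_sq_le {A B : ℝ} {n : ℕ} {α β : ℝ≥0∞} (hA : ‖A‖ₑ ^ 2 ≤ n * α)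
    (hB : ‖B‖ₑ ^ 2 ≤ β) : ‖A + B‖ₑ ^ 2 ≤ (n + 1 : ℕ) * (α + β) := by
  by_cases hα : α = ∞
  · subst hα; rw [top_add, ENNReal.mul_top (by exact_mod_cast n.succ_ne_zero)]; exact le_top
  by_cases hβ : β = ∞
  · subst hβ; rw [add_top, ENNReal.mul_top (by exact_mod_cast n.succ_ne_zero)]; exact le_top
  lift α to ℝ≥0 using hα
  lift β to ℝ≥0 using hβ
  rw [← ofReal_sq_eq] at *
  have hA' : A ^ 2 ≤ n * α := by
    have : ((n : ℝ≥0∞) * α) = ENNReal.ofReal (n * α) := by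
      rw [ENNReal.ofReal_mul (by positivity)]; simp
    rwa [this, ENNReal.ofReal_le_ofReal_iff (by positivity)] at hA
  have hB' : B ^ 2 ≤ β := by
    rwa [← ENNReal.ofReal_coe_nnreal, ENNReal.ofReal_le_ofReal_iff (by positivity)] at hB
  have : (((n + 1 : ℕ) : ℝ≥0∞) * (α + β)) = ENNReal.ofReal ((n + 1) * (α + β)) := by
    rw [ENNReal.ofReal_mul (by positivity), ENNReal.ofReal_add (by positivity) (by positivity),
      ENNReal.ofReal_add (by positivity) (by positivity)]; simp
  rw [this]
  refine ENNReal.ofReal_le_ofReal ?_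
  rcases n.eq_zero_or_pos with rfl | hn
  · have : A = 0 := by simpa using le_antisymm (by simpa using hA') (sq_nonneg A)
    subst this; simp; linarith [α.2]
  · have hn' : (0 : ℝ) < n := by exact_mod_cast hn
    have : 0 ≤ (n : ℝ)⁻¹ * (A - n * B) ^ 2 := by positivity
    have e : (n : ℝ)⁻¹ * (A - n * B) ^ 2 = (n : ℝ)⁻¹ * A ^ 2 - 2 * (A * B) + n * B ^ 2 := by
      field_simp; ring
    have k1 : (n : ℝ)⁻¹ * A ^ 2 ≤ α := by
      rw [inv_mul_le_iff₀ hn']; exact hA'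
    nlinarith

/-- The angular derivative of `f` along the boundary of `B`. -/
def Disk.angDeriv (B : Disk) (f : ℂ → ℝ) (x : ℂ) : ℝ :=
  deriv (fun t : ℝ => f (B.cent + (x - B.cent) * Complex.exp (t * Complex.I))) 0

theorem Disk.angDeriv_pt (B : Disk) (f : ℂ → ℝ) (v : ℂ) (t : ℝ) :
    B.angDeriv f (B.pt v t) = deriv (fun s => f (B.pt v s)) t := by
  rw [angDeriv]
  have : ∀ s : ℝ, B.cent + (B.pt v t - B.cent) * Complex.exp (s * Complex.I) = B.pt v (t + s) := by
    intro s
    rw [pt_sub_cent, pt, Complex.ofReal_add, add_mul, Complex.exp_add]; ring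
  simp only [this]
  rw [deriv_comp_const_add (f := fun s => f (B.pt v s)), add_zero]

/-- The energy density of `f`, with respect to angles. -/
def energyDens (f : ℂ → ℝ) (B : Disk) (x : ℂ) : ℝ≥0∞ := ‖B.angDeriv f x‖ₑ ^ 2

/-- The mass density of `f`, with respect to angles. -/
def massDens (f : ℂ → ℝ) (B : Disk) (x : ℂ) : ℝ≥0∞ := ENNReal.ofReal (B.rad ^ 2) * ‖f x‖ₑ ^ 2

/-! ### The Poincaré inequality -/

namespace Triple

/-- `f` is absolutely continuous on all arcs of the gasket. -/
structure ACOnArcs (D : Triple) (f : ℂ → ℝ) : Prop where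
  side : ∀ j, AbsolutelyContinuousOnInterval (fun t => f (D.sidePt j t)) 0 (D.angle j)
  circle : ∀ w v, ‖v‖ = 1 → ∀ a b,
    AbsolutelyContinuousOnInterval (fun t => f ((D.word w).inscribed.pt v t)) a b

variable {D : Triple} {f : ℂ → ℝ}

theorem sideInt_energyDens (f : ℂ → ℝ) (j : Fin 3) : sideInt (energyDens f) D j =
    ∫⁻ t in Set.Ioc 0 (D.angle j), ‖deriv (fun t => f (D.sidePt j t)) t‖ₑ ^ 2 := by
  simp only [sideInt, energyDens, sidePt, Disk.angDeriv_pt]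

theorem _root_.Apollonian.circInt_energyDens (f : ℂ → ℝ) (B : Disk) {v : ℂ} (hv : ‖v‖ = 1) :
    circInt (energyDens f) B =
    ∫⁻ t in Set.Ioc 0 (2 * Real.pi), ‖deriv (fun t => f (B.pt v t)) t‖ₑ ^ 2 := by
  simp only [circInt_eq _ _ hv, energyDens, Disk.angDeriv_pt]

/-- The sides of the `i`-th child are an arc of the inscribed circle, an initial piece of the side
`i + 1` and a final piece of the side `i + 2`. -/
theorem ACOnArcs.step (hf : D.ACOnArcs f) (h : D.Kissing) (i : Fin 3) : (D.step i).ACOnArcs f := by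
  refine ⟨(forall_fin3 i).2 ⟨?_, ?_, ?_⟩, fun w => hf.circle (i :: w)⟩
  · simp only [Kissing.sidePt_step_self]
    exact hf.circle [] _ (norm_unitVec (h.cent_sub_inscribed_ne_zero _)) _ _
  · obtain ⟨e1, e2, e3, e4⟩ := fin3_add i
    have s2 := Kissing.sidePt_step_snd (D := D) (i + 1)
    have ea1 := h.angle_add (i + 1)
    have b1 := (h.step (i + 2)).angle_mem (i + 1)
    have b0 := (h.step i).angle_mem (i + 1)
    rw [e2] at s2
    rw [e2, e1] at ea1
    simp only [s2]
    refine (hf.side (i + 1)).mono ?_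
    rw [Set.uIcc_of_le b0.1.le, Set.uIcc_of_le (h.angle_mem _).1.le]
    exact Set.Icc_subset_Icc_right (by linarith [b1.1])
  · obtain ⟨e1, e2, e3, e4⟩ := fin3_add i
    have e := h.sidePt_step_fst (i + 2)
    have ea := h.angle_add (i + 2)
    have a1 := (h.step (i + 1)).angle_mem (i + 2)
    have a0 := (h.step i).angle_mem (i + 2)
    rw [e3] at e
    rw [e4, e3] at ea
    rw [e4] at e
    simp only [e]
    refine ac_comp_const_add (g := fun t => f (D.sidePt (i + 2) t)) ((hf.side (i + 2)).mono ?_)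
    rw [Set.uIcc_of_le (by linarith [a0.1]), Set.uIcc_of_le (h.angle_mem _).1.le, add_zero, ea]
    exact Set.Icc_subset_Icc_left a1.1.le

theorem ACOnArcs.circle_sq_le (hf : D.ACOnArcs f) (w : List (Fin 3)) {x y : ℂ}
    (hx : x ∈ (D.word w).inscribed.boundary) (hy : y ∈ (D.word w).inscribed.boundary) :
    ‖f y - f x‖ₑ ^ 2 ≤ ENNReal.ofReal Real.pi * circInt (energyDens f) (D.word w).inscribed := by
  set B := (D.word w).inscribed
  set v := unitVec (x - B.cent)
  have hn := Disk.mem_boundary.1 hx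
  have hx0 : x - B.cent ≠ 0 := by rw [← norm_pos_iff, hn]; exact B.rad_pos
  have hv : ‖v‖ = 1 := norm_unitVec hx0
  have h0 : B.pt v 0 = x := by
    rw [← sub_left_inj (a := B.cent), Disk.pt_sub_cent, ← hn]; simp [v, norm_mul_unitVec]
  obtain ⟨t, ht, rfl⟩ := B.exists_pt_eq hv hy
  obtain ⟨s, hs, hst⟩ := (B.periodic_pt v).exists_mem_Ico₀ Real.two_pi_pos t
  have := ac_sq_sub_le_half (g := fun t => f (B.pt v t)) (a := 0) (b := 2 * Real.pi) (t := s)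
    (by have := B.periodic_pt v 0; rw [zero_add] at this; simp only [this])
    ⟨hs.1, hs.2.le⟩ (hf.circle w v hv _ _)
  rw [← circInt_energyDens f B hv, ← hst, h0] at this
  refine this.trans (le_of_eq ?_)
  congr 2; ring

end Triple

namespace Triple

variable {D : Triple} {f : ℂ → ℝ}

theorem ACOnArcs.side_sq_le (hf : D.ACOnArcs f) (h : D.Kissing) (hq : ∀ j, f (D.q j) = 0) (j : Fin 3)
    {t : ℝ} (ht : t ∈ Set.Icc 0 (D.angle j)) :
    ‖f (D.sidePt j t)‖ₑ ^ 2 ≤ ENNReal.ofReal (D.angle j / 2) * sideInt (energyDens f) D j := by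
  have h0 : f (D.sidePt j 0) = 0 := by rw [h.sidePt_zero, hq]
  have := ac_sq_sub_le_half (g := fun t => f (D.sidePt j t))
    (by simp only [h.sidePt_zero, h.sidePt_angle, hq]) ht (hf.side j)
  simp only [h0, sub_zero] at this
  rwa [sideInt_energyDens]

/-- With rad · angle ≤ 2/κ, the factor rad² · angle · (angle/2) is at most 2/κ². -/
theorem ACOnArcs.sideInt_massDens_le (hf : D.ACOnArcs f) (h : D.Kissing) (hq : ∀ j, f (D.q j) = 0)
    (j : Fin 3) : sideInt (massDens f) D j ≤
      ENNReal.ofReal (2 / D.kappa ^ 2) * sideInt (energyDens f) D j := by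
  have ha := h.angle_mem j
  have hr := (D j).rad_pos
  have hk := D.kappa_pos
  have e : 2 / D.kappa ^ 2 = (2 / D.kappa) ^ 2 / 2 := by field_simp
  calc sideInt (massDens f) D j ≤ ∫⁻ t in Set.Ioc 0 (D.angle j), ENNReal.ofReal ((D j).rad ^ 2) *
        (ENNReal.ofReal (D.angle j / 2) * sideInt (energyDens f) D j) :=
        setLIntegral_mono' measurableSet_Ioc fun t ht =>
          mul_le_mul_right (hf.side_sq_le h hq j (Set.Ioc_subset_Icc_self ht)) _
    _ = ENNReal.ofReal (((D j).rad * D.angle j) ^ 2 / 2) * sideInt (energyDens f) D j := by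
        rw [setLIntegral_const, Real.volume_Ioc, ← mul_assoc, ← ENNReal.ofReal_mul (by positivity),
          mul_right_comm, ← ENNReal.ofReal_mul (by nlinarith [ha.1])]
        congr 2; ring
    _ ≤ _ := by
        rw [e]
        refine mul_le_mul_left (ENNReal.ofReal_le_ofReal ?_) _
        have h1 := h.rad_mul_angle_le j
        have h2 : 0 ≤ (D j).rad * D.angle j := mul_nonneg hr.le ha.1.le
        exact div_le_div_of_nonneg_right (pow_le_pow_left₀ h2 h1 2) zero_le_two

/-- After n arcs of total energy a, the walk goes on along the inscribed circles of the prefixes of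
w, each touching the next. Crossing a circle costs at most π times its energy. The circles are
distinct, so their energies stay below E and only their number enters the bound. -/
theorem ACOnArcs.sq_le_of_chain (w : List (Fin 3)) : ∀ {D : Triple}, D.Kissing → D.ACOnArcs f →
    ∀ {n : ℕ} {a E : ℝ≥0∞}, (∃ y ∈ D.inscribed.boundary, ‖f y‖ₑ ^ 2 ≤ n * (ENNReal.ofReal Real.pi * a)) →
    a + innerInt (energyDens f) D ≤ E → ∀ x ∈ (D.word w).inscribed.boundary,
    ‖f x‖ₑ ^ 2 ≤ (n + w.length + 1 : ℕ) * (ENNReal.ofReal Real.pi * E) := by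
  induction w with
  | nil =>
    rintro D h hf n a E ⟨y, hy, hfy⟩ hE x hx
    have := enorm_add_sq_le hfy (hf.circle_sq_le [] hy hx)
    rw [← mul_add, add_sub_cancel] at this
    refine this.trans ?_
    simp only [List.length_nil, add_zero]
    gcongr
    refine le_trans ?_ hE
    rw [innerInt_eq]; gcongr; exact le_self_add
  | cons i w ih =>
    rintro D h hf n a E ⟨y, hy, hfy⟩ hE x hx
    have key : ∀ z ∈ D.inscribed.boundary, ‖f z‖ₑ ^ 2 ≤
        (n + 1 : ℕ) * (ENNReal.ofReal Real.pi * (a + circInt (energyDens f) D.inscribed)) := by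
      intro z hz
      have := enorm_add_sq_le hfy (hf.circle_sq_le [] hy hz)
      rwa [← mul_add, add_sub_cancel] at this
    have hd : ∃ z ∈ (D.step i).inscribed.boundary, z ∈ D.inscribed.boundary := by
      have h' := h.step i
      have hc := h'.step (i + 1)
      obtain ⟨e1, e2, e3, e4⟩ := fin3_add i
      -- In this grandchild the disks `i` and `i + 1` are the inscribed disks of `D` and of `D.step
      -- i`, so its vertex `i + 2` is their contact point.
      refine ⟨((D.step i).step (i + 1)).q (i + 2), ?_, ?_⟩
      · have := hc.norm_q_sub_snd (i + 2)
        rw [e4, step_self] at this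
        exact Disk.mem_boundary.2 this
      · have := hc.norm_q_sub_fst (i + 2)
        rw [e3, step_of_ne _ (fin3_ne i).1, step_self] at this
        exact Disk.mem_boundary.2 this
    obtain ⟨z, hz, hz'⟩ := hd
    have := ih (h.step i) (hf.step h i) (n := n + 1) (E := E) ⟨z, hz, key z hz'⟩
      (by
        refine le_trans ?_ hE
        rw [innerInt_eq _ D, add_assoc]; gcongr
        exact Finset.single_le_sum (f := fun k => innerInt (energyDens f) (D.step k))
          (fun _ _ => zero_le) (Finset.mem_univ i)) x hx
    refine this.trans (le_of_eq ?_)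
    congr 2; simp; ring

/-- The chain starts on the side 0, at the point where the inscribed circle touches it; hence n = 1
and |w| + 2 arcs. The factor 2π² is the π of the chain bound times the angular length 2π of the
circle. -/
theorem ACOnArcs.circInt_massDens_le (hf : D.ACOnArcs f) (h : D.Kissing) (hq : ∀ j, f (D.q j) = 0)
    (w : List (Fin 3)) : circInt (massDens f) (D.word w).inscribed ≤
      (w.length + 2 : ℕ) * ENNReal.ofReal ((D.word w).inscribed.rad ^ 2) *
        (ENNReal.ofReal (2 * Real.pi ^ 2) * totalInt (energyDens f) D) := by
  set B := (D.word w).inscribed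
  have ha := h.angle_mem 0
  have hp := Real.pi_pos
  have hb : ∀ x ∈ B.boundary, ‖f x‖ₑ ^ 2 ≤
      (w.length + 2 : ℕ) * (ENNReal.ofReal Real.pi * totalInt (energyDens f) D) := by
    intro x hx
    have hs := (h.step (0 + 2)).angle_mem 0
    have := sq_le_of_chain w h hf (n := 1) (a := sideInt (energyDens f) D 0)
      (E := totalInt (energyDens f) D) ⟨_, h.sidePt_contact 0, by
        rw [Nat.cast_one, one_mul]
        refine (hf.side_sq_le h hq 0 ⟨hs.1.le, ?_⟩).trans ?_
        · have := h.angle_add 0; have := (h.step (0 + 1)).angle_mem 0; linarith [this.1]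
        · gcongr; linarith [ha.2]⟩
      (by
        rw [totalInt]; gcongr
        exact Finset.single_le_sum (f := fun k => sideInt (energyDens f) D k)
          (fun _ _ => zero_le) (Finset.mem_univ 0)) x hx
    refine this.trans (le_of_eq ?_)
    congr 2; ring
  calc circInt (massDens f) B ≤ ∫⁻ t in Set.Ioc 0 (2 * Real.pi), ENNReal.ofReal (B.rad ^ 2) *
        ((w.length + 2 : ℕ) * (ENNReal.ofReal Real.pi * totalInt (energyDens f) D)) :=
        setLIntegral_mono' measurableSet_Ioc fun t ht =>
          mul_le_mul_right (hb _ (B.pt_mem_boundary norm_one t)) _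
    _ = _ := by
        have : ENNReal.ofReal (2 * Real.pi ^ 2) = ENNReal.ofReal Real.pi * ENNReal.ofReal (2 * Real.pi - 0) := by
          rw [← ENNReal.ofReal_mul hp.le]; congr 1; ring
        rw [setLIntegral_const, Real.volume_Ioc, this]; ring

/-- The Poincaré inequality for functions vanishing at the vertices. -/
theorem ACOnArcs.totalInt_massDens_le (hf : D.ACOnArcs f) (h : D.Kissing) (hq : ∀ j, f (D.q j) = 0) :
    totalInt (massDens f) D ≤ ENNReal.ofReal (40 / D.kappa ^ 2) * totalInt (energyDens f) D := by
  have hp := Real.pi_pos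
  have hk := D.kappa_pos
  set T := totalInt (energyDens f) D with hT
  have h1 : ∑ j, sideInt (massDens f) D j ≤ ENNReal.ofReal (2 / D.kappa ^ 2) * T :=
    calc _ ≤ ∑ j, ENNReal.ofReal (2 / D.kappa ^ 2) * sideInt (energyDens f) D j :=
          Finset.sum_le_sum fun j _ => hf.sideInt_massDens_le h hq j
      _ ≤ _ := by rw [← Finset.mul_sum, hT, totalInt]; gcongr; exact le_self_add
  -- With π < 3.15 one has 2π² · 11/6 < 38; the sides contribute the remaining 2.
  have h2 : innerInt (massDens f) D ≤ ENNReal.ofReal (38 / D.kappa ^ 2) * T :=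
    calc _ ≤ _ := ENNReal.tsum_le_tsum fun w => hf.circInt_massDens_le h hq w
      _ ≤ ENNReal.ofReal (11 / 6 * D.kappa⁻¹ ^ 2) * (ENNReal.ofReal (2 * Real.pi ^ 2) * T) := by
          rw [ENNReal.tsum_mul_right]; gcongr; exact h.tsum_length_mul_rad_sq_le
      _ ≤ _ := by
          rw [← mul_assoc, ← ENNReal.ofReal_mul (by positivity)]
          refine mul_le_mul_left (ENNReal.ofReal_le_ofReal ?_) _
          rw [inv_pow, div_eq_mul_inv, mul_right_comm]
          refine mul_le_mul_of_nonneg_right ?_ (by positivity)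
          nlinarith [Real.pi_lt_d2]
  rw [totalInt]
  refine (add_le_add h1 h2).trans (le_of_eq ?_)
  rw [← add_mul, ← ENNReal.ofReal_add (by positivity) (by positivity)]
  congr 2; ring

end Triple

/-- Gluing of Lipschitz functions on sets which meet transversally. -/
theorem exists_lipschitzWith_glue {ι E : Type*} [Finite ι] [PseudoMetricSpace E] {G : ι → Set E}
    {f : ι → E → ℝ} (hf : ∀ i, ∃ L : ℝ≥0, LipschitzWith L (f i))
    (hG : ∀ i k, i ≠ k → ∃ p, f i p = f k p ∧ ∃ C : ℝ, ∀ x ∈ G i, ∀ y ∈ G k,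
      dist x p + dist y p ≤ C * dist x y) :
    ∃ g : E → ℝ, (∃ L : ℝ≥0, LipschitzWith L g) ∧ ∀ i, ∀ x ∈ G i, g x = f i x := by
  classical
  have := Fintype.ofFinite ι
  choose L hL using hf
  -- Comparing through the common point p, the increment from x to y is at most L_i·dist(x, p) +
  -- L_k·dist(y, p), which transversality bounds by a multiple of dist(x, y). The glued function is
  -- therefore Lipschitz on the union and extends to the whole space.
  have key : ∀ i k, ∃ C : ℝ, 0 ≤ C ∧ ∀ x ∈ G i, ∀ y ∈ G k, dist (f i x) (f k y) ≤ C * dist x y := by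
    intro i k
    by_cases hik : i = k
    · subst hik; exact ⟨L i, (L i).2, fun x _ y _ => (hL i).dist_le_mul x y⟩
    obtain ⟨p, hp, C, hC⟩ := hG i k hik
    refine ⟨(L i + L k) * |C|, by positivity, fun x hx y hy => ?_⟩
    have h1 := (hL i).dist_le_mul x p
    have h2 := (hL k).dist_le_mul y p
    have h3 := dist_triangle (f i x) (f i p) (f k y)
    rw [hp, dist_comm (f k p)] at h3
    rw [hp] at h1
    have h4 := hC x hx y hy
    have h5 : C * dist x y ≤ |C| * dist x y := mul_le_mul_of_nonneg_right (le_abs_self C) dist_nonneg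
    have d1 := dist_nonneg (x := x) (y := p)
    have d2 := dist_nonneg (x := y) (y := p)
    have l1 := (L i).2
    have l2 := (L k).2
    calc dist (f i x) (f k y) ≤ L i * dist x p + L k * dist y p := by linarith
      _ ≤ (L i + L k) * (dist x p + dist y p) := by
        have := mul_nonneg l1 d2; have := mul_nonneg l2 d1
        simp only [NNReal.val_eq_coe] at *; nlinarith
      _ ≤ (L i + L k) * (|C| * dist x y) :=
        mul_le_mul_of_nonneg_left (h4.trans h5) (by positivity)
      _ = _ := by ring
  choose C hC0 hC using key
  let g : E → ℝ := fun x => if hx : ∃ i, x ∈ G i then f hx.choose x else 0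
  have hg : ∀ i, ∀ x ∈ G i, g x = f i x := fun i x hx => by
    have hx' : ∃ i, x ∈ G i := ⟨i, hx⟩
    have := hC _ i x hx'.choose_spec x hx
    rw [dist_self, mul_zero] at this
    simp only [g, dif_pos hx']
    exact dist_le_zero.1 this
  let K : ℝ≥0 := ⟨∑ i, ∑ k, C i k, Finset.sum_nonneg fun i _ => Finset.sum_nonneg fun k _ => hC0 i k⟩
  have hK : LipschitzOnWith K g (⋃ i, G i) := LipschitzOnWith.of_dist_le_mul fun x hx y hy => by
    obtain ⟨i, hi⟩ := Set.mem_iUnion.1 hx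
    obtain ⟨k, hk⟩ := Set.mem_iUnion.1 hy
    rw [hg i x hi, hg k y hk]
    refine (hC i k x hi y hk).trans (mul_le_mul_of_nonneg_right ?_ dist_nonneg)
    exact (Finset.single_le_sum (f := fun k => C i k) (fun k _ => hC0 i k) (Finset.mem_univ k)).trans
      (Finset.single_le_sum (f := fun i => ∑ k, C i k)
        (fun i _ => Finset.sum_nonneg fun k _ => hC0 i k) (Finset.mem_univ i))
  obtain ⟨g', hg', he⟩ := hK.extend_real
  exact ⟨g', ⟨K, hg'⟩, fun i x hx => by rw [← he (Set.mem_iUnion.2 ⟨i, hx⟩), hg i x hx]⟩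

/-! ### Transversality of neighbouring cells -/

namespace Triple

theorem q_step (D : Triple) (h : D.Kissing) (i : Fin 3) : (D.step i).q i = D.q i := by
  rw [(h.step i).q_eq, h.q_eq, step_fst, step_snd]

namespace Kissing

variable {D : Triple}

/-- The triangle inequality in `bary_smul`, combined with |z - c_j| ≥ r_j; the contributions of r_j
to the edge lengths cancel. -/
theorem bary_mul_rad_le (h : D.Kissing) (j : Fin 3) {z : ℂ} (hz : z ∈ D.curvTriangle) :
    D.bary j z * (D j).rad ≤ D.bary (j + 1) z * (D (j + 1)).rad + D.bary (j + 2) z * (D (j + 2)).rad := by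
  have e := congrArg norm (D.bary_smul j z)
  have ha := h.area_pos
  rw [norm_mul, Complex.norm_real, Real.norm_eq_abs, abs_of_pos ha] at e
  have h1 := norm_add_le (D.bary (j + 1) z * ((D (j + 1)).cent - (D j).cent))
    (D.bary (j + 2) z * ((D (j + 2)).cent - (D j).cent))
  rw [← e, norm_mul, norm_mul, Complex.norm_real, Complex.norm_real, Real.norm_eq_abs,
    Real.norm_eq_abs, abs_of_nonneg (hz _).2, abs_of_nonneg (hz _).2, h.dist _ _ (fin3_ne j).1,
    h.dist _ _ (fin3_ne j).2.1] at h1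
  have h2 := mul_le_mul_of_nonneg_left (hz j).1 ha.le
  have := D.bary_add j z
  rw [← this] at h1 h2
  linarith

/-- In the curved triangle, the distance to a vertex is controlled by the distance to the edge
through it. -/
theorem norm_sub_q_le (h : D.Kissing) (j : Fin 3) {z : ℂ} (hz : z ∈ D.curvTriangle) :
    D.area * ‖z - D.q j‖ ≤ (‖(D j).cent - D.q j‖ + (D j).rad) * D.bary j z := by
  obtain ⟨e1, e2, e3, e4⟩ := fin3_add j
  have ha := h.area_pos
  have b1 := h.bary_mul_rad_le (j + 1) hz
  have b2 := h.bary_mul_rad_le (j + 2) hz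
  rw [e1, e2] at b1
  rw [e3, e4] at b2
  have r1 := (D (j + 1)).rad_pos; have r2 := (D (j + 2)).rad_pos; have r0 := (D j).rad_pos
  set u : ℂ := (((D (j + 1)).rad + (D (j + 2)).rad : ℝ) : ℂ)⁻¹ * ((D (j + 2)).cent - (D (j + 1)).cent)
  have hu : ‖u‖ = 1 := by
    rw [norm_mul, norm_inv, Complex.norm_real, h.dist _ _ (fin3_ne j).2.2, Real.norm_eq_abs,
      abs_of_pos (by positivity), inv_mul_cancel₀ (by positivity)]
  have q1 : D.q j - (D (j + 1)).cent = (D (j + 1)).rad * u := by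
    rw [h.q_eq, Disk.contact_sub_cent, Complex.ofReal_div]; simp only [u]; ring
  have q2 : D.q j - (D (j + 2)).cent = -((D (j + 2)).rad * u) := by
    rw [h.q_eq, Disk.contact_comm, Disk.contact_sub_cent, Complex.ofReal_div]; simp only [u]
    rw [add_comm (D (j + 2)).rad]; ring
  have e : (D.area : ℂ) * (z - D.q j) = D.bary j z * ((D j).cent - D.q j) +
      ((D.bary (j + 2) z * (D (j + 2)).rad - D.bary (j + 1) z * (D (j + 1)).rad : ℝ) : ℂ) * u := by
    have s := D.bary_smul j z
    have t := congrArg (fun x : ℝ => (x : ℂ)) (D.bary_add j z)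
    simp only [Complex.ofReal_add] at t
    push_cast
    linear_combination s + (D.q j - (D j).cent) * t - D.bary (j + 1) z * q1 - D.bary (j + 2) z * q2
  have := congrArg norm e
  rw [norm_mul, Complex.norm_real, Real.norm_eq_abs, abs_of_pos ha] at this
  rw [this]
  refine (norm_add_le _ _).trans ?_
  rw [norm_mul, norm_mul, Complex.norm_real, Complex.norm_real, Real.norm_eq_abs, Real.norm_eq_abs,
    abs_of_nonneg (hz _).2, hu, mul_one, add_mul, mul_comm]
  refine add_le_add_right (abs_le.2 ⟨?_, ?_⟩) _ <;> linarith

theorem abs_bary_sub_le (D : Triple) (j : Fin 3) (x y : ℂ) :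
    |D.bary j x - D.bary j y| ≤ ‖(D (j + 2)).cent - (D (j + 1)).cent‖ * ‖x - y‖ := by
  have : D.bary j x - D.bary j y = cross ((D (j + 2)).cent - (D (j + 1)).cent) (x - y) := by
    simp only [bary, cross, Complex.sub_re, Complex.sub_im]; ring
  rw [this]; exact abs_cross_le _ _

theorem gasket_subset_curvTriangle (h : D.Kissing) : D.gasket ⊆ D.curvTriangle :=
  fun _ hz => (h.mem_gasket.1 hz).1

theorem norm_q_sub_of_ne (h : D.Kissing) {j k : Fin 3} (hkj : k ≠ j) :
    ‖D.q j - (D k).cent‖ = (D k).rad := by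
  rcases fin3_cases j k with rfl | rfl | rfl
  · exact absurd rfl hkj
  · exact h.norm_q_sub_fst j
  · exact h.norm_q_sub_snd j

/-- The two cells lie on opposite sides of the line through the new centre and the centre of the
third disk, their coordinates there being negatives of each other. Each leaves the contact point on
that line in a cusp orthogonal to it, so the distance to the point is controlled by the distance to
the line, and the latter distances add up. -/
theorem exists_dist_add_dist_le (h : D.Kissing) {i k : Fin 3} (hik : i ≠ k) :
    (D.step i).q k = (D.step k).q i ∧
    ∃ C : ℝ, ∀ x ∈ (D.step i).gasket, ∀ y ∈ (D.step k).gasket,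
      Dist.dist x ((D.step i).q k) + Dist.dist y ((D.step i).q k) ≤ C * Dist.dist x y := by
  have hi := h.step i
  have hk := h.step k
  obtain ⟨l, hl⟩ := fin3_exists_ne i k
  have hq : (D.step i).q k = (D.step k).q i := by
    refine hk.eq_q_of_ne (k := k) (l := l) hik hl.1.symm hl.2.symm ?_ ?_
    · have := hi.norm_q_sub_of_ne hik
      rw [step_self] at this ⊢; exact this.le
    · have := hi.norm_q_sub_of_ne hl.2
      rw [step_of_ne _ hl.1] at this; rw [step_of_ne _ hl.2]; exact this.le
  refine ⟨hq, ?_⟩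
  set p := (D.step i).q k
  set A := (‖(D.step i k).cent - p‖ + (D.step i k).rad) / (D.step i).area with hA
  set B := (‖(D.step k i).cent - p‖ + (D.step k i).rad) / (D.step k).area with hB
  have hA0 : 0 ≤ A := by have := hi.area_pos; have := (D.step i k).rad_pos; positivity
  have hB0 : 0 ≤ B := by have := hk.area_pos; have := (D.step k i).rad_pos; positivity
  refine ⟨(A + B) * ‖(D.step i (k + 2)).cent - (D.step i (k + 1)).cent‖, fun x hx y hy => ?_⟩
  have hx' := hi.gasket_subset_curvTriangle hx
  have hy' := hk.gasket_subset_curvTriangle hy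
  have h1 : Dist.dist x p ≤ A * (D.step i).bary k x := by
    rw [dist_eq_norm, hA, div_mul_eq_mul_div, le_div_iff₀ hi.area_pos, mul_comm]
    exact hi.norm_sub_q_le k hx'
  have h2 : Dist.dist y p ≤ B * (D.step k).bary i y := by
    rw [dist_eq_norm, hB, div_mul_eq_mul_div, le_div_iff₀ hk.area_pos, mul_comm, hq]
    exact hk.norm_sub_q_le i hy'
  have h3 : (D.step k).bary i y = -(D.step i).bary k y := by
    rw [h.bary_step_of_ne hik, h.bary_step_of_ne hik.symm]; ring
  have h4 := abs_bary_sub_le (D.step i) k x y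
  have h5 := (hx' k).2
  have h6 := (hy' i).2
  have h7 := le_abs_self ((D.step i).bary k x - (D.step i).bary k y)
  rw [dist_eq_norm x y, mul_assoc]
  refine le_trans ?_ (mul_le_mul_of_nonneg_left h4 (add_nonneg hA0 hB0))
  refine le_trans ?_ (mul_le_mul_of_nonneg_left h7 (add_nonneg hA0 hB0))
  rw [h3] at h2 h6
  nlinarith [mul_nonneg hA0 h6, mul_nonneg hB0 h5]

end Kissing

end Triple

/-! ### The energy of affine functions -/

theorem hasDerivAt_dot {γ : ℝ → ℂ} {γ' : ℂ} {t : ℝ} (g : ℂ) (hγ : HasDerivAt γ γ' t) :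
    HasDerivAt (fun s => dot g (γ s)) (dot g γ') t := by
  let L : ℂ →L[ℝ] ℝ := g.re • Complex.reCLM + g.im • Complex.imCLM
  have := L.hasFDerivAt.comp_hasDerivAt t hγ
  convert! this using 1

theorem Disk.hasDerivAt_pt (B : Disk) (v : ℂ) (t : ℝ) :
    HasDerivAt (B.pt v) (B.rad * (v * Complex.exp (t * Complex.I) * Complex.I)) t := by
  have h1 : HasDerivAt (fun s : ℝ => (s : ℂ) * Complex.I) (1 * Complex.I) t :=
    (Complex.ofRealCLM.hasDerivAt (x := t)).mul_const Complex.I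
  have h2 := (h1.cexp.const_mul (B.rad * v)).const_add B.cent
  convert! h2 using 1
  ring

theorem Disk.angDeriv_affine (B : Disk) (a : ℝ) (g v : ℂ) (t : ℝ) :
    B.angDeriv (fun z => a + dot g z) (B.pt v t) =
      B.rad * dot g (v * Complex.exp (t * Complex.I) * Complex.I) := by
  rw [angDeriv_pt]
  have := ((hasDerivAt_dot g (B.hasDerivAt_pt v t)).const_add a).deriv
  rw [this]
  simp only [dot, Complex.re_ofReal_mul, Complex.im_ofReal_mul]; ring

theorem dot_sub (g x y : ℂ) : dot g (x - y) = dot g x - dot g y := by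
  simp only [dot, Complex.sub_re, Complex.sub_im]; ring

theorem circInt_affine_le (B : Disk) (a : ℝ) (g : ℂ) :
    circInt (energyDens fun z => a + dot g z) B ≤
      ENNReal.ofReal (2 * Real.pi * ‖g‖ ^ 2) * ENNReal.ofReal (B.rad ^ 2) := by
  have hp := Real.pi_pos
  calc _ ≤ ∫⁻ t in Set.Ioc 0 (2 * Real.pi), ENNReal.ofReal (B.rad ^ 2 * ‖g‖ ^ 2) := by
        refine lintegral_mono fun t => ?_
        simp only [energyDens, B.angDeriv_affine, ← ofReal_sq_eq]
        refine ENNReal.ofReal_le_ofReal ?_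
        rw [mul_pow]
        refine mul_le_mul_of_nonneg_left ?_ (sq_nonneg _)
        have := abs_dot_le g (1 * Complex.exp (t * Complex.I) * Complex.I)
        rw [one_mul, norm_mul, Complex.norm_exp_ofReal_mul_I, Complex.norm_I, mul_one, mul_one] at this
        rw [one_mul, ← sq_abs]
        exact pow_le_pow_left₀ (abs_nonneg _) this 2
    _ = _ := by
        rw [setLIntegral_const, Real.volume_Ioc, ← ENNReal.ofReal_mul (by positivity),
          ← ENNReal.ofReal_mul (by positivity)]
        congr 1; ring

theorem prod_add_fin3 (x : Fin 3 → ℝ) (j : Fin 3) : (x 1 + x 2) * (x 2 + x 0) * (x 0 + x 1) =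
    (x (j + 1) + x (j + 2)) * (x (j + 2) + x j) * (x j + x (j + 1)) := by
  fin_cases j
  · rfl
  · change _ = (x 2 + x 0) * (x 0 + x 1) * (x 1 + x 2); ring
  · change _ = (x 0 + x 1) * (x 1 + x 2) * (x 2 + x 0); ring

/-- In terms of the radii a, b, c the first factor is `radBound`, the second is twice a squared
chord times an angle, and the right-hand side is the square of twice the area of the triangle of
tangency points. The hypothesis a ≤ c enters only through b(c + a) ≤ 2c(a + b + c). -/
theorem radBound_chord_le {a b c κ φ : ℝ} (ha : 0 < a) (hb : 0 < b) (hc : 0 < c) (hκ : 0 < κ)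
    (hac : a ≤ c) (hs : κ ^ 2 * (a * b * c) = a + b + c) (hφ : φ ≤ 2 / (c * κ)) :
    κ * (a * b * c) ^ 2 / (2 * ((a + b) * (b + c) * (c + a))) *
      (2 * (4 * b ^ 2 * c * a / ((b + c) * (b + a))) * φ) ≤
      (4 * (a * b * c) ^ 2 * κ / ((a + b) * (b + c) * (c + a))) ^ 2 := by
  have e : (4 * (a * b * c) ^ 2 * κ / ((a + b) * (b + c) * (c + a))) ^ 2 =
      16 * (a * b * c) ^ 3 * (a + b + c) / ((a + b) * (b + c) * (c + a)) ^ 2 := by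
    rw [← hs, div_pow]; ring
  rw [e]
  calc _ ≤ κ * (a * b * c) ^ 2 / (2 * ((a + b) * (b + c) * (c + a))) *
      (2 * (4 * b ^ 2 * c * a / ((b + c) * (b + a))) * (2 / (c * κ))) := by gcongr
    _ = 8 * (a * b * c) ^ 2 * a * b * (b * (c + a)) / ((a + b) * (b + c) * (c + a)) ^ 2 := by
      field_simp; ring
    _ ≤ _ := by
      refine div_le_div_of_nonneg_right ?_ (by positivity)
      have : b * (c + a) ≤ 2 * c * (a + b + c) := by nlinarith [mul_pos hc hc, mul_pos ha hc]
      have := mul_le_mul_of_nonneg_left this (by positivity : 0 ≤ 8 * (a * b * c) ^ 2 * a * b)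
      nlinarith

namespace Triple

namespace Kissing

variable {D : Triple}

theorem innerInt_affine_le (h : D.Kissing) (a : ℝ) (g : ℂ) :
    innerInt (energyDens fun z => a + dot g z) D ≤
      ENNReal.ofReal (2 * Real.pi * ‖g‖ ^ 2 * D.radBound) := by
  have hp := Real.pi_pos
  rw [ENNReal.ofReal_mul (by positivity)]
  calc _ ≤ _ := ENNReal.tsum_le_tsum fun w => circInt_affine_le _ a g
    _ ≤ _ := by rw [ENNReal.tsum_mul_left]; gcongr; exact h.tsum_rad_sq_le

/-- Twice the area of the triangle of the vertices. -/
theorem cross_q (h : D.Kissing) (j : Fin 3) :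
    cross (D.q (j + 1) - D.q j) (D.q (j + 2) - D.q j) * (((D j).rad + (D (j + 1)).rad) *
      ((D (j + 1)).rad + (D (j + 2)).rad) * ((D (j + 2)).rad + (D j).rad)) =
      4 * ((D j).rad * (D (j + 1)).rad * (D (j + 2)).rad) ^ 2 * D.kappa := by
  obtain ⟨e1, e2, e3, e4⟩ := fin3_add j
  have r1 := (D (j + 1)).rad_pos; have r2 := (D (j + 2)).rad_pos; have r0 := (D j).rad_pos
  have ha := h.area_formula j
  have : 4 * ((D j).rad * (D (j + 1)).rad * (D (j + 2)).rad) ^ 2 * D.kappa =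
      2 * ((D j).rad * (D (j + 1)).rad * (D (j + 2)).rad) * D.area := by rw [ha]; ring
  rw [this, D.area_eq j, h.q_eq, h.q_eq, h.q_eq, e1, e2, e3, e4]
  simp only [Disk.contact, cross, Complex.sub_re, Complex.sub_im, Complex.add_re, Complex.add_im,
    Complex.re_ofReal_mul, Complex.im_ofReal_mul]
  field_simp
  ring

theorem norm_q_sub_q_sq (h : D.Kissing) (j : Fin 3) :
    ‖D.q (j + 1) - D.q (j + 2)‖ ^ 2 * (((D j).rad + (D (j + 1)).rad) * ((D j).rad + (D (j + 2)).rad)) =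
      4 * (D j).rad ^ 2 * ((D (j + 1)).rad * (D (j + 2)).rad) := by
  have e : D.q (j + 1) - D.q (j + 2) = ((D j).rad : ℂ) * (D.dir j * Complex.exp (D.angle j * Complex.I) -
      D.dir j * Complex.exp ((0 : ℝ) * Complex.I)) := by
    rw [← h.sidePt_angle, ← h.sidePt_zero, sidePt, sidePt, Disk.pt, Disk.pt]; ring
  have s := h.sin_half_sq j
  have c := Real.sin_sq_eq_half_sub (D.angle j / 2)
  rw [show 2 * (D.angle j / 2) = D.angle j by ring] at c
  have n : ‖D.dir j * Complex.exp (D.angle j * Complex.I) -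
      D.dir j * Complex.exp ((0 : ℝ) * Complex.I)‖ ^ 2 = 4 * Real.sin (D.angle j / 2) ^ 2 := by
    have := two_dot_eq (D.dir j * Complex.exp ((0 : ℝ) * Complex.I)) (D.dir j * Complex.exp (D.angle j * Complex.I))
    rw [dot_mul_exp, norm_mul, norm_mul, Complex.norm_exp_ofReal_mul_I, Complex.norm_exp_ofReal_mul_I,
      h.norm_dir, sub_zero] at this
    rw [c]; linarith
  rw [e, norm_mul, mul_pow, n, Complex.norm_real, Real.norm_eq_abs, sq_abs]
  linear_combination 4 * (D j).rad ^ 2 * s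

/-- For k = `(D j).curv` and s the sum of the other two curvatures, `radBound` is κ/(2(κ² + k²)s)
and ks ≤ κ². The κ² part uses angle ≤ 2k/κ three times, giving 8k³; the k² part uses it once with
angle² ≤ 10, giving 20k³; hence 28 and then 56. -/
theorem rad_sq_mul_angle_pow_le (h : D.Kissing) (j : Fin 3) :
    (D j).rad ^ 2 * D.angle j ^ 3 ≤ 56 * D.radBound := by
  have k0 := D.curv_pos j; have k1 := D.curv_pos (j + 1); have k2 := D.curv_pos (j + 2)
  have hk := D.kappa_pos
  have ks := D.kappa_sq j
  have ha := h.angle_mem j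
  have hp := Real.pi_lt_d2
  have h1 := h.angle_le j
  rw [mul_div_assoc', le_div_iff₀ hk] at h1
  have hR : D.radBound = D.kappa / (2 * ((D.kappa ^ 2 + (D j).curv ^ 2) *
      ((D (j + 1)).curv + (D (j + 2)).curv))) := by
    rw [ks, radBound, prod_add_fin3 (fun i => (D i).curv) j]
    congr 2
    ring
  have hr : (D j).rad = 1 / (D j).curv := D.rad_eq j
  rw [hR, hr]
  set k := (D j).curv
  set s := (D (j + 1)).curv + (D (j + 2)).curv
  have hs : k * s ≤ D.kappa ^ 2 := by rw [ks]; simp only [s, k]; nlinarith [mul_pos k1 k2]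
  have hs0 : 0 < s := add_pos k1 k2
  set φ := D.angle j
  have h0 : 0 ≤ φ * D.kappa := mul_nonneg ha.1.le hk.le
  have c3 : (φ * D.kappa) ^ 3 ≤ 8 * k ^ 3 := by
    calc _ ≤ (2 * k) ^ 3 := pow_le_pow_left₀ h0 h1 3
      _ = _ := by ring
  have c1 : φ ^ 2 * (φ * D.kappa) ≤ 10 * (2 * k) := by
    refine mul_le_mul ?_ h1 h0 (by norm_num)
    nlinarith [ha.1, ha.2]
  have c4 : φ ^ 3 * D.kappa * (D.kappa ^ 2 + k ^ 2) ≤ 28 * k ^ 3 := by nlinarith [sq_nonneg k]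
  rw [mul_div_assoc', le_div_iff₀ (by positivity), one_div, inv_pow]
  rw [show (k ^ 2)⁻¹ * φ ^ 3 * (2 * ((D.kappa ^ 2 + k ^ 2) * s)) =
    (φ ^ 3 * (2 * ((D.kappa ^ 2 + k ^ 2) * s))) / k ^ 2 by field_simp, div_le_iff₀ (by positivity)]
  have c5 := mul_le_mul_of_nonneg_right c4 hs0.le
  have c6 : 28 * k ^ 3 * s ≤ 28 * k ^ 2 * D.kappa ^ 2 := by nlinarith [sq_nonneg k]
  have c7 : (φ ^ 3 * (2 * ((D.kappa ^ 2 + k ^ 2) * s))) * D.kappa ≤ (56 * D.kappa * k ^ 2) * D.kappa := by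
    nlinarith
  exact le_of_mul_le_mul_right c7 hk

/-- The tangent τ at the midpoint of the arc is parallel to the chord, so the component of g along τ
is read off from the increment between the end points, with sin(φ/2) ≥ φ/π. Elsewhere the tangent is
turned by at most φ/2; this costs a term of order rad²·φ³·‖g‖², which `radBound` absorbs. -/
theorem sideInt_affine_le (h : D.Kissing) (a : ℝ) (g : ℂ) (j : Fin 3) :
    sideInt (energyDens fun z => a + dot g z) D j ≤
      ENNReal.ofReal (5 * ((dot g (D.q (j + 1) - D.q (j + 2))) ^ 2 / D.angle j) +
        28 * D.radBound * ‖g‖ ^ 2) := by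
  have ha := h.angle_mem j
  have hp := Real.pi_lt_d2
  have hp0 := Real.pi_pos
  have hr := (D j).rad_pos
  set φ := D.angle j with hφ
  set τ : ℂ := D.dir j * Complex.exp ((φ / 2 : ℝ) * Complex.I) * Complex.I with hτ
  have hτn : ‖τ‖ = 1 := by
    rw [hτ, norm_mul, norm_mul, Complex.norm_exp_ofReal_mul_I, Complex.norm_I, h.norm_dir]; simp
  have hexp : ∀ s : ℝ, Complex.exp (s * Complex.I) = (Real.cos s : ℂ) + Real.sin s * Complex.I := by
    intro s; rw [Complex.exp_mul_I]; simp
  have hτt : ∀ t : ℝ, D.dir j * Complex.exp (t * Complex.I) * Complex.I =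
      (Real.cos (t - φ / 2) : ℝ) * τ + (Real.sin (t - φ / 2) : ℝ) * (τ * Complex.I) := by
    intro t
    have : Complex.exp (t * Complex.I) = Complex.exp ((φ / 2 : ℝ) * Complex.I) *
        Complex.exp ((t - φ / 2 : ℝ) * Complex.I) := by
      rw [← Complex.exp_add]; congr 1; push_cast; ring
    rw [this, hexp (t - φ / 2), hτ]; ring
  have hchord : D.q (j + 1) - D.q (j + 2) = ((2 * (D j).rad * Real.sin (φ / 2) : ℝ) : ℂ) * τ := by
    rw [← h.sidePt_angle, ← h.sidePt_zero, sidePt, sidePt, Disk.pt, Disk.pt, hτ]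
    rw [← hφ]
    have e1 : Complex.exp (φ * Complex.I) = Complex.exp ((φ / 2 : ℝ) * Complex.I) *
        Complex.exp ((φ / 2 : ℝ) * Complex.I) := by
      rw [← Complex.exp_add]; congr 1; push_cast; ring
    have e2 : (1 : ℂ) = Complex.exp ((φ / 2 : ℝ) * Complex.I) *
        Complex.exp ((-(φ / 2) : ℝ) * Complex.I) := by
      rw [← Complex.exp_add, ← Complex.exp_zero]; congr 1; push_cast; ring
    have e3 := hexp (φ / 2)
    rw [hexp (-(φ / 2)), Real.cos_neg, Real.sin_neg, Complex.ofReal_neg] at e2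
    rw [e1, Complex.ofReal_zero, zero_mul, Complex.exp_zero, mul_one, Complex.ofReal_mul,
      Complex.ofReal_mul]
    generalize Complex.exp ((φ / 2 : ℝ) * Complex.I) = w at *
    push_cast at e2 e3 ⊢
    linear_combination ((D j).rad * D.dir j * w) * e3 - ((D j).rad * D.dir j) * e2
  have hd : dot g (D.q (j + 1) - D.q (j + 2)) = 2 * (D j).rad * Real.sin (φ / 2) * dot g τ := by
    rw [hchord]; simp only [dot, Complex.re_ofReal_mul, Complex.im_ofReal_mul]; ring
  have hsin : φ / Real.pi ≤ Real.sin (φ / 2) := by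
    have := Real.mul_le_sin (x := φ / 2) (by linarith [ha.1]) (by linarith [ha.2])
    refine le_trans (le_of_eq ?_) this; field_simp
  have hs0 : 0 < φ / Real.pi := div_pos ha.1 hp0
  have hmain : (D j).rad ^ 2 * (dot g τ) ^ 2 * φ ≤
      5 / 2 * ((dot g (D.q (j + 1) - D.q (j + 2))) ^ 2 / φ) := by
    rw [hd, mul_div_assoc', le_div_iff₀ ha.1]
    have c : (φ / Real.pi) ^ 2 ≤ Real.sin (φ / 2) ^ 2 := pow_le_pow_left₀ hs0.le hsin 2
    rw [div_pow, div_le_iff₀ (by positivity)] at c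
    have c' : φ ^ 2 ≤ 10 * Real.sin (φ / 2) ^ 2 := by
      refine c.trans ?_
      rw [mul_comm]; refine mul_le_mul_of_nonneg_right ?_ (sq_nonneg _); nlinarith
    have := mul_le_mul_of_nonneg_left c' (by positivity : 0 ≤ (D j).rad ^ 2 * (dot g τ) ^ 2)
    nlinarith
  have hb : ∀ t ∈ Set.Ioc 0 φ, energyDens (fun z => a + dot g z) (D j) (D.sidePt j t) ≤
      ENNReal.ofReal (2 * (D j).rad ^ 2 * (dot g τ ^ 2 + ‖g‖ ^ 2 * (φ / 2) ^ 2)) := by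
    intro t ht
    rw [energyDens, sidePt, Disk.angDeriv_affine, ← ofReal_sq_eq, hτt]
    refine ENNReal.ofReal_le_ofReal ?_
    have e : dot g ((Real.cos (t - φ / 2) : ℝ) * τ + (Real.sin (t - φ / 2) : ℝ) * (τ * Complex.I)) =
        Real.cos (t - φ / 2) * dot g τ + Real.sin (t - φ / 2) * dot g (τ * Complex.I) := by
      simp only [dot, Complex.add_re, Complex.add_im, Complex.re_ofReal_mul, Complex.im_ofReal_mul]; ring
    rw [e, mul_pow]
    refine le_trans (mul_le_mul_of_nonneg_left (a := (D j).rad ^ 2)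
      (c := 2 * (dot g τ ^ 2 + ‖g‖ ^ 2 * (φ / 2) ^ 2)) ?_ (sq_nonneg _)) (le_of_eq (by ring))
    have s1 : Real.sin (t - φ / 2) ^ 2 ≤ (φ / 2) ^ 2 := by
      refine (Real.sin_sq_le_sq).trans (sq_le_sq' ?_ ?_) <;> linarith [ht.1, ht.2]
    have s2 := Real.cos_sq_le_one (t - φ / 2)
    have s3 : dot g (τ * Complex.I) ^ 2 ≤ ‖g‖ ^ 2 := by
      have := abs_dot_le g (τ * Complex.I)
      rw [norm_mul, hτn, Complex.norm_I, mul_one, mul_one] at this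
      rw [← sq_abs]; exact pow_le_pow_left₀ (abs_nonneg _) this 2
    have s4 : (Real.sin (t - φ / 2) * dot g (τ * Complex.I)) ^ 2 ≤ ‖g‖ ^ 2 * (φ / 2) ^ 2 := by
      rw [mul_pow, mul_comm]; exact mul_le_mul s3 s1 (sq_nonneg _) (sq_nonneg _)
    have s5 : (Real.cos (t - φ / 2) * dot g τ) ^ 2 ≤ dot g τ ^ 2 := by
      rw [mul_pow]; exact mul_le_of_le_one_left (sq_nonneg _) s2
    have := add_sq_le (a := Real.cos (t - φ / 2) * dot g τ) (b := Real.sin (t - φ / 2) * dot g (τ * Complex.I))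
    linarith
  calc _ ≤ ∫⁻ t in Set.Ioc 0 φ, ENNReal.ofReal (2 * (D j).rad ^ 2 * (dot g τ ^ 2 + ‖g‖ ^ 2 * (φ / 2) ^ 2)) :=
        setLIntegral_mono' measurableSet_Ioc hb
    _ ≤ _ := by
        rw [setLIntegral_const, Real.volume_Ioc, ← ENNReal.ofReal_mul (by positivity)]
        refine ENNReal.ofReal_le_ofReal ?_
        have c := mul_le_mul_of_nonneg_right (h.rad_sq_mul_angle_pow_le j) (sq_nonneg ‖g‖)
        rw [← hφ] at c
        nlinarith

/-- The vector g is recovered from its products with the two chords x, y issuing from `q j`. With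
`j` the smallest disk, the coefficients in this reconstruction are bounded by `radBound_chord_le`.
The chord x belongs to the disk `j + 2` and y to `j + 1`, which fixes the pairing with the angles.
-/
theorem radBound_mul_le (h : D.Kissing) (g : ℂ) : D.radBound * ‖g‖ ^ 2 ≤
    ∑ j, (dot g (D.q (j + 1) - D.q (j + 2))) ^ 2 / D.angle j := by
  obtain ⟨j, -, hj⟩ := Finset.exists_min_image Finset.univ (fun j => (D j).rad) ⟨0, Finset.mem_univ _⟩
  obtain ⟨e1, e2, e3, e4⟩ := fin3_add j
  have r1 := (D (j + 1)).rad_pos; have r2 := (D (j + 2)).rad_pos; have r0 := (D j).rad_pos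
  have m1 := hj (j + 1) (Finset.mem_univ _)
  have m2 := hj (j + 2) (Finset.mem_univ _)
  have hk := D.kappa_pos
  have hQ := h.cross_q j
  have n1 := h.norm_q_sub_q_sq (j + 1)
  have n2 := h.norm_q_sub_q_sq (j + 2)
  have a1 := h.angle_le (j + 1)
  have a2 := h.angle_le (j + 2)
  have p0 := h.angle_mem j; have p1 := h.angle_mem (j + 1); have p2 := h.angle_mem (j + 2)
  have ks := D.kappa_sq j
  rw [sum_fin3 j, e1, e2, e3, e4]
  rw [e1, e2] at n1
  rw [e3, e4] at n2
  set x := D.q (j + 1) - D.q j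
  set y := D.q (j + 2) - D.q j
  rw [norm_sub_rev] at n2
  change ‖x‖ ^ 2 * _ = _ at n2
  have hR : D.radBound = D.kappa * ((D j).rad * (D (j + 1)).rad * (D (j + 2)).rad) ^ 2 /
      (2 * (((D j).rad + (D (j + 1)).rad) * ((D (j + 1)).rad + (D (j + 2)).rad) *
        ((D (j + 2)).rad + (D j).rad))) := by
    rw [radBound, prod_add_fin3 (fun i => (D i).curv) j]
    simp only [Disk.curv]
    field_simp
    ring
  simp only [Disk.curv] at ks a1 a2
  set a := (D j).rad
  set b := (D (j + 1)).rad
  set c := (D (j + 2)).rad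
  have hs : D.kappa ^ 2 * (a * b * c) = a + b + c := by rw [ks]; field_simp; ring
  have hQ' : cross x y = 4 * (a * b * c) ^ 2 * D.kappa / ((a + b) * (b + c) * (c + a)) := by
    rw [eq_div_iff (by positivity)]; exact hQ
  have hy : ‖y‖ ^ 2 = 4 * b ^ 2 * c * a / ((b + c) * (b + a)) := by
    rw [eq_div_iff (by positivity), n1]; ring
  have hx : ‖x‖ ^ 2 = 4 * c ^ 2 * b * a / ((c + b) * (c + a)) := by
    rw [eq_div_iff (by positivity)]; linear_combination n2
  have i1 : D.radBound * (2 * ‖y‖ ^ 2 * D.angle (j + 2)) ≤ cross x y ^ 2 := by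
    rw [hR, hy, hQ']
    exact radBound_chord_le r0 r1 r2 hk m2 hs (a2.trans (le_of_eq (by field_simp)))
  have i2 : D.radBound * (2 * ‖x‖ ^ 2 * D.angle (j + 1)) ≤ cross x y ^ 2 := by
    have := radBound_chord_le (φ := D.angle (j + 1)) r0 r2 r1 hk m1 (by linarith)
      (a1.trans (le_of_eq (by field_simp)))
    rw [hR, hx, hQ']
    refine (le_of_eq ?_).trans (this.trans (le_of_eq ?_)) <;> ring
  have hQ0 : 0 < cross x y := by rw [hQ']; positivity
  have hg : (cross x y : ℂ) * g = (dot g x : ℂ) * (-(Complex.I * y)) + (dot g y : ℂ) * (Complex.I * x) := by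
    apply Complex.ext <;> simp [cross, dot] <;> ring
  have hn : cross x y * ‖g‖ ≤ |dot g x| * ‖y‖ + |dot g y| * ‖x‖ := by
    have := congrArg norm hg
    rw [norm_mul, Complex.norm_real, Real.norm_eq_abs, abs_of_pos hQ0] at this
    rw [this]
    refine (norm_add_le _ _).trans (le_of_eq ?_)
    simp
  have hn2 : cross x y ^ 2 * ‖g‖ ^ 2 ≤ 2 * (dot g x ^ 2 * ‖y‖ ^ 2 + dot g y ^ 2 * ‖x‖ ^ 2) := by
    rw [← mul_pow]
    refine (pow_le_pow_left₀ (by positivity) hn 2).trans (add_sq_le.trans (le_of_eq ?_))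
    rw [mul_pow, mul_pow, sq_abs, sq_abs]
  have hxn : dot g (D.q j - D.q (j + 1)) ^ 2 = dot g x ^ 2 := by simp only [dot_sub, x]; ring
  rw [hxn]
  have t0 : 0 ≤ dot g (D.q (j + 1) - D.q (j + 2)) ^ 2 / D.angle j := div_nonneg (sq_nonneg _) p0.1.le
  have hRp := D.radBound_pos
  have j1 : D.radBound * (2 * ‖y‖ ^ 2) ≤ cross x y ^ 2 / D.angle (j + 2) := by
    rw [le_div_iff₀ p2.1]; linarith
  have j2 : D.radBound * (2 * ‖x‖ ^ 2) ≤ cross x y ^ 2 / D.angle (j + 1) := by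
    rw [le_div_iff₀ p1.1]; linarith
  have k1 := mul_le_mul_of_nonneg_left j1 (sq_nonneg (dot g x))
  have k2 := mul_le_mul_of_nonneg_left j2 (sq_nonneg (dot g y))
  have k3 := mul_le_mul_of_nonneg_left hn2 hRp.le
  have k4 : cross x y ^ 2 * (D.radBound * ‖g‖ ^ 2) ≤
      cross x y ^ 2 * (dot g y ^ 2 / D.angle (j + 1) + dot g x ^ 2 / D.angle (j + 2)) := by
    calc _ = D.radBound * (cross x y ^ 2 * ‖g‖ ^ 2) := by ring
      _ ≤ dot g x ^ 2 * (cross x y ^ 2 / D.angle (j + 2)) +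
          dot g y ^ 2 * (cross x y ^ 2 / D.angle (j + 1)) := by linarith
      _ = _ := by ring
  have := le_of_mul_le_mul_left k4 (by positivity)
  linarith

/-- The energy of an affine function is controlled by its increments on the sides. -/
theorem totalInt_affine_le (h : D.Kissing) (a : ℝ) (g : ℂ) :
    totalInt (energyDens fun z => a + dot g z) D ≤
      100 * ∑ j, ENNReal.ofReal ((dot g (D.q (j + 1) - D.q (j + 2))) ^ 2 / D.angle j) := by
  have hp := Real.pi_lt_d2
  have hnn : ∀ j, 0 ≤ (dot g (D.q (j + 1) - D.q (j + 2))) ^ 2 / D.angle j := fun j =>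
    div_nonneg (sq_nonneg _) (h.angle_mem j).1.le
  set S := ∑ j, (dot g (D.q (j + 1) - D.q (j + 2))) ^ 2 / D.angle j with hS
  have hR := h.radBound_mul_le g
  have hRp := D.radBound_pos
  have hRg : 0 ≤ D.radBound * ‖g‖ ^ 2 := by positivity
  rw [← ENNReal.ofReal_sum_of_nonneg fun j _ => hnn j, ← hS, totalInt]
  calc _ ≤ ∑ j, ENNReal.ofReal (5 * ((dot g (D.q (j + 1) - D.q (j + 2))) ^ 2 / D.angle j) +
        28 * D.radBound * ‖g‖ ^ 2) + ENNReal.ofReal (2 * Real.pi * ‖g‖ ^ 2 * D.radBound) :=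
        add_le_add (Finset.sum_le_sum fun j _ => h.sideInt_affine_le a g j) (h.innerInt_affine_le a g)
    _ = ENNReal.ofReal (5 * S + 84 * (D.radBound * ‖g‖ ^ 2) + 2 * Real.pi * (D.radBound * ‖g‖ ^ 2)) := by
        rw [← ENNReal.ofReal_sum_of_nonneg fun j _ => by have := hnn j; positivity,
          Finset.sum_add_distrib, ← Finset.mul_sum, ← hS, ← ENNReal.ofReal_add]
        · congr 1; simp; ring
        · have : 0 ≤ S := Finset.sum_nonneg fun j _ => hnn j
          simp; positivity
        · have := Real.pi_pos; positivity
    -- As `radBound * ‖g‖ ^ 2` ≤ S and 2π < 7, the total is at most (5 + 84 + 7)S.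
    _ ≤ ENNReal.ofReal (100 * S) := by
        refine ENNReal.ofReal_le_ofReal ?_
        have : 2 * Real.pi * (D.radBound * ‖g‖ ^ 2) ≤ 7 * (D.radBound * ‖g‖ ^ 2) :=
          mul_le_mul_of_nonneg_right (by linarith) hRg
        linarith
    _ = _ := by rw [ENNReal.ofReal_mul (by norm_num)]; norm_num

/-- The affine function with prescribed values at the vertices. -/
theorem exists_affine (h : D.Kissing) (u : ℂ → ℝ) : ∃ (a : ℝ) (g : ℂ), ∀ j, a + dot g (D.q j) = u (D.q j) := by
  have hQ := h.cross_q 0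
  have r1 := (D (0 + 1)).rad_pos; have r2 := (D (0 + 2)).rad_pos; have r0 := (D 0).rad_pos
  have hk := D.kappa_pos
  have hQ0 : 0 < cross (D.q (0 + 1) - D.q 0) (D.q (0 + 2) - D.q 0) := by
    refine pos_of_mul_pos_left (b := (((D 0).rad + (D (0 + 1)).rad) *
      ((D (0 + 1)).rad + (D (0 + 2)).rad) * ((D (0 + 2)).rad + (D 0).rad))) ?_ (by positivity)
    rw [hQ]; positivity
  set x := D.q (0 + 1) - D.q 0 with hx
  set y := D.q (0 + 2) - D.q 0 with hy
  let A := (u (D.q (0 + 1)) - u (D.q 0)) / cross x y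
  let B := (u (D.q (0 + 2)) - u (D.q 0)) / cross x y
  let g : ℂ := (A : ℂ) * (-(Complex.I * y)) + (B : ℂ) * (Complex.I * x)
  have gx : dot g x = u (D.q (0 + 1)) - u (D.q 0) := by
    have : dot g x = A * cross x y := by simp [g, dot, cross]; ring
    rw [this, div_mul_cancel₀ _ hQ0.ne']
  have gy : dot g y = u (D.q (0 + 2)) - u (D.q 0) := by
    have : dot g y = B * cross x y := by simp [g, dot, cross]; ring
    rw [this, div_mul_cancel₀ _ hQ0.ne']
  rw [hx, dot_sub] at gx
  rw [hy, dot_sub] at gy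
  exact ⟨u (D.q 0) - dot g (D.q 0), g, (forall_fin3 0).2 ⟨by ring, by linarith, by linarith⟩⟩

/-- Among functions with given end values the linear one minimises the Dirichlet integral. With
`totalInt_affine_le` this bounds the energy of the affine interpolant of u by 100 times that of u.
-/
theorem ofReal_sq_div_angle_le (h : D.Kissing) {u : ℂ → ℝ} (hu : D.ACOnArcs u) (j : Fin 3) :
    ENNReal.ofReal ((u (D.q (j + 1)) - u (D.q (j + 2))) ^ 2 / D.angle j) ≤ sideInt (energyDens u) D j := by
  have ha := h.angle_mem j
  have := ac_sq_sub_le ha.1.le (hu.side j)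
  simp only [h.sidePt_zero, h.sidePt_angle, sub_zero] at this
  rw [← sideInt_energyDens, ← ofReal_sq_eq] at this
  rw [ENNReal.ofReal_div_of_pos ha.1]
  exact ENNReal.div_le_of_le_mul' this

end Kissing

end Triple

/-! ### One measure space for all arcs, and Lipschitz approximation -/

namespace Triple

/-- The initial direction of the parametrisation of an arc. -/
def arcDir (D : Triple) : ArcIndex → ℂ
  | Sum.inl j => D.dir j
  | Sum.inr _ => 1

/-- The length of the parameter interval of an arc. -/
def arcLen (D : Triple) : ArcIndex → ℝ
  | Sum.inl j => D.angle j
  | Sum.inr _ => 2 * Real.pi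

/-- The parametrisation of an arc by angles. -/
def arcPt (D : Triple) (i : ArcIndex) (t : ℝ) : ℂ := (D.arcDisk i).pt (D.arcDir i) t

/-- The arcs, parametrised by angles. -/
abbrev ArcParam := Σ _ : ArcIndex, ℝ

/-- The sum of the angular measures of the arcs. -/
def angularMeasure (D : Triple) : Measure ArcParam :=
  Measure.sum fun i => (volume.restrict (Set.Ioc 0 (D.arcLen i))).map (@Sigma.mk ArcIndex (fun _ => ℝ) i)

/-- The derivatives of `f` in the angular variables. -/
def arcDeriv (D : Triple) (f : ℂ → ℝ) (p : ArcParam) : ℝ := deriv (fun t => f (D.arcPt p.1 t)) p.2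

theorem measurableSet_arcParam {s : Set ArcParam} :
    MeasurableSet s ↔ ∀ i, MeasurableSet (@Sigma.mk ArcIndex (fun _ => ℝ) i ⁻¹' s) := by
  exact MeasurableSpace.measurableSet_iInf

theorem measurable_arcParam {β : Type*} [MeasurableSpace β] {f : ArcParam → β}
    (hf : ∀ i, Measurable fun t => f ⟨i, t⟩) : Measurable f := fun _ hs =>
  measurableSet_arcParam.2 fun i => hf i hs

theorem measurable_sigmaMk (i : ArcIndex) : Measurable (@Sigma.mk ArcIndex (fun _ => ℝ) i) := fun _ hs =>
  measurableSet_arcParam.1 hs i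

theorem measurableEmbedding_sigmaMk (i : ArcIndex) : MeasurableEmbedding (@Sigma.mk ArcIndex (fun _ => ℝ) i) where
  injective := sigma_mk_injective
  measurable := measurable_sigmaMk i
  measurableSet_image' := fun {s} hs => measurableSet_arcParam.2 fun k => by
    by_cases h : i = k
    · subst h; rwa [Set.preimage_image_eq _ sigma_mk_injective]
    · convert! MeasurableSet.empty
      ext t; simp only [Set.mem_preimage, Set.mem_image, Sigma.mk.injEq, Set.mem_empty_iff_false, iff_false]
      rintro ⟨x, -, hik, -⟩; exact h hik

theorem lintegral_angularMeasure (D : Triple) (G : ArcParam → ℝ≥0∞) :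
    ∫⁻ p, G p ∂D.angularMeasure = ∑' i, ∫⁻ t in Set.Ioc 0 (D.arcLen i), G ⟨i, t⟩ := by
  rw [angularMeasure, lintegral_sum_measure]
  exact tsum_congr fun i => (measurableEmbedding_sigmaMk i).lintegral_map G

theorem ae_angularMeasure {D : Triple} {P : ArcParam → Prop} :
    (∀ᵐ p ∂D.angularMeasure, P p) ↔ ∀ i, ∀ᵐ t ∂volume.restrict (Set.Ioc 0 (D.arcLen i)), P ⟨i, t⟩ := by
  rw [angularMeasure, Measure.ae_sum_iff]
  exact forall_congr' fun i => (measurableEmbedding_sigmaMk i).ae_map_iff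

theorem totalInt_eq_lintegral (D : Triple) (F : Disk → ℂ → ℝ≥0∞) :
    totalInt F D = ∫⁻ p, F (D.arcDisk p.1) (D.arcPt p.1 p.2) ∂D.angularMeasure := by
  rw [lintegral_angularMeasure, Summable.tsum_sum ENNReal.summable ENNReal.summable, tsum_fintype]
  rfl

theorem measurable_arcDeriv (D : Triple) (f : ℂ → ℝ) : Measurable (D.arcDeriv f) :=
  measurable_arcParam fun i => measurable_deriv fun t => f (D.arcPt i t)

theorem energyDens_arcPt (D : Triple) (f : ℂ → ℝ) (i : ArcIndex) (t : ℝ) :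
    energyDens f (D.arcDisk i) (D.arcPt i t) = ‖D.arcDeriv f ⟨i, t⟩‖ₑ ^ 2 := by
  rw [energyDens, arcPt, Disk.angDeriv_pt]; rfl

theorem totalInt_energyDens (D : Triple) (f : ℂ → ℝ) :
    totalInt (energyDens f) D = ∫⁻ p, ‖D.arcDeriv f p‖ₑ ^ 2 ∂D.angularMeasure := by
  rw [totalInt_eq_lintegral]
  exact lintegral_congr fun p => D.energyDens_arcPt f p.1 p.2

variable {D : Triple} {f g : ℂ → ℝ}

theorem ACOnArcs.arc (hf : D.ACOnArcs f) (i : ArcIndex) :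
    AbsolutelyContinuousOnInterval (fun t => f (D.arcPt i t)) 0 (D.arcLen i) := by
  cases i with
  | inl j => exact hf.side j
  | inr w => exact hf.circle w 1 norm_one _ _

theorem Kissing.arcLen_pos (h : D.Kissing) (i : ArcIndex) : 0 < D.arcLen i := by
  cases i with
  | inl j => exact (h.angle_mem j).1
  | inr w => exact Real.two_pi_pos

theorem Kissing.norm_arcDir (h : D.Kissing) (i : ArcIndex) : ‖D.arcDir i‖ = 1 := by
  cases i with
  | inl j => exact h.norm_dir j
  | inr w => exact norm_one

theorem ACOnArcs.ae_differentiableAt (hf : D.ACOnArcs f) (h : D.Kissing) :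
    ∀ᵐ p ∂D.angularMeasure, DifferentiableAt ℝ (fun t => f (D.arcPt p.1 t)) p.2 := by
  refine ae_angularMeasure.2 fun i => ?_
  refine (ae_restrict_iff' measurableSet_Ioc).2 ?_
  filter_upwards [(hf.arc i).ae_differentiableAt] with t ht hmem
  refine ht ?_
  rw [Set.uIcc_of_le (h.arcLen_pos i).le]; exact Set.Ioc_subset_Icc_self hmem

theorem ACOnArcs.sub (hf : D.ACOnArcs f) (hg : D.ACOnArcs g) : D.ACOnArcs fun x => f x - g x :=
  ⟨fun j => (hf.side j).sub (hg.side j), fun w v hv a b => (hf.circle w v hv a b).sub (hg.circle w v hv a b)⟩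

theorem ACOnArcs.add (hf : D.ACOnArcs f) (hg : D.ACOnArcs g) : D.ACOnArcs fun x => f x + g x :=
  ⟨fun j => (hf.side j).add (hg.side j), fun w v hv a b => (hf.circle w v hv a b).add (hg.circle w v hv a b)⟩

theorem ACOnArcs.const_mul (hf : D.ACOnArcs f) (c : ℝ) : D.ACOnArcs fun x => c * f x :=
  ⟨fun j => (hf.side j).const_mul c, fun w v hv a b => (hf.circle w v hv a b).const_mul c⟩

theorem ACOnArcs.comp_lipschitz (hf : D.ACOnArcs f) {φ : ℝ → ℝ} {K : ℝ≥0} (hφ : LipschitzWith K φ) :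
    D.ACOnArcs fun x => φ (f x) :=
  ⟨fun j => ac_comp_lipschitz hφ (hf.side j), fun w v hv a b => ac_comp_lipschitz hφ (hf.circle w v hv a b)⟩

theorem _root_.Apollonian.Disk.lipschitzWith_pt (B : Disk) {v : ℂ} (hv : ‖v‖ = 1) :
    LipschitzWith (Real.toNNReal B.rad) (B.pt v) := by
  refine lipschitzWith_of_nnnorm_deriv_le (fun t => (B.hasDerivAt_pt v t).differentiableAt) fun t => ?_
  rw [(B.hasDerivAt_pt v t).deriv, ← NNReal.coe_le_coe, coe_nnnorm, norm_mul, norm_mul, norm_mul, hv,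
    Complex.norm_exp_ofReal_mul_I, Complex.norm_I, Complex.norm_real, Real.norm_eq_abs,
    abs_of_pos B.rad_pos, Real.coe_toNNReal _ B.rad_pos.le]
  simp

theorem Kissing.acOnArcs_of_lipschitz (h : D.Kissing) {L : ℝ≥0} (hf : LipschitzWith L f) : D.ACOnArcs f :=
  ⟨fun j => ((hf.comp ((D j).lipschitzWith_pt (h.norm_dir j))).lipschitzOnWith
      (s := Set.uIcc _ _)).absolutelyContinuousOnInterval,
    fun w _ hv _ _ => ((hf.comp ((D.word w).inscribed.lipschitzWith_pt hv)).lipschitzOnWith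
      (s := Set.uIcc _ _)).absolutelyContinuousOnInterval⟩

theorem ACOnArcs.arcDeriv_sub (hf : D.ACOnArcs f) (hg : D.ACOnArcs g) (h : D.Kissing) :
    D.arcDeriv (fun x => f x - g x) =ᵐ[D.angularMeasure] fun p => D.arcDeriv f p - D.arcDeriv g p := by
  filter_upwards [hf.ae_differentiableAt h, hg.ae_differentiableAt h] with p h1 h2
  exact deriv_fun_sub h1 h2

theorem ACOnArcs.arcDeriv_add (hf : D.ACOnArcs f) (hg : D.ACOnArcs g) (h : D.Kissing) :
    D.arcDeriv (fun x => f x + g x) =ᵐ[D.angularMeasure] fun p => D.arcDeriv f p + D.arcDeriv g p := by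
  filter_upwards [hf.ae_differentiableAt h, hg.ae_differentiableAt h] with p h1 h2
  exact deriv_fun_add h1 h2

theorem arcDeriv_const_mul (D : Triple) (c : ℝ) (f : ℂ → ℝ) :
    D.arcDeriv (fun x => c * f x) = fun p => c * D.arcDeriv f p := by
  ext p; exact deriv_const_mul_field c

theorem ACOnArcs.totalInt_sub_le (hf : D.ACOnArcs f) (hg : D.ACOnArcs g) (h : D.Kissing) :
    totalInt (energyDens fun x => f x - g x) D ≤
      2 * (totalInt (energyDens f) D + totalInt (energyDens g) D) := by
  simp only [totalInt_energyDens]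
  have hm : Measurable fun p => ‖D.arcDeriv f p‖ₑ ^ 2 + ‖D.arcDeriv g p‖ₑ ^ 2 :=
    ((D.measurable_arcDeriv f).enorm.pow_const 2).add ((D.measurable_arcDeriv g).enorm.pow_const 2)
  rw [← lintegral_add_left ((D.measurable_arcDeriv f).enorm.pow_const 2), ← lintegral_const_mul _ hm]
  refine lintegral_mono_ae ?_
  filter_upwards [hf.arcDeriv_sub hg h] with p hp
  rw [hp]
  simp only [← ofReal_sq_eq]
  rw [← ENNReal.ofReal_add (sq_nonneg _) (sq_nonneg _), ← ENNReal.ofReal_ofNat 2,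
    ← ENNReal.ofReal_mul zero_le_two]
  refine ENNReal.ofReal_le_ofReal ?_
  nlinarith [sq_nonneg (D.arcDeriv f p + D.arcDeriv g p)]

theorem Kissing.arcPt_mem (h : D.Kissing) {i : ArcIndex} {t : ℝ} (ht : t ∈ Set.Icc 0 (D.arcLen i)) :
    D.arcPt i t ∈ D.arc i := by
  cases i with
  | inl j => exact h.sidePt_mem ht
  | inr w => exact Disk.pt_mem_boundary _ norm_one t

theorem Kissing.ae_arcDeriv_congr (h : D.Kissing) (hfg : ∀ x ∈ D.arcUnion, f x = g x) :
    D.arcDeriv f =ᵐ[D.angularMeasure] D.arcDeriv g := by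
  refine ae_angularMeasure.2 fun i => ?_
  rw [← restrict_Ioo_eq_restrict_Ioc, ae_restrict_iff' measurableSet_Ioo]
  refine ae_of_all _ fun t ht => Filter.EventuallyEq.deriv_eq ?_
  filter_upwards [Ioo_mem_nhds ht.1 ht.2] with s hs
  exact hfg _ (Set.mem_iUnion.2 ⟨i, h.arcPt_mem (Set.Ioo_subset_Icc_self hs)⟩)

theorem Kissing.totalInt_energyDens_congr (h : D.Kissing) (hfg : ∀ x ∈ D.arcUnion, f x = g x) :
    totalInt (energyDens f) D = totalInt (energyDens g) D := by
  simp only [totalInt_energyDens]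
  refine lintegral_congr_ae ?_
  filter_upwards [h.ae_arcDeriv_congr hfg] with p hp
  rw [hp]

theorem Kissing.totalInt_massDens_congr (h : D.Kissing) (hfg : ∀ x ∈ D.arcUnion, f x = g x) :
    totalInt (massDens f) D = totalInt (massDens g) D := by
  simp only [totalInt_eq_lintegral]
  refine lintegral_congr_ae (ae_angularMeasure.2 fun i => ?_)
  refine (ae_restrict_iff' measurableSet_Ioc).2 (ae_of_all _ fun t ht => ?_)
  simp only [massDens]
  rw [hfg _ (Set.mem_iUnion.2 ⟨i, h.arcPt_mem (Set.Ioc_subset_Icc_self ht)⟩)]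

theorem Kissing.q_mem_gasket (h : D.Kissing) (j : Fin 3) : D.q j ∈ D.gasket :=
  h.arc_subset_gasket (Sum.inl (j + 1)) (by
    have := h.q_mem_arc_fst (j + 1)
    rwa [(fin3_add j).2.1] at this)

theorem Kissing.le_curv_step (h : D.Kissing) {s : ℝ} (hsD : ∀ j, s ≤ (D j).curv) (k j : Fin 3) :
    s ≤ (D.step k j).curv := by
  by_cases hjk : j = k
  · subst hjk
    rw [step_self, h.curv_inscribed, inCurv]
    have := hsD 0; have := D.kappa_pos; have := D.curv_pos 1; have := D.curv_pos 2
    linarith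
  · rw [step_of_ne _ hjk]; exact hsD j

/-- Approximation by Lipschitz functions with controlled energy. -/
theorem ACOnArcs.exists_lipschitz_approx {u : ℂ → ℝ} {s : ℝ} (hs : 0 < s) (n : ℕ) :
    ∀ {D : Triple}, D.Kissing → (∀ j, s ≤ (D j).curv) → D.ACOnArcs u →
    ∃ f : ℂ → ℝ, (∃ L : ℝ≥0, LipschitzWith L f) ∧ (∀ j, f (D.q j) = u (D.q j)) ∧
      totalInt (energyDens f) D ≤ 100 * totalInt (energyDens u) D ∧
      totalInt (massDens fun x => u x - f x) D ≤
        ENNReal.ofReal (40 / (D.kappa + 2 * n * s) ^ 2) * (202 * totalInt (energyDens u) D) := by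
  induction n with
  | zero =>
    intro D h hsD hu
    obtain ⟨a, g, hag⟩ := h.exists_affine u
    have hL : LipschitzWith ‖g‖₊ fun z => a + dot g z := LipschitzWith.of_dist_le_mul fun x y => by
      rw [Real.dist_eq, add_sub_add_left_eq_sub, ← dot_sub, dist_eq_norm]
      exact abs_dot_le _ _
    have hE : totalInt (energyDens fun z => a + dot g z) D ≤ 100 * totalInt (energyDens u) D := by
      refine (h.totalInt_affine_le a g).trans (mul_le_mul_right ?_ _)
      refine le_trans (Finset.sum_le_sum fun j _ => ?_) (le_self_add : _ ≤ totalInt (energyDens u) D)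
      refine le_trans (le_of_eq ?_) (h.ofReal_sq_div_angle_le hu j)
      rw [← hag, ← hag, dot_sub]; congr 3; ring
    have hf := h.acOnArcs_of_lipschitz hL
    refine ⟨_, ⟨_, hL⟩, hag, hE, ?_⟩
    refine ((hu.sub hf).totalInt_massDens_le h (fun j => by rw [hag, sub_self])).trans ?_
    rw [Nat.cast_zero, mul_zero, zero_mul, add_zero]
    -- 202 = 2(1 + 100).
    refine mul_le_mul_right ((hu.totalInt_sub_le hf h).trans ?_) _
    calc _ ≤ 2 * (totalInt (energyDens u) D + 100 * totalInt (energyDens u) D) := by gcongr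
      _ = _ := by ring
  | succ n ih =>
    intro D h hsD hu
    -- Each child is approximated separately. At a common vertex both approximants take the value of
    -- u, which makes the gluing possible.
    choose fk hL hq hE hM using fun k => ih (h.step k) (h.le_curv_step hsD k) (hu.step h k)
    obtain ⟨f, hfL, hf⟩ := exists_lipschitzWith_glue (G := fun k => (D.step k).gasket) hL
      fun i k hik => by
        obtain ⟨e, C, hC⟩ := h.exists_dist_add_dist_le hik
        refine ⟨(D.step i).q k, ?_, C, hC⟩
        rw [hq i, e, hq k]
    have hfU : ∀ k, ∀ x ∈ (D.step k).arcUnion, f x = fk k x := fun k x hx =>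
      hf k x ((h.step k).arcUnion_subset_gasket hx)
    refine ⟨f, hfL, fun j => ?_, ?_, ?_⟩
    · have := hf j _ ((h.step j).q_mem_gasket j)
      rw [hq, D.q_step h] at this
      exact this
    · rw [h.totalInt_step, h.totalInt_step (energyDens u), Finset.mul_sum]
      refine Finset.sum_le_sum fun k _ => ?_
      rw [(h.step k).totalInt_energyDens_congr (hfU k)]
      exact hE k
    · rw [h.totalInt_step, h.totalInt_step (energyDens u), Finset.mul_sum, Finset.mul_sum]
      refine Finset.sum_le_sum fun k _ => ?_
      rw [(h.step k).totalInt_massDens_congr (g := fun x => u x - fk k x)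
        fun x hx => by rw [hfU k x hx]]
      -- The κ of a child is at least κ + 2s, which supplies the level lost in the induction.
      refine (hM k).trans (mul_le_mul_left (ENNReal.ofReal_le_ofReal ?_) _)
      have hk := D.kappa_pos
      have := h.kappa_step k
      have s1 := hsD (k + 1)
      have s2 := hsD (k + 2)
      have hn : (0 : ℝ) ≤ n * s := by positivity
      refine div_le_div_of_nonneg_left (by norm_num) (by positivity)
        (pow_le_pow_left₀ (by positivity) ?_ 2)
      push_cast
      nlinarith

end Triple

/-! ### The measures on arcs and on the gasket in angular coordinates -/

namespace Disk

theorem circleMap_eq_pt (B : Disk) : circleMap B.cent B.rad = B.pt 1 := by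
  ext t; rw [circleMap, pt, mul_one]

/-- The starting direction and the branch of the angle can be chosen freely: (-π, π] suits the sides
and (0, 2π] the circles. -/
theorem lengthMeasure_eq (B : Disk) {v : ℂ} (hv : ‖v‖ = 1) (a : ℝ) : B.lengthMeasure =
    ENNReal.ofReal B.rad • (volume.restrict (Set.Ioc a (a + 2 * Real.pi))).map (B.pt v) := by
  rw [lengthMeasure, circleMap_eq_pt]
  congr 1
  ext s hs
  have hm : Measurable (s.indicator (1 : ℂ → ℝ≥0∞)) := measurable_one.indicator hs
  rw [← lintegral_indicator_one hs, ← lintegral_indicator_one hs, lintegral_map hm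
    (B.continuous_pt 1).measurable, lintegral_map hm (B.continuous_pt v).measurable]
  have h1 := setLIntegral_Ioc_periodic (G := fun t => s.indicator (1 : ℂ → ℝ≥0∞) (B.pt 1 t))
    (fun t => by simp only [B.periodic_pt 1 t]) (-Real.pi) 0
  have h2 := setLIntegral_Ioc_periodic (G := fun t => s.indicator (1 : ℂ → ℝ≥0∞) (B.pt v t))
    (fun t => by simp only [B.periodic_pt v t]) a 0
  have h3 := circInt_eq (fun _ => s.indicator (1 : ℂ → ℝ≥0∞)) B hv
  rw [show -Real.pi + 2 * Real.pi = Real.pi by ring, zero_add] at h1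
  rw [zero_add] at h2
  rw [h1, h2, ← h3, circInt]

theorem injOn_pt (B : Disk) {v : ℂ} (hv : ‖v‖ = 1) {L : ℝ} (hL : L ≤ 2 * Real.pi) :
    Set.InjOn (B.pt v) (Set.Ioc 0 L) := by
  intro s hs t ht hst
  have hp := Real.pi_pos
  have hv0 : v ≠ 0 := by rw [← norm_pos_iff, hv]; exact one_pos
  have hr : (B.rad : ℂ) ≠ 0 := by exact_mod_cast B.rad_pos.ne'
  simp only [pt, add_right_inj] at hst
  obtain ⟨n, hn⟩ := Complex.exp_eq_exp_iff_exists_int.1 (mul_left_cancel₀ (mul_ne_zero hr hv0) hst)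
  have e : s = t + n * (2 * Real.pi) := by
    have h2 := congrArg Complex.im hn
    simpa using h2
  have n1 : (n : ℝ) < 1 := by
    by_contra hc; push Not at hc; nlinarith [hs.2, ht.1]
  have n2 : (-1 : ℝ) < n := by
    by_contra hc; push Not at hc; nlinarith [hs.1, ht.2]
  have : n = 0 := by
    have n1 : n < 1 := by exact_mod_cast n1
    have n2 : -1 < n := by exact_mod_cast n2
    omega
  rw [e, this]; simp

end Disk

namespace Triple

variable {D : Triple} {f : ℂ → ℝ}

theorem continuous_arcPt (D : Triple) (i : ArcIndex) : Continuous (D.arcPt i) := Disk.continuous_pt _ _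

namespace Kissing

theorem arcLen_le (h : D.Kissing) (i : ArcIndex) : D.arcLen i ≤ 2 * Real.pi := by
  cases i with
  | inl j => have := (h.angle_mem j).2; have := Real.pi_pos; simp only [arcLen]; linarith
  | inr w => exact le_rfl

theorem arc_eq_image (h : D.Kissing) (i : ArcIndex) : D.arc i = D.arcPt i '' Set.Icc 0 (D.arcLen i) := by
  cases i with
  | inl j => exact h.arc_inl_eq j
  | inr w =>
    refine Set.Subset.antisymm (fun x hx => ?_) ?_
    · obtain ⟨t, -, rfl⟩ := (D.word w).inscribed.exists_pt_eq norm_one hx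
      obtain ⟨s, hs, hst⟩ := ((D.word w).inscribed.periodic_pt 1).exists_mem_Ico₀ Real.two_pi_pos t
      exact ⟨s, Set.Ico_subset_Icc_self hs, hst.symm⟩
    · rintro _ ⟨t, ht, rfl⟩; exact h.arcPt_mem ht

theorem isCompact_arc (h : D.Kissing) (i : ArcIndex) : IsCompact (D.arc i) := by
  rw [h.arc_eq_image]; exact isCompact_Icc.image (D.continuous_arcPt i)

theorem arcMeasure_eq (h : D.Kissing) (i : ArcIndex) : D.arcMeasure i =
    ENNReal.ofReal (D.arcDisk i).rad • (volume.restrict (Set.Ioc 0 (D.arcLen i))).map (D.arcPt i) := by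
  have hm := (h.isCompact_arc i).measurableSet
  cases i with
  | inl j =>
    have ha := h.angle_mem j
    rw [arcMeasure, arcDisk, (D j).lengthMeasure_eq (h.norm_dir j) (-Real.pi), Measure.restrict_smul,
      Measure.restrict_map ((D j).continuous_pt _).measurable hm,
      Measure.restrict_restrict (((D j).continuous_pt _).measurable hm)]
    congr 2
    rw [Measure.restrict_congr_set (Ioc_ae_eq_Icc (a := 0))]
    congr 1
    ext t
    rw [show -Real.pi + 2 * Real.pi = Real.pi by ring]
    constructor
    · rintro ⟨h1, h2⟩; exact (h.sidePt_mem_iff h2).1 h1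
    · intro ht
      exact ⟨h.sidePt_mem ht, by linarith [ht.1, Real.pi_pos], by simp only [arcLen] at ht; linarith [ht.2, ha.2]⟩
  | inr w =>
    rw [arcMeasure, arcDisk, (D.word w).inscribed.lengthMeasure_eq norm_one 0, Measure.restrict_smul,
      Measure.restrict_map ((D.word w).inscribed.continuous_pt _).measurable hm, zero_add]
    congr 2
    rw [Set.eq_univ_of_forall (s := (D.word w).inscribed.pt 1 ⁻¹' D.arc (Sum.inr w))
      fun t => Disk.pt_mem_boundary _ norm_one t, Measure.restrict_univ]
    rfl

/-- On the half-open interval the parametrisation is injective. As a measurable embedding it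
transports integrals of arbitrary functions, without measurability hypotheses on them. -/
theorem measurableEmbedding_arcPt (h : D.Kissing) (i : ArcIndex) :
    MeasurableEmbedding ((Set.Ioc 0 (D.arcLen i)).domRestrict (D.arcPt i)) :=
  (D.continuous_arcPt i).continuousOn.measurableEmbedding measurableSet_Ioc
    ((D.arcDisk i).injOn_pt (h.norm_arcDir i) (h.arcLen_le i))

theorem map_arcPt_eq (D : Triple) (i : ArcIndex) :
    (volume.restrict (Set.Ioc 0 (D.arcLen i))).map (D.arcPt i) =
      (volume.comap Subtype.val).map ((Set.Ioc 0 (D.arcLen i)).domRestrict (D.arcPt i)) := by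
  rw [← map_comap_subtype_coe measurableSet_Ioc, Measure.map_map (D.continuous_arcPt i).measurable
    measurable_subtype_coe]
  rfl

theorem lintegral_arcMeasure (h : D.Kissing) (i : ArcIndex) (G : ℂ → ℝ≥0∞) : ∫⁻ x, G x ∂D.arcMeasure i =
    ENNReal.ofReal (D.arcDisk i).rad * ∫⁻ t in Set.Ioc 0 (D.arcLen i), G (D.arcPt i t) := by
  rw [h.arcMeasure_eq, lintegral_smul_measure, map_arcPt_eq, (h.measurableEmbedding_arcPt i).lintegral_map]
  exact congrArg _ (lintegral_subtype_comap measurableSet_Ioc fun t => G (D.arcPt i t))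

theorem integral_arcMeasure (h : D.Kissing) (i : ArcIndex) (G : ℂ → ℝ) : ∫ x, G x ∂D.arcMeasure i =
    (D.arcDisk i).rad * ∫ t in Set.Ioc 0 (D.arcLen i), G (D.arcPt i t) := by
  rw [h.arcMeasure_eq, integral_smul_measure, map_arcPt_eq, (h.measurableEmbedding_arcPt i).integral_map,
    ENNReal.toReal_ofReal (D.arcDisk i).rad_pos.le, smul_eq_mul]
  exact congrArg _ (integral_subtype_comap measurableSet_Ioc fun t => G (D.arcPt i t))

theorem aestronglyMeasurable_arcMeasure (h : D.Kissing) (i : ArcIndex) {E : Type*} [TopologicalSpace E]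
    {G : ℂ → E} (hG : AEStronglyMeasurable (fun t => G (D.arcPt i t)) (volume.restrict (Set.Ioc 0 (D.arcLen i)))) :
    AEStronglyMeasurable G (D.arcMeasure i) := by
  rw [h.arcMeasure_eq, map_arcPt_eq]
  refine AEStronglyMeasurable.smul_measure ?_ _
  rw [(h.measurableEmbedding_arcPt i).aestronglyMeasurable_map_iff]
  rw [← map_comap_subtype_coe measurableSet_Ioc,
    (MeasurableEmbedding.subtype_coe measurableSet_Ioc).aestronglyMeasurable_map_iff] at hG
  exact hG

theorem lintegral_ambientMeasure (h : D.Kissing) (G : ℂ → ℝ≥0∞) : ∫⁻ x, G x ∂D.ambientMeasure =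
    totalInt (fun B x => ENNReal.ofReal (B.rad ^ 2) * G x) D := by
  rw [ambientMeasure, lintegral_sum_measure, totalInt_eq_lintegral, lintegral_angularMeasure]
  refine tsum_congr fun i => ?_
  change _ = ∫⁻ t in Set.Ioc 0 (D.arcLen i), ENNReal.ofReal ((D.arcDisk i).rad ^ 2) * G (D.arcPt i t)
  rw [lintegral_smul_measure, h.lintegral_arcMeasure, lintegral_const_mul' _ _ ENNReal.ofReal_ne_top,
    smul_eq_mul, ← mul_assoc, ← ENNReal.ofReal_mul (D.arcDisk i).rad_pos.le, sq]

theorem ambientMeasure_restrict (h : D.Kissing) : D.ambientMeasure.restrict D.gasket = D.ambientMeasure := by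
  refine Measure.restrict_eq_self_of_ae_mem ?_
  rw [ambientMeasure, Measure.ae_sum_iff]
  intro i
  refine Measure.ae_smul_measure ?_ _
  rw [arcMeasure]
  filter_upwards [ae_restrict_mem (h.isCompact_arc i).measurableSet] with x hx
  exact h.arc_subset_gasket i hx

theorem lintegral_gasketMeasure (h : D.Kissing) (G : ℂ → ℝ≥0∞) : ∫⁻ x, G x ∂D.gasketMeasure =
    totalInt (fun B x => ENNReal.ofReal (B.rad ^ 2) * G x) D := by
  rw [gasketMeasure, lintegral_subtype_comap h.isCompact_gasket.measurableSet, h.ambientMeasure_restrict,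
    h.lintegral_ambientMeasure]

theorem map_gasketMeasure (h : D.Kissing) : D.gasketMeasure.map Subtype.val = D.ambientMeasure := by
  rw [gasketMeasure, map_comap_subtype_coe h.isCompact_gasket.measurableSet, h.ambientMeasure_restrict]

/-- The weights rad(C) are positive, so null sets of the gasket measure are exactly those that are
null in every parameter interval. -/
theorem ae_gasketMeasure (h : D.Kissing) {P : ℂ → Prop} : (∀ᵐ x : D.gasket ∂D.gasketMeasure, P x) ↔
    ∀ᵐ p ∂D.angularMeasure, P (D.arcPt p.1 p.2) := by
  have e := (MeasurableEmbedding.subtype_coe h.isCompact_gasket.measurableSet).ae_map_iff (p := P)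
    (μ := D.gasketMeasure)
  rw [← e, h.map_gasketMeasure, ambientMeasure, Measure.ae_sum_iff, ae_angularMeasure]
  refine forall_congr' fun i => ?_
  have hr : ENNReal.ofReal (D.arcDisk i).rad ≠ 0 := (ENNReal.ofReal_pos.2 (D.arcDisk i).rad_pos).ne'
  rw [Measure.ae_ennreal_smul_measure_iff hr, h.arcMeasure_eq, Measure.ae_ennreal_smul_measure_iff hr, map_arcPt_eq,
    (h.measurableEmbedding_arcPt i).ae_map_iff, ← map_comap_subtype_coe measurableSet_Ioc,
    (MeasurableEmbedding.subtype_coe measurableSet_Ioc).ae_map_iff]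
  rfl

theorem aestronglyMeasurable_gasketMeasure (h : D.Kissing) (hf : D.ACOnArcs f) :
    AEStronglyMeasurable (fun x : D.gasket => f x) D.gasketMeasure := by
  refine ((MeasurableEmbedding.subtype_coe h.isCompact_gasket.measurableSet).aestronglyMeasurable_map_iff
    (g := f)).1 ?_
  rw [h.map_gasketMeasure, ambientMeasure, aestronglyMeasurable_sum_measure_iff]
  refine fun i => AEStronglyMeasurable.smul_measure (h.aestronglyMeasurable_arcMeasure i ?_) _
  have := (hf.arc i).continuousOn
  rw [Set.uIcc_of_le (h.arcLen_pos i).le] at this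
  exact (this.mono Set.Ioc_subset_Icc_self).aestronglyMeasurable measurableSet_Ioc

theorem lintegral_sq_gasketMeasure (h : D.Kissing) (f : ℂ → ℝ) :
    ∫⁻ x, ‖f x‖ₑ ^ 2 ∂D.gasketMeasure = totalInt (massDens f) D :=
  h.lintegral_gasketMeasure fun x => ‖f x‖ₑ ^ 2

theorem gasketMeasure_univ_lt_top (h : D.Kissing) : D.gasketMeasure Set.univ < ∞ := by
  have hp := Real.pi_pos
  have := h.lintegral_gasketMeasure fun _ => 1
  rw [lintegral_one] at this
  rw [this, totalInt]
  simp only [mul_one]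
  refine ENNReal.add_lt_top.2 ⟨ENNReal.sum_lt_top.2 fun j _ => ?_, ?_⟩
  · rw [sideInt, setLIntegral_const, Real.volume_Ioc]
    exact ENNReal.mul_lt_top ENNReal.ofReal_lt_top ENNReal.ofReal_lt_top
  · rw [innerInt]
    have : ∀ B : Disk, circInt (fun B x => ENNReal.ofReal (B.rad ^ 2)) B =
        ENNReal.ofReal (B.rad ^ 2) * ENNReal.ofReal (2 * Real.pi) := fun B => by
      rw [circInt, setLIntegral_const, Real.volume_Ioc, sub_zero]
    simp only [this]
    rw [ENNReal.tsum_mul_right]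
    exact ENNReal.mul_lt_top (h.tsum_rad_sq_le.trans_lt ENNReal.ofReal_lt_top) ENNReal.ofReal_lt_top

theorem isFiniteMeasure_gasketMeasure (h : D.Kissing) : IsFiniteMeasure D.gasketMeasure :=
  ⟨h.gasketMeasure_univ_lt_top⟩

theorem norm_cent_sub_q_sq (h : D.Kissing) (j : Fin 3) : ‖(D j).cent - D.q j‖ ^ 2 *
    ((D (j + 1)).rad + (D (j + 2)).rad) = (D j).rad ^ 2 * ((D (j + 1)).rad + (D (j + 2)).rad) +
      4 * (D j).rad * (D (j + 1)).rad * (D (j + 2)).rad := by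
  have r1 := (D (j + 1)).rad_pos; have r2 := (D (j + 2)).rad_pos; have r0 := (D j).rad_pos
  have e : ((D (j + 1)).rad + (D (j + 2)).rad) ^ 2 * ‖(D j).cent - D.q j‖ ^ 2 =
      (D (j + 2)).rad ^ 2 * ‖(D (j + 1)).cent - (D j).cent‖ ^ 2 +
      (D (j + 1)).rad ^ 2 * ‖(D (j + 2)).cent - (D j).cent‖ ^ 2 + 2 * (D (j + 1)).rad * (D (j + 2)).rad *
        dot ((D (j + 1)).cent - (D j).cent) ((D (j + 2)).cent - (D j).cent) := by
    rw [h.q_eq]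
    simp only [norm_sq_eq_dot, dot, Disk.contact, Complex.sub_re, Complex.sub_im, Complex.add_re,
      Complex.add_im, Complex.re_ofReal_mul, Complex.im_ofReal_mul]
    field_simp
    ring
  rw [h.two_dot, h.dist _ _ (fin3_ne j).1, h.dist _ _ (fin3_ne j).2.1] at e
  have hp : 0 < (D (j + 1)).rad + (D (j + 2)).rad := by positivity
  refine mul_left_cancel₀ hp.ne' ?_
  linear_combination e

/-- The curved triangle is small if `κ` is large. -/
theorem exists_norm_sub_q_le (h : D.Kissing) : ∃ j, ∀ z ∈ D.curvTriangle, ‖z - D.q j‖ ≤ 5 / D.kappa := by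
  obtain ⟨j, -, hj⟩ := Finset.exists_min_image Finset.univ (fun j => (D j).rad) ⟨0, Finset.mem_univ _⟩
  refine ⟨j, fun z hz => ?_⟩
  have r1 := (D (j + 1)).rad_pos; have r2 := (D (j + 2)).rad_pos; have r0 := (D j).rad_pos
  have m1 := hj (j + 1) (Finset.mem_univ _)
  have m2 := hj (j + 2) (Finset.mem_univ _)
  have hk := D.kappa_pos
  have ks := D.kappa_sq j
  have n := h.norm_cent_sub_q_sq j
  have ha := h.area_pos
  have hn := h.norm_sub_q_le j hz
  have hb : D.bary j z ≤ D.area := by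
    have := D.bary_add j z; have := (hz (j + 1)).2; have := (hz (j + 2)).2; linarith
  simp only [Disk.curv] at ks
  set a := (D j).rad
  set b := (D (j + 1)).rad
  set c := (D (j + 2)).rad
  have hs : D.kappa ^ 2 * (a * b * c) = a + b + c := by
    rw [ks]; field_simp; ring
  set N := ‖(D j).cent - D.q j‖
  have hN0 : 0 ≤ N := norm_nonneg _
  -- For the smallest radius a the distance from the centre to `q j` is at most 3/κ, and below a ≤
  -- 2/κ. As `bary j z` ≤ `area`, `norm_sub_q_le` bounds the distance by their sum 5/κ.
  have hN : (N * D.kappa) ^ 2 ≤ 9 := by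
    have e : (N * D.kappa) ^ 2 * ((b + c) * (a * b * c)) =
        (a ^ 2 * (b + c) + 4 * a * b * c) * (a + b + c) := by
      rw [← n, ← hs]; ring
    refine le_of_mul_le_mul_right ?_ (by positivity : 0 < (b + c) * (a * b * c))
    rw [e]
    have h1 : a * (b + c) ≤ 2 * (b * c) := by nlinarith
    have h2 : (b + c) * a * (a + b + c) ≤ 3 * ((b + c) * (b * c)) := by
      have : a * (a + b + c) ≤ 3 * (b * c) := by nlinarith
      nlinarith
    have h3 : 4 * (a * b * c) * (a + b + c) ≤ 6 * ((b + c) * (a * b * c)) := by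
      have : 0 < a * b * c := by positivity
      nlinarith
    nlinarith
  have hN' : N * D.kappa ≤ 3 := by nlinarith [mul_nonneg hN0 hk.le]
  have hA : (a * D.kappa) ^ 2 ≤ 4 := by
    refine le_of_mul_le_mul_right ?_ (by positivity : 0 < b * c)
    have e : (a * D.kappa) ^ 2 * (b * c) = a * (a + b + c) := by rw [← hs]; ring
    rw [e]; nlinarith
  have hA' : a * D.kappa ≤ 2 := by nlinarith [mul_nonneg r0.le hk.le]
  have h5 : D.area * ‖z - D.q j‖ ≤ D.area * (N + a) := by
    rw [mul_comm D.area (N + a)]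
    exact hn.trans (mul_le_mul_of_nonneg_left hb (by positivity))
  have h6 := le_of_mul_le_mul_left h5 ha
  rw [le_div_iff₀ hk]
  nlinarith

theorem exists_word_mem (h : D.Kissing) (n : ℕ) {x : ℂ} (hx : x ∈ D.gasket) :
    ∃ w : List (Fin 3), w.length = n ∧ x ∈ (D.word w).gasket := by
  induction n generalizing D with
  | zero => exact ⟨[], rfl, hx⟩
  | succ n ih =>
    obtain ⟨j, hj⟩ := h.mem_gasket_iff_step.1 hx
    obtain ⟨w, hw, hm⟩ := ih (h.step j) hj
    exact ⟨j :: w, by simp [hw], hm⟩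

theorem exists_pos_le_curv (D : Triple) : ∃ s, 0 < s ∧ ∀ j, s ≤ (D j).curv := by
  obtain ⟨j, -, hj⟩ := Finset.exists_min_image Finset.univ (fun j => (D j).curv) ⟨0, Finset.mem_univ _⟩
  exact ⟨_, D.curv_pos j, fun k => hj k (Finset.mem_univ k)⟩

/-- A cell of level n containing x has diameter at most 10/κ, with its own κ, and this κ is at least
2ns. -/
theorem exists_inscribed_subset (h : D.Kissing) {x : ℂ} (hx : x ∈ D.gasket) {ε : ℝ} (hε : 0 < ε) :
    ∃ w : List (Fin 3), (D.word w).inscribed.boundary ⊆ Metric.ball x ε := by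
  obtain ⟨s, hs, hsD⟩ := exists_pos_le_curv D
  obtain ⟨n, hn⟩ := exists_nat_gt (10 / (2 * s * ε))
  obtain ⟨w, hw, hxw⟩ := h.exists_word_mem n hx
  have hk := h.le_kappa_word hsD w
  have hk0 := D.kappa_pos
  have hk1 := (D.word w).kappa_pos
  obtain ⟨j, hj⟩ := (h.word w).exists_norm_sub_q_le
  refine ⟨w, fun y hy => ?_⟩
  have h1 := hj x ((h.word w).gasket_subset_curvTriangle hxw)
  have h2 := hj y ((h.word w).gasket_subset_curvTriangle ((h.word w).boundary_inscribed_subset hy))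
  rw [Metric.mem_ball, dist_eq_norm]
  have h3 := norm_sub_le (y - (D.word w).q j) (x - (D.word w).q j)
  rw [sub_sub_sub_cancel_right] at h3
  refine h3.trans_lt ?_
  have h4 : 10 / (D.word w).kappa < ε := by
    rw [div_lt_iff₀ hk1]
    rw [div_lt_iff₀ (by positivity)] at hn
    rw [hw] at hk
    nlinarith
  have h5 : 10 / (D.word w).kappa = 5 / (D.word w).kappa + 5 / (D.word w).kappa := by ring
  linarith

theorem isOpenPosMeasure (h : D.Kissing) : D.gasketMeasure.IsOpenPosMeasure := by
  refine ⟨fun U hU ⟨x, hx⟩ h0 => ?_⟩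
  obtain ⟨V, hV, rfl⟩ := isOpen_induced_iff.1 hU
  obtain ⟨ε, hε, hb⟩ := Metric.isOpen_iff.1 hV x hx
  obtain ⟨w, hw⟩ := h.exists_inscribed_subset x.2 hε
  have h1 : ∀ᵐ y : D.gasket ∂D.gasketMeasure, (y : ℂ) ∉ V := measure_eq_zero_iff_ae_notMem.1 h0
  rw [h.ae_gasketMeasure (P := fun y => y ∉ V)] at h1
  have h2 := ae_angularMeasure.1 h1 (Sum.inr w)
  have h3 : ∀ᵐ t ∂volume.restrict (Set.Ioc 0 (D.arcLen (Sum.inr w))), False := by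
    filter_upwards [h2] with t ht
    exact ht (hb (hw (Disk.pt_mem_boundary _ norm_one t)))
  rw [ae_iff] at h3
  simp [arcLen, Real.pi_pos.not_ge] at h3

end Kissing

end Triple

/-! ### Absolute continuity on arcs and the Sobolev space -/

theorem ac_congr {f g : ℝ → ℝ} {a b : ℝ} (hf : AbsolutelyContinuousOnInterval f a b)
    (hfg : Set.EqOn f g (Set.uIcc a b)) : AbsolutelyContinuousOnInterval g a b := by
  rw [absolutelyContinuousOnInterval_iff] at hf ⊢
  intro ε hε
  obtain ⟨δ, hδ, H⟩ := hf ε hε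
  refine ⟨δ, hδ, fun E hE hl => ?_⟩
  refine lt_of_eq_of_lt (Finset.sum_congr rfl fun i hi => ?_) (H E hE hl)
  have := hE.1 i hi
  rw [hfg this.1, hfg this.2]

theorem ac_of_integral {f φ : ℝ → ℝ} {a b : ℝ} (hφ : IntervalIntegrable φ volume a b)
    (hf : ∀ x ∈ Set.uIcc a b, f x = f a + ∫ t in a..x, φ t) : AbsolutelyContinuousOnInterval f a b := by
  have h1 := hφ.absolutelyContinuousOnInterval_intervalIntegral (c := a) Set.left_mem_uIcc
  have h2 := (LipschitzWith.const (f a)).lipschitzOnWith (s := Set.uIcc a b)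
  exact ac_congr (h2.absolutelyContinuousOnInterval.add h1) fun x hx => by
    simp only [Pi.add_apply]; rw [hf x hx]

/-- On both pieces f is the integral of its derivative; this representation concatenates, and an
indefinite integral is absolutely continuous. -/
theorem ac_trans {f : ℝ → ℝ} {a b c : ℝ} (hab : a ≤ b) (hbc : b ≤ c)
    (h1 : AbsolutelyContinuousOnInterval f a b) (h2 : AbsolutelyContinuousOnInterval f b c) :
    AbsolutelyContinuousOnInterval f a c := by
  have i1 := h1.intervalIntegrable_deriv
  have i2 := h2.intervalIntegrable_deriv
  have key : ∀ {a b : ℝ}, a ≤ b → AbsolutelyContinuousOnInterval f a b → ∀ x ∈ Set.Icc a b,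
      f x = f a + ∫ t in a..x, deriv f t := fun hab h x hx => by
    have : AbsolutelyContinuousOnInterval f _ x := h.mono (by
      rw [Set.uIcc_of_le hx.1, Set.uIcc_of_le hab]; exact Set.Icc_subset_Icc_right hx.2)
    rw [this.integral_deriv_eq_sub]; ring
  refine ac_of_integral (i1.trans i2) fun x hx => ?_
  rw [Set.uIcc_of_le (hab.trans hbc)] at hx
  rcases le_total x b with h | h
  · exact key hab h1 x ⟨hx.1, h⟩
  · have i3 : IntervalIntegrable (deriv f) volume b x := i2.mono_set (by
      rw [Set.uIcc_of_le h, Set.uIcc_of_le hbc]; exact Set.Icc_subset_Icc_right hx.2)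
    rw [← intervalIntegral.integral_add_adjacent_intervals i1 i3, key hbc h2 x ⟨h, hx.2⟩,
      key hab h1 b ⟨hab, le_rfl⟩]
    ring

theorem ac_of_periodic {g : ℝ → ℝ} {T : ℝ} (hT : 0 < T) (hg : Function.Periodic g T)
    (h : AbsolutelyContinuousOnInterval g 0 T) (a b : ℝ) : AbsolutelyContinuousOnInterval g a b := by
  have shift : ∀ k : ℤ, AbsolutelyContinuousOnInterval g (k * T) ((k + 1) * T) := fun k => by
    have := ac_comp_const_add (g := g) (a := k * T) (b := (k + 1) * T) (c := -(k * T)) (by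
      convert! h using 1 <;> ring)
    refine ac_congr this fun t _ => ?_
    have := hg.sub_zsmul_eq k (x := t)
    rw [zsmul_eq_mul] at this
    rw [← this]; congr 1; ring
  have hn : ∀ n : ℕ, AbsolutelyContinuousOnInterval g (-(n * T)) (n * T) := fun n => by
    induction n with
    | zero => exact h.mono (by simp [hT.le])
    | succ n ih =>
      have s1 := shift (-(n + 1 : ℕ))
      have s2 := shift n
      push_cast at s1 s2 ⊢
      have e : (-1 + -(n : ℝ)) * T = -((n + 1) * T) := by ring
      have hnT : 0 ≤ (n : ℝ) * T := by positivity
      have s1' : AbsolutelyContinuousOnInterval g (-((n + 1) * T)) (-(n * T)) := by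
        convert! s1 using 1 <;> ring
      exact ac_trans (by linarith) (by linarith) (ac_trans (by linarith) (by linarith) s1' ih) s2
  obtain ⟨n, hn'⟩ := exists_nat_ge (max |a| |b| / T)
  rw [div_le_iff₀ hT] at hn'
  refine (hn n).mono ?_
  have h1 := abs_le.1 ((le_max_left |a| |b|).trans hn')
  have h2 := abs_le.1 ((le_max_right |a| |b|).trans hn')
  rw [Set.uIcc_of_le (a := -((n : ℝ) * T)) (by linarith)]
  exact Set.uIcc_subset_Icc h1 h2

theorem Disk.pt_eq_pt_one (B : Disk) {v : ℂ} (hv : ‖v‖ = 1) (t : ℝ) : B.pt v t = B.pt 1 (v.arg + t) := by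
  have := Complex.norm_mul_exp_arg_mul_I v
  rw [hv] at this
  rw [pt_add, one_mul]; congr 1; simpa using this.symm

theorem Disk.circleGrad_eq (B : Disk) (f : ℂ → ℝ) (x : ℂ) :
    B.circleGrad f x = (B.angDeriv f x / B.rad) • (Complex.I * (x - B.cent) / B.rad) := rfl

theorem Disk.norm_tangent (B : Disk) {x : ℂ} (hx : x ∈ B.boundary) :
    ‖Complex.I * (x - B.cent) / B.rad‖ = 1 := by
  have hr := B.rad_pos
  rw [norm_div, norm_mul, Complex.norm_I, mem_boundary.1 hx, Complex.norm_real, Real.norm_eq_abs,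
    abs_of_pos hr, one_mul, div_self hr.ne']

theorem Disk.inner_circleGrad (B : Disk) (f g : ℂ → ℝ) {x : ℂ} (hx : x ∈ B.boundary) :
    inner ℝ (B.circleGrad f x) (B.circleGrad g x) = B.angDeriv f x * B.angDeriv g x / B.rad ^ 2 := by
  have hr := B.rad_pos
  rw [circleGrad_eq, circleGrad_eq, real_inner_smul_left, real_inner_smul_right,
    real_inner_self_eq_norm_sq, B.norm_tangent hx]
  field_simp

theorem Disk.enorm_circleGrad_sq (B : Disk) (f : ℂ → ℝ) {x : ℂ} (hx : x ∈ B.boundary) :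
    ‖B.circleGrad f x‖ₑ ^ 2 = ENNReal.ofReal ((B.rad ^ 2)⁻¹) * ‖B.angDeriv f x‖ₑ ^ 2 := by
  have hr := B.rad_pos
  rw [circleGrad_eq, enorm_smul, ← ofReal_norm (Complex.I * (x - B.cent) / B.rad), B.norm_tangent hx,
    ENNReal.ofReal_one, mul_one, ← ofReal_sq_eq, ← ofReal_sq_eq, ← ENNReal.ofReal_mul (by positivity)]
  congr 1; field_simp

namespace Triple

variable {D : Triple} {f g : ℂ → ℝ}

theorem acOnArcs_iff : D.ACOnArcs f ↔
    ∀ i, AbsolutelyContinuousOnInterval (fun t => f (D.arcPt i t)) 0 (D.arcLen i) := by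
  refine ⟨fun hf i => hf.arc i, fun H => ⟨fun j => H (Sum.inl j), fun w v hv a b => ?_⟩⟩
  have h1 := ac_of_periodic Real.two_pi_pos (g := fun t => f ((D.word w).inscribed.pt 1 t))
    (fun t => by simp only [(D.word w).inscribed.periodic_pt 1 t]) (H (Sum.inr w)) (v.arg + a) (v.arg + b)
  simp only [Disk.pt_eq_pt_one _ hv]
  exact ac_comp_const_add (g := fun t => f ((D.word w).inscribed.pt 1 t)) h1

theorem ACOnArcs.congr (hf : D.ACOnArcs f) (h : D.Kissing) (hfg : ∀ x ∈ D.arcUnion, f x = g x) :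
    D.ACOnArcs g := by
  refine acOnArcs_iff.2 fun i => ac_congr (hf.arc i) fun t ht => ?_
  rw [Set.uIcc_of_le (h.arcLen_pos i).le] at ht
  exact hfg _ (Set.mem_iUnion.2 ⟨i, h.arcPt_mem ht⟩)

theorem Kissing.arcPt_mem_boundary (h : D.Kissing) (i : ArcIndex) (t : ℝ) :
    D.arcPt i t ∈ (D.arcDisk i).boundary := Disk.pt_mem_boundary _ (h.norm_arcDir i) t

theorem zeroExt_apply (D : Triple) (u : D.arcUnion → ℝ) (x : D.arcUnion) : D.zeroExt u x = u x :=
  Subtype.val_injective.extend_apply _ _ _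

theorem zeroExt_of_notMem (D : Triple) (u : D.arcUnion → ℝ) {x : ℂ} (hx : x ∉ D.arcUnion) :
    D.zeroExt u x = 0 :=
  Function.extend_apply' _ _ _ (by rintro ⟨y, rfl⟩; exact hx y.2)

/-- `IsACOnArc` ranges over all angular intervals mapped into the arc. For a circle they are reached
by periodicity. For a side, the interval is shifted by a multiple of 2π until its left end lies in
the branch (-π, π]; it then lies in [0, angle]. -/
theorem Kissing.isACOnArc_iff (h : D.Kissing) (u : D.arcUnion → ℝ) (i : ArcIndex) : D.IsACOnArc u i ↔
    AbsolutelyContinuousOnInterval (fun t => D.zeroExt u (D.arcPt i t)) 0 (D.arcLen i) := by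
  have hp := Real.pi_pos
  have e : ∀ t, D.arcPt i t = circleMap (D.arcDisk i).cent (D.arcDisk i).rad ((D.arcDir i).arg + t) :=
    fun t => by rw [Disk.circleMap_eq_pt]; exact Disk.pt_eq_pt_one _ (h.norm_arcDir i) t
  have e' : ∀ t, circleMap (D.arcDisk i).cent (D.arcDisk i).rad t = D.arcPt i (t - (D.arcDir i).arg) :=
    fun t => by rw [e]; congr 1; ring
  constructor
  · intro H
    simp only [e]
    refine ac_comp_const_add (g := fun t => D.zeroExt u (circleMap (D.arcDisk i).cent (D.arcDisk i).rad t))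
      (H _ _ (by linarith [h.arcLen_pos i]) fun t ht => ?_)
    rw [e']
    exact h.arcPt_mem ⟨by linarith [ht.1], by linarith [ht.2]⟩
  · intro H a b hab hmem
    cases i with
    | inr w =>
      have := ac_of_periodic Real.two_pi_pos
        (g := fun t => D.zeroExt u ((D.word w).inscribed.pt 1 t))
        (fun t => by simp only [(D.word w).inscribed.periodic_pt 1 t]) H a b
      rw [← Disk.circleMap_eq_pt] at this
      exact this
    | inl j =>
      set θ := (D.arcDir (Sum.inl j)).arg
      set k := toIocDiv Real.two_pi_pos (-Real.pi) (a - θ)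
      set c := θ + k * (2 * Real.pi) with hc
      have hk := toIocMod_mem_Ioc Real.two_pi_pos (-Real.pi) (a - θ)
      rw [← self_sub_toIocDiv_zsmul, zsmul_eq_mul] at hk
      have ha : a - c ∈ Set.Ioc (-Real.pi) Real.pi := by
        constructor
        · have := hk.1; simp only [hc]; linarith
        · have := hk.2; simp only [hc]; linarith
      have ept : ∀ t, circleMap (D.arcDisk (Sum.inl j)).cent (D.arcDisk (Sum.inl j)).rad t =
          D.sidePt j (t - c) := fun t => by
        rw [e']
        have := ((D j).periodic_pt (D.dir j)).sub_zsmul_eq k (x := t - θ)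
        rw [zsmul_eq_mul] at this
        change (D j).pt (D.dir j) (t - θ) = (D j).pt (D.dir j) (t - c)
        rw [← this, hc]; congr 1; ring
      have hmem' : ∀ t ∈ Set.Icc a b, t - c ∈ Set.Ioc (-Real.pi) Real.pi → t - c ∈ Set.Icc 0 (D.angle j) :=
        fun t ht htc => (h.sidePt_mem_iff htc).1 (by rw [← ept]; exact hmem t ht)
      have ha' := hmem' a ⟨le_rfl, hab⟩ ha
      have hang := h.angle_mem j
      have hb' : b - c ≤ D.angle j := by
        by_contra hn
        push Not at hn
        -- If b - c exceeded the angle of the side, this point would still belong to the branch but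
        -- no longer to the side.
        have := hmem' (min b (c + Real.pi)) ⟨le_min hab (by linarith [ha.2]), min_le_left _ _⟩
          ⟨by rw [lt_sub_iff_add_lt, lt_min_iff]; constructor <;> linarith [hang.1], by
            linarith [min_le_right b (c + Real.pi)]⟩
        have h2 := this.2
        rw [sub_le_iff_le_add, min_le_iff] at h2
        rcases h2 with h2 | h2
        · linarith
        · linarith [hang.2]
      simp only [ept]
      have := ac_comp_const_add (g := fun t => D.zeroExt u (D.sidePt j t)) (a := a) (b := b) (c := -c)
        (AbsolutelyContinuousOnInterval.mono (a := 0) (b := D.angle j) H (by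
          rw [Set.uIcc_of_le (by linarith), Set.uIcc_of_le hang.1.le]
          exact Set.Icc_subset_Icc (by linarith [ha'.1]) (by linarith)))
      simpa only [neg_add_eq_sub] using this

/-- One factor rad is the weight, one comes from arc length, and the squared gradient contributes
rad⁻²: they cancel. -/
theorem Kissing.rad_mul_lintegral_arcGrad (h : D.Kissing) (u : D.arcUnion → ℝ) (i : ArcIndex) :
    ENNReal.ofReal (D.arcDisk i).rad * ∫⁻ x, ‖D.arcGrad u i x‖ₑ ^ 2 ∂D.arcMeasure i =
      ∫⁻ t in Set.Ioc 0 (D.arcLen i), ‖D.arcDeriv (D.zeroExt u) ⟨i, t⟩‖ₑ ^ 2 := by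
  have hr := (D.arcDisk i).rad_pos
  rw [h.lintegral_arcMeasure, ← mul_assoc, ← ENNReal.ofReal_mul hr.le,
    ← lintegral_const_mul' _ _ ENNReal.ofReal_ne_top]
  refine lintegral_congr fun t => ?_
  rw [arcGrad, Disk.enorm_circleGrad_sq _ _ (h.arcPt_mem_boundary i t), ← mul_assoc,
    ← ENNReal.ofReal_mul (by positivity), ← energyDens_arcPt, energyDens,
    show (D.arcDisk i).rad * (D.arcDisk i).rad * ((D.arcDisk i).rad ^ 2)⁻¹ = 1 by field_simp,
    ENNReal.ofReal_one, one_mul]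

theorem Kissing.aestronglyMeasurable_arcGrad (h : D.Kissing) (u : D.arcUnion → ℝ) (i : ArcIndex) :
    AEStronglyMeasurable (D.arcGrad u i) (D.arcMeasure i) := by
  refine h.aestronglyMeasurable_arcMeasure i (Measurable.aestronglyMeasurable ?_)
  have : (fun t => D.arcGrad u i (D.arcPt i t)) = fun t =>
      (deriv (fun t => D.zeroExt u (D.arcPt i t)) t / (D.arcDisk i).rad) •
        (Complex.I * (D.arcPt i t - (D.arcDisk i).cent) / (D.arcDisk i).rad) := by
    ext1 t
    rw [arcGrad, Disk.circleGrad_eq]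
    simp only [arcPt, Disk.angDeriv_pt]
  rw [this]
  have h1 := (D.continuous_arcPt i).measurable
  exact ((measurable_deriv fun t => D.zeroExt u (D.arcPt i t)).div_const _).smul (((h1.sub_const _).const_mul _).div_const _)

theorem Kissing.mem_sobolevSpace_iff (h : D.Kissing) (u : D.arcUnion → ℝ) : u ∈ D.sobolevSpace ↔
    D.ACOnArcs (D.zeroExt u) ∧ totalInt (energyDens (D.zeroExt u)) D < ∞ := by
  have hsum : ∑' i, ENNReal.ofReal (D.arcDisk i).rad * ∫⁻ x, ‖D.arcGrad u i x‖ₑ ^ 2 ∂D.arcMeasure i =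
      totalInt (energyDens (D.zeroExt u)) D := by
    rw [totalInt_energyDens, lintegral_angularMeasure]
    exact tsum_congr fun i => h.rad_mul_lintegral_arcGrad u i
  rw [acOnArcs_iff]
  simp only [sobolevSpace, Set.mem_ofPred_eq, hsum, h.isACOnArc_iff]
  refine ⟨fun H => ⟨fun i => (H.1 i).1, H.2⟩, fun H => ⟨fun i => ⟨H.1 i, h.aestronglyMeasurable_arcGrad u i, ?_⟩, H.2⟩⟩
  rw [eLpNorm_lt_top_iff_lintegral_rpow_enorm_lt_top two_ne_zero ENNReal.ofNat_ne_top]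
  have h1 := (ENNReal.le_tsum i).trans_lt (hsum.trans_lt H.2)
  have hr := ENNReal.ofReal_pos.2 (D.arcDisk i).rad_pos
  have h2 := ENNReal.lt_top_of_mul_ne_top_right h1.ne hr.ne'
  simpa using h2

theorem Kissing.energy_eq (h : D.Kissing) {u v : D.arcUnion → ℝ}
    (hi : Integrable (fun p => D.arcDeriv (D.zeroExt u) p * D.arcDeriv (D.zeroExt v) p) D.angularMeasure) :
    D.energy u v = ∫ p, D.arcDeriv (D.zeroExt u) p * D.arcDeriv (D.zeroExt v) p ∂D.angularMeasure := by
  rw [angularMeasure] at hi ⊢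
  rw [integral_sum_measure hi, energy]
  refine tsum_congr fun i => ?_
  rw [(measurableEmbedding_sigmaMk i).integral_map, h.integral_arcMeasure, ← mul_assoc,
    ← integral_const_mul]
  refine integral_congr_ae (ae_of_all _ fun t => ?_)
  have hr := (D.arcDisk i).rad_pos
  simp only [arcGrad]
  rw [Disk.inner_circleGrad _ _ _ (h.arcPt_mem_boundary i t)]
  simp only [arcDeriv, arcPt, Disk.angDeriv_pt]
  field_simp

end Triple

/-! ### Functions of finite energy as elements of L² -/

theorem enorm_toLp_sq {α : Type*} [MeasurableSpace α] {μ : Measure α} {f : α → ℝ} (hf : MemLp f 2 μ) :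
    ‖hf.toLp f‖ₑ ^ 2 = ∫⁻ x, ‖f x‖ₑ ^ 2 ∂μ := by
  rw [Lp.enorm_toLp, eLpNorm_eq_lintegral_rpow_enorm_toReal two_ne_zero ENNReal.ofNat_ne_top,
    ← ENNReal.rpow_natCast, ← ENNReal.rpow_mul]
  simp

theorem memLp_two_of_lintegral {α : Type*} [MeasurableSpace α] {μ : Measure α} {f : α → ℝ}
    (hm : AEStronglyMeasurable f μ) (hf : ∫⁻ x, ‖f x‖ₑ ^ 2 ∂μ < ∞) : MemLp f 2 μ := by
  refine ⟨hm, ?_⟩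
  rw [eLpNorm_lt_top_iff_lintegral_rpow_enorm_lt_top two_ne_zero ENNReal.ofNat_ne_top]
  simpa using hf

namespace Triple

variable {D : Triple} {f g : ℂ → ℝ}

namespace Kissing

/-- The functions of finite energy, extended by zero to the plane. -/
def energySpace (h : D.Kissing) : Submodule ℝ (ℂ → ℝ) where
  -- The vanishing off `arcUnion` makes the representative unique, as the injectivity of `toL2`
  -- requires.
  carrier := {f | D.ACOnArcs f ∧ totalInt (energyDens f) D < ∞ ∧ ∀ x ∉ D.arcUnion, f x = 0}
  zero_mem' := by
    refine ⟨h.acOnArcs_of_lipschitz (LipschitzWith.const 0 : LipschitzWith 0 fun _ : ℂ => (0 : ℝ)), ?_,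
      fun _ _ => rfl⟩
    rw [totalInt_energyDens]
    have : D.arcDeriv 0 = 0 := by ext p; exact deriv_const _ _
    simp [this]
  add_mem' := by
    rintro f g ⟨hf, hf', hf0⟩ ⟨hg, hg', hg0⟩
    refine ⟨hf.add hg, ?_, fun x hx => by simp [hf0 x hx, hg0 x hx]⟩
    rw [totalInt_energyDens] at *
    have hle : ∀ᵐ p ∂D.angularMeasure, ‖D.arcDeriv (f + g) p‖ₑ ^ 2 ≤
        2 * ‖D.arcDeriv f p‖ₑ ^ 2 + 2 * ‖D.arcDeriv g p‖ₑ ^ 2 := by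
      filter_upwards [hf.arcDeriv_add hg h] with p hp
      change ‖D.arcDeriv (fun x => f x + g x) p‖ₑ ^ 2 ≤ _
      rw [hp]
      simp only [← ofReal_sq_eq]
      rw [← ENNReal.ofReal_ofNat 2, ← ENNReal.ofReal_mul zero_le_two, ← ENNReal.ofReal_mul zero_le_two,
        ← ENNReal.ofReal_add (by positivity) (by positivity)]
      refine ENNReal.ofReal_le_ofReal ?_
      nlinarith [sq_nonneg (D.arcDeriv f p - D.arcDeriv g p)]
    refine (lintegral_mono_ae hle).trans_lt ?_
    rw [lintegral_add_left (((D.measurable_arcDeriv f).enorm.pow_const 2).const_mul 2),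
      lintegral_const_mul' _ _ (by simp), lintegral_const_mul' _ _ (by simp)]
    exact ENNReal.add_lt_top.2 ⟨ENNReal.mul_lt_top (by simp) hf', ENNReal.mul_lt_top (by simp) hg'⟩
  smul_mem' := by
    rintro c f ⟨hf, hf', hf0⟩
    refine ⟨hf.const_mul c, ?_, fun x hx => by simp [hf0 x hx]⟩
    rw [totalInt_energyDens] at *
    have : D.arcDeriv (c • f) = fun p => c * D.arcDeriv f p := D.arcDeriv_const_mul c f
    simp only [this, enorm_mul, mul_pow]
    rw [lintegral_const_mul' _ _ (by simp)]
    exact ENNReal.mul_lt_top (by simp) hf'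

theorem memLp_of_lipschitz (h : D.Kissing) {L : ℝ≥0} (hf : LipschitzWith L f) :
    MemLp (fun x : D.gasket => f x) 2 D.gasketMeasure := by
  have := h.isFiniteMeasure_gasketMeasure
  obtain ⟨C, hC⟩ := h.isCompact_gasket.exists_bound_of_continuousOn hf.continuous.continuousOn
  exact MemLp.of_bound (h.aestronglyMeasurable_gasketMeasure (h.acOnArcs_of_lipschitz hf)) C
    (ae_of_all _ fun x => hC x x.2)

/-- The level 0 approximant is Lipschitz, hence bounded on the compact gasket, and by the Poincaré
inequality its difference from f has finite mass. -/
theorem memLp_gasketMeasure (h : D.Kissing) (hf : D.ACOnArcs f) (hE : totalInt (energyDens f) D < ∞) :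
    MemLp (fun x : D.gasket => f x) 2 D.gasketMeasure := by
  obtain ⟨s, hs, hsD⟩ := exists_pos_le_curv D
  obtain ⟨φ, ⟨L, hL⟩, -, -, hM⟩ := ACOnArcs.exists_lipschitz_approx hs 0 h hsD hf
  have h1 : MemLp (fun x : D.gasket => f x - φ x) 2 D.gasketMeasure := by
    refine memLp_two_of_lintegral (h.aestronglyMeasurable_gasketMeasure
      (hf.sub (h.acOnArcs_of_lipschitz hL))) ?_
    rw [h.lintegral_sq_gasketMeasure fun x => f x - φ x]
    exact hM.trans_lt (ENNReal.mul_lt_top ENNReal.ofReal_lt_top (ENNReal.mul_lt_top (by simp) hE))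
  convert! h1.add (h.memLp_of_lipschitz hL) using 1
  ext x; simp

theorem memLp_arcDeriv (hE : totalInt (energyDens f) D < ∞) :
    MemLp (D.arcDeriv f) 2 D.angularMeasure :=
  memLp_two_of_lintegral (D.measurable_arcDeriv f).aestronglyMeasurable
    (by rwa [← totalInt_energyDens])

/-- The inclusion of the functions of finite energy into `L²`. -/
def toL2 (h : D.Kissing) : h.energySpace →ₗ[ℝ] Lp ℝ 2 D.gasketMeasure where
  toFun f := (h.memLp_gasketMeasure f.2.1 f.2.2.1).toLp _
  map_add' _ _ := rfl
  map_smul' _ _ := rfl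

/-- The derivatives along the arcs, as an element of `L²`. -/
def gradL2 (h : D.Kissing) : h.energySpace →ₗ[ℝ] Lp ℝ 2 D.angularMeasure where
  toFun f := (memLp_arcDeriv f.2.2.1).toLp _
  map_add' f g := by
    rw [← MemLp.toLp_add, MemLp.toLp_eq_toLp_iff]
    exact f.2.1.arcDeriv_add g.2.1 h
  map_smul' c f := by
    rw [RingHom.id_apply, ← MemLp.toLp_const_smul, MemLp.toLp_eq_toLp_iff]
    exact ae_of_all _ fun p => congrFun (D.arcDeriv_const_mul c f) p

theorem coeFn_toL2 (h : D.Kissing) (f : h.energySpace) : h.toL2 f =ᵐ[D.gasketMeasure] fun x => (f : ℂ → ℝ) x :=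
  (h.memLp_gasketMeasure f.2.1 f.2.2.1).coeFn_toLp

theorem coeFn_gradL2 (h : D.Kissing) (f : h.energySpace) : h.gradL2 f =ᵐ[D.angularMeasure] D.arcDeriv f :=
  (memLp_arcDeriv f.2.2.1).coeFn_toLp

theorem enorm_toL2_sq (h : D.Kissing) (f : h.energySpace) : ‖h.toL2 f‖ₑ ^ 2 = totalInt (massDens f) D := by
  rw [← h.lintegral_sq_gasketMeasure]; exact enorm_toLp_sq (h.memLp_gasketMeasure f.2.1 f.2.2.1)

theorem enorm_gradL2_sq (h : D.Kissing) (f : h.energySpace) : ‖h.gradL2 f‖ₑ ^ 2 = totalInt (energyDens f) D := by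
  rw [totalInt_energyDens]; exact enorm_toLp_sq (memLp_arcDeriv f.2.2.1)

theorem continuousOn_arcPt (h : D.Kissing) (hf : D.ACOnArcs f) (i : ArcIndex) :
    ContinuousOn (fun t => f (D.arcPt i t)) (Set.Icc 0 (D.arcLen i)) := by
  have := (hf.arc i).continuousOn
  rwa [Set.uIcc_of_le (h.arcLen_pos i).le] at this

/-- Both functions are continuous along each arc, and each parameter interval has positive length.
-/
theorem eqOn_of_ae_eq (h : D.Kissing) (hf : D.ACOnArcs f) (hg : D.ACOnArcs g)
    (hfg : ∀ᵐ x : D.gasket ∂D.gasketMeasure, f x = g x) : ∀ x ∈ D.arcUnion, f x = g x := by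
  intro x hx
  obtain ⟨i, hi⟩ := Set.mem_iUnion.1 hx
  rw [h.arc_eq_image] at hi
  obtain ⟨t, ht, rfl⟩ := hi
  have h1 := ae_angularMeasure.1 ((h.ae_gasketMeasure (P := fun x => f x = g x)).1 hfg) i
  rw [Measure.restrict_congr_set Ioc_ae_eq_Icc] at h1
  exact Measure.eqOn_Icc_of_ae_eq volume (h.arcLen_pos i).ne h1 (h.continuousOn_arcPt hf i)
    (h.continuousOn_arcPt hg i) ht

theorem injective_toL2 (h : D.Kissing) : Function.Injective h.toL2 := by
  intro f g hfg
  have h1 : ∀ᵐ x : D.gasket ∂D.gasketMeasure, (f : ℂ → ℝ) x = (g : ℂ → ℝ) x := by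
    filter_upwards [h.coeFn_toL2 f, h.coeFn_toL2 g] with x h1 h2
    rw [← h1, ← h2, hfg]
  have h2 := h.eqOn_of_ae_eq f.2.1 g.2.1 h1
  ext x
  by_cases hx : x ∈ D.arcUnion
  · exact h2 x hx
  · rw [f.2.2.2 x hx, g.2.2.2 x hx]

/-- Evaluation at a point of an arc is bounded. -/
theorem exists_abs_apply_le (h : D.Kissing) {x : ℂ} (hx : x ∈ D.arcUnion) :
    ∃ C : ℝ, ∀ f : h.energySpace, |(f : ℂ → ℝ) x| ≤ C * (‖h.toL2 f‖ + ‖h.gradL2 f‖) := by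
  obtain ⟨i, hi⟩ := Set.mem_iUnion.1 hx
  rw [h.arc_eq_image] at hi
  obtain ⟨t, ht, rfl⟩ := hi
  have hl := h.arcLen_pos i
  have hr := (D.arcDisk i).rad_pos
  set l := D.arcLen i
  set r := (D.arcDisk i).rad
  refine ⟨Real.sqrt (2 * (l * r ^ 2)⁻¹ + 2 * l), fun f => ?_⟩
  have hE : ∫⁻ s in Set.Ioc 0 l, ‖D.arcDeriv f ⟨i, s⟩‖ₑ ^ 2 ≤ ‖h.gradL2 f‖ₑ ^ 2 := by
    rw [h.enorm_gradL2_sq, totalInt_energyDens, lintegral_angularMeasure]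
    exact ENNReal.le_tsum (f := fun i => ∫⁻ s in Set.Ioc 0 (D.arcLen i), ‖D.arcDeriv f ⟨i, s⟩‖ₑ ^ 2) i
  have hM : ENNReal.ofReal (r ^ 2) * ∫⁻ s in Set.Ioc 0 l, ‖(f : ℂ → ℝ) (D.arcPt i s)‖ₑ ^ 2 ≤ ‖h.toL2 f‖ₑ ^ 2 := by
    rw [h.enorm_toL2_sq, totalInt_eq_lintegral, lintegral_angularMeasure,
      ← lintegral_const_mul' _ _ ENNReal.ofReal_ne_top]
    exact ENNReal.le_tsum (f := fun i => ∫⁻ s in Set.Ioc 0 (D.arcLen i),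
      massDens f (D.arcDisk i) (D.arcPt i s)) i
  -- The one-dimensional Sobolev bound: the value at t is compared with the value at each s, and the
  -- result is then averaged over s.
  have key : ∀ s ∈ Set.Ioc 0 l, ‖(f : ℂ → ℝ) (D.arcPt i t)‖ₑ ^ 2 ≤
      2 * ‖(f : ℂ → ℝ) (D.arcPt i s)‖ₑ ^ 2 + 2 * (ENNReal.ofReal l * ‖h.gradL2 f‖ₑ ^ 2) := by
    intro s hs
    have h1 : ‖(f : ℂ → ℝ) (D.arcPt i t) - (f : ℂ → ℝ) (D.arcPt i s)‖ₑ ^ 2 ≤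
        ENNReal.ofReal l * ‖h.gradL2 f‖ₑ ^ 2 := by
      have aux : ∀ a b : ℝ, a ∈ Set.Icc 0 l → b ∈ Set.Icc 0 l → a ≤ b →
          ‖(f : ℂ → ℝ) (D.arcPt i b) - (f : ℂ → ℝ) (D.arcPt i a)‖ₑ ^ 2 ≤
            ENNReal.ofReal l * ‖h.gradL2 f‖ₑ ^ 2 := fun a b ha hb hab => by
        refine (ac_sq_sub_le hab (((f.2.1.arc i)).mono ?_)).trans ?_
        · rw [Set.uIcc_of_le hab, Set.uIcc_of_le hl.le]; exact Set.Icc_subset_Icc ha.1 hb.2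
        · gcongr
          · linarith [ha.1, hb.2]
          · refine le_trans ?_ hE
            exact lintegral_mono_set (Set.Ioc_subset_Ioc ha.1 hb.2)
      rcases le_total s t with hst | hst
      · exact aux s t (Set.Ioc_subset_Icc_self hs) ht hst
      · rw [← enorm_neg, neg_sub]; exact aux t s ht (Set.Ioc_subset_Icc_self hs) hst
    have h2 := enorm_add_sq_le (n := 1) (α := ‖(f : ℂ → ℝ) (D.arcPt i s)‖ₑ ^ 2)
      (A := (f : ℂ → ℝ) (D.arcPt i s)) (by simp) h1
    rw [add_sub_cancel, mul_add] at h2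
    simpa using h2
  have h3 : ENNReal.ofReal l * ‖(f : ℂ → ℝ) (D.arcPt i t)‖ₑ ^ 2 ≤
      2 * (∫⁻ s in Set.Ioc 0 l, ‖(f : ℂ → ℝ) (D.arcPt i s)‖ₑ ^ 2) +
        ENNReal.ofReal l * (2 * (ENNReal.ofReal l * ‖h.gradL2 f‖ₑ ^ 2)) := by
    calc _ = ∫⁻ s in Set.Ioc 0 l, ‖(f : ℂ → ℝ) (D.arcPt i t)‖ₑ ^ 2 := by
          rw [setLIntegral_const, Real.volume_Ioc, sub_zero, mul_comm]
      _ ≤ ∫⁻ s in Set.Ioc 0 l, (2 * ‖(f : ℂ → ℝ) (D.arcPt i s)‖ₑ ^ 2 +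
          2 * (ENNReal.ofReal l * ‖h.gradL2 f‖ₑ ^ 2)) := setLIntegral_mono' measurableSet_Ioc key
      _ = _ := by
          rw [lintegral_add_right _ measurable_const, setLIntegral_const, Real.volume_Ioc, sub_zero,
            lintegral_const_mul' _ _ (by simp)]
          ring
  have h4 : ENNReal.ofReal (l * r ^ 2) * ‖(f : ℂ → ℝ) (D.arcPt i t)‖ₑ ^ 2 ≤
      2 * ‖h.toL2 f‖ₑ ^ 2 + ENNReal.ofReal (2 * l ^ 2 * r ^ 2) * ‖h.gradL2 f‖ₑ ^ 2 := by
    calc _ = ENNReal.ofReal (r ^ 2) * (ENNReal.ofReal l * ‖(f : ℂ → ℝ) (D.arcPt i t)‖ₑ ^ 2) := by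
          rw [ENNReal.ofReal_mul hl.le]; ring
      _ ≤ _ := mul_le_mul_right h3 _
      _ = 2 * (ENNReal.ofReal (r ^ 2) * ∫⁻ s in Set.Ioc 0 l, ‖(f : ℂ → ℝ) (D.arcPt i s)‖ₑ ^ 2) +
          ENNReal.ofReal (2 * l ^ 2 * r ^ 2) * ‖h.gradL2 f‖ₑ ^ 2 := by
          rw [ENNReal.ofReal_mul (by positivity), ENNReal.ofReal_mul (by positivity),
            ENNReal.ofReal_pow hl.le, ENNReal.ofReal_ofNat]
          ring
      _ ≤ _ := by gcongr
  have h5 : (l * r ^ 2) * (f : ℂ → ℝ) (D.arcPt i t) ^ 2 ≤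
      2 * ‖h.toL2 f‖ ^ 2 + (2 * l ^ 2 * r ^ 2) * ‖h.gradL2 f‖ ^ 2 := by
    rw [← ENNReal.ofReal_le_ofReal_iff (by positivity), ENNReal.ofReal_mul (p := l * r ^ 2) (by positivity),
      ENNReal.ofReal_add (by positivity) (by positivity), ENNReal.ofReal_mul (p := 2) (by positivity),
      ENNReal.ofReal_mul (p := 2 * l ^ 2 * r ^ 2) (by positivity),
      ofReal_sq_eq ((f : ℂ → ℝ) (D.arcPt i t)), ENNReal.ofReal_pow (norm_nonneg (h.toL2 f)),
      ENNReal.ofReal_pow (norm_nonneg (h.gradL2 f)), ofReal_norm, ofReal_norm, ENNReal.ofReal_ofNat]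
    exact h4
  have ha := norm_nonneg (h.toL2 f)
  have hb := norm_nonneg (h.gradL2 f)
  refine abs_le_of_sq_le_sq ?_ (by positivity)
  rw [mul_pow, Real.sq_sqrt (by positivity)]
  have h6 : (f : ℂ → ℝ) (D.arcPt i t) ^ 2 ≤ 2 * (l * r ^ 2)⁻¹ * ‖h.toL2 f‖ ^ 2 + 2 * l * ‖h.gradL2 f‖ ^ 2 := by
    have hp : 0 < l * r ^ 2 := by positivity
    refine le_of_mul_le_mul_left (h5.trans (le_of_eq ?_)) hp
    field_simp
  refine h6.trans ?_
  have p1 : 0 ≤ 2 * (l * r ^ 2)⁻¹ := by positivity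
  have p2 : 0 ≤ 2 * l := by positivity
  have q1 : ‖h.toL2 f‖ ^ 2 ≤ (‖h.toL2 f‖ + ‖h.gradL2 f‖) ^ 2 := by nlinarith
  have q2 : ‖h.gradL2 f‖ ^ 2 ≤ (‖h.toL2 f‖ + ‖h.gradL2 f‖) ^ 2 := by nlinarith
  nlinarith [mul_le_mul_of_nonneg_left q1 p1, mul_le_mul_of_nonneg_left q2 p2]

end Kissing

end Triple

/-! ### Closedness of the gradient -/

namespace Triple

variable {D : Triple} {f g : ℂ → ℝ}

theorem angularMeasure_restrict (D : Triple) (i : ArcIndex) {s : Set ℝ} (hs : MeasurableSet s)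
    (hsub : s ⊆ Set.Ioc 0 (D.arcLen i)) :
    D.angularMeasure.restrict (@Sigma.mk ArcIndex (fun _ => ℝ) i '' s) =
      (volume.restrict s).map (@Sigma.mk ArcIndex (fun _ => ℝ) i) := by
  have hS := (measurableEmbedding_sigmaMk i).measurableSet_image' hs
  ext T hT
  rw [Measure.restrict_apply hT, angularMeasure, Measure.sum_apply _ (hT.inter hS),
    tsum_eq_single i]
  · rw [(measurableEmbedding_sigmaMk i).map_apply, (measurableEmbedding_sigmaMk i).map_apply,
      Set.preimage_inter, Set.preimage_image_eq _ sigma_mk_injective,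
      Measure.restrict_apply ((measurable_sigmaMk i hT).inter hs), Measure.restrict_apply (measurable_sigmaMk i hT),
      Set.inter_assoc, Set.inter_eq_left.2 hsub]
  · intro k hk
    rw [(measurableEmbedding_sigmaMk k).map_apply]
    have : @Sigma.mk ArcIndex (fun _ => ℝ) k ⁻¹' (T ∩ @Sigma.mk ArcIndex (fun _ => ℝ) i '' s) = ∅ := by
      ext t
      simp only [Set.mem_preimage, Set.mem_inter_iff, Set.mem_image, Sigma.mk.injEq, Set.mem_empty_iff_false,
        iff_false, not_and]
      rintro - ⟨x, -, hik, -⟩; exact hk hik.symm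
    rw [this, measure_empty]

theorem angularMeasure_image_ne_top (D : Triple) (i : ArcIndex) {s : Set ℝ} (hs : MeasurableSet s)
    (hsub : s ⊆ Set.Ioc 0 (D.arcLen i)) :
    D.angularMeasure (@Sigma.mk ArcIndex (fun _ => ℝ) i '' s) ≠ ∞ := by
  rw [← Measure.restrict_apply_univ, D.angularMeasure_restrict i hs hsub,
    Measure.map_apply (measurable_sigmaMk i) MeasurableSet.univ]
  simp only [Set.preimage_univ, Measure.restrict_apply_univ]
  exact ((measure_mono hsub).trans_lt (by simp)).ne

theorem integrableOn_arc (D : Triple) (ψ : Lp ℝ 2 D.angularMeasure) (i : ArcIndex) :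
    IntegrableOn (fun t => ψ ⟨i, t⟩) (Set.Ioc 0 (D.arcLen i)) := by
  have h1 := integrableOn_Lp_of_measure_ne_top ψ one_le_two
    (D.angularMeasure_image_ne_top i measurableSet_Ioc subset_rfl)
  rw [IntegrableOn, D.angularMeasure_restrict i measurableSet_Ioc subset_rfl,
    (measurableEmbedding_sigmaMk i).integrable_map_iff] at h1
  exact h1

/-- Integration over an initial piece of one arc is the inner product with an indicator function of
finite measure, hence continuous on L². -/
theorem tendsto_integral_arc (D : Triple) {φ : ℕ → Lp ℝ 2 D.angularMeasure} {ψ : Lp ℝ 2 D.angularMeasure}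
    (hφ : Tendsto φ atTop (𝓝 ψ)) (i : ArcIndex) {t : ℝ} (ht : t ∈ Set.Icc 0 (D.arcLen i)) :
    Tendsto (fun n => ∫ s in 0..t, φ n ⟨i, s⟩) atTop (𝓝 (∫ s in 0..t, ψ ⟨i, s⟩)) := by
  have hsub : Set.Ioc 0 t ⊆ Set.Ioc 0 (D.arcLen i) := Set.Ioc_subset_Ioc_right ht.2
  have hS := (measurableEmbedding_sigmaMk i).measurableSet_image' (measurableSet_Ioc (a := 0) (b := t))
  have hS' := D.angularMeasure_image_ne_top i measurableSet_Ioc hsub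
  have key : ∀ χ : Lp ℝ 2 D.angularMeasure,
      inner ℝ (indicatorConstLp 2 hS hS' (1 : ℝ)) χ = ∫ s in 0..t, χ ⟨i, s⟩ := fun χ => by
    rw [L2.inner_indicatorConstLp_one, D.angularMeasure_restrict i measurableSet_Ioc hsub,
      (measurableEmbedding_sigmaMk i).integral_map, intervalIntegral.integral_of_le ht.1]
  simp only [← key]
  exact tendsto_const_nhds.inner hφ

namespace Kissing

theorem apply_arcPt_eq (h : D.Kissing) (f : h.energySpace) (i : ArcIndex) {t : ℝ}
    (ht : t ∈ Set.Icc 0 (D.arcLen i)) :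
    (f : ℂ → ℝ) (D.arcPt i t) = (f : ℂ → ℝ) (D.arcPt i 0) + ∫ s in 0..t, h.gradL2 f ⟨i, s⟩ := by
  have h1 := ae_angularMeasure.1 (h.coeFn_gradL2 f) i
  rw [ae_restrict_iff' measurableSet_Ioc] at h1
  have h2 : AbsolutelyContinuousOnInterval (fun t => (f : ℂ → ℝ) (D.arcPt i t)) 0 t :=
    (f.2.1.arc i).mono (by
      rw [Set.uIcc_of_le ht.1, Set.uIcc_of_le (h.arcLen_pos i).le]; exact Set.Icc_subset_Icc_right ht.2)
  have h3 : ∫ s in 0..t, h.gradL2 f ⟨i, s⟩ = ∫ s in 0..t, deriv (fun t => (f : ℂ → ℝ) (D.arcPt i t)) s := by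
    refine intervalIntegral.integral_congr_ae ?_
    filter_upwards [h1] with s hs hs'
    rw [Set.uIoc_of_le ht.1] at hs'
    exact hs ⟨hs'.1, hs'.2.trans ht.2⟩
  rw [h3, h2.integral_deriv_eq_sub]; ring

theorem arcPt_mem_arcUnion (h : D.Kissing) (i : ArcIndex) {t : ℝ} (ht : t ∈ Set.Icc 0 (D.arcLen i)) :
    D.arcPt i t ∈ D.arcUnion :=
  Set.mem_iUnion.2 ⟨i, by rw [h.arc_eq_image]; exact Set.mem_image_of_mem _ ht⟩

/-- The gradient is a closed operator. -/
theorem exists_of_tendsto (h : D.Kissing) {f : ℕ → h.energySpace} {φ : Lp ℝ 2 D.gasketMeasure}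
    {ψ : Lp ℝ 2 D.angularMeasure} (hφ : Tendsto (fun n => h.toL2 (f n)) atTop (𝓝 φ))
    (hψ : Tendsto (fun n => h.gradL2 (f n)) atTop (𝓝 ψ)) :
    ∃ F : h.energySpace, h.toL2 F = φ ∧ h.gradL2 F = ψ := by
  -- Evaluation at a point of an arc is bounded by the two L² norms, so the values form a Cauchy
  -- sequence; off the arcs they all vanish.
  have hlim : ∀ x, ∃ y, Tendsto (fun n => (f n : ℂ → ℝ) x) atTop (𝓝 y) := by
    intro x
    by_cases hx : x ∈ D.arcUnion
    · obtain ⟨C, hC⟩ := h.exists_abs_apply_le hx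
      have h1 := hφ.cauchySeq
      have h2 := hψ.cauchySeq
      refine cauchySeq_tendsto_of_complete (Metric.cauchySeq_iff'.2 fun ε hε => ?_)
      have hC' : 0 < |C| + 1 := by positivity
      have hδ : 0 < ε / (2 * (|C| + 1)) := by positivity
      obtain ⟨N₁, hN₁⟩ := Metric.cauchySeq_iff.1 h1 _ hδ
      obtain ⟨N₂, hN₂⟩ := Metric.cauchySeq_iff.1 h2 _ hδ
      refine ⟨max N₁ N₂, fun n hn => ?_⟩
      have e1 := hN₁ n (le_of_max_le_left hn) (max N₁ N₂) (le_max_left _ _)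
      have e2 := hN₂ n (le_of_max_le_right hn) (max N₁ N₂) (le_max_right _ _)
      have e3 := hC (f n - f (max N₁ N₂))
      rw [map_sub, map_sub, ← dist_eq_norm, ← dist_eq_norm] at e3
      rw [Real.dist_eq]
      refine e3.trans_lt ?_
      have e4 : Dist.dist (h.toL2 (f n)) (h.toL2 (f (max N₁ N₂))) +
          Dist.dist (h.gradL2 (f n)) (h.gradL2 (f (max N₁ N₂))) < ε / (|C| + 1) := by
        have : ε / (|C| + 1) = ε / (2 * (|C| + 1)) + ε / (2 * (|C| + 1)) := by field_simp; norm_num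
        rw [this]; exact add_lt_add e1 e2
      rw [lt_div_iff₀ hC'] at e4
      have e5 := le_abs_self C
      nlinarith [dist_nonneg (x := h.toL2 (f n)) (y := h.toL2 (f (max N₁ N₂))),
        dist_nonneg (x := h.gradL2 (f n)) (y := h.gradL2 (f (max N₁ N₂)))]
    · exact ⟨0, by simp [(f _).2.2.2 x hx]⟩
  choose F hF using hlim
  have hF0 : ∀ x ∉ D.arcUnion, F x = 0 := fun x hx =>
    tendsto_nhds_unique (hF x) (by simp [(f _).2.2.2 x hx])
  -- The fundamental theorem of calculus passes to the limit: along each arc, F is an indefinite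
  -- integral of ψ.
  have hFi : ∀ i, ∀ t ∈ Set.Icc 0 (D.arcLen i), F (D.arcPt i t) = F (D.arcPt i 0) + ∫ s in 0..t, ψ ⟨i, s⟩ := by
    intro i t ht
    refine tendsto_nhds_unique (hF _) ?_
    simp only [h.apply_arcPt_eq _ i ht]
    exact (hF _).add (D.tendsto_integral_arc hψ i ht)
  have hii : ∀ i, IntervalIntegrable (fun s => ψ ⟨i, s⟩) volume 0 (D.arcLen i) := fun i =>
    (intervalIntegrable_iff_integrableOn_Ioc_of_le (h.arcLen_pos i).le).2 (D.integrableOn_arc ψ i)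
  have hac : D.ACOnArcs F := acOnArcs_iff.2 fun i => ac_of_integral (hii i) fun t ht => by
    rw [Set.uIcc_of_le (h.arcLen_pos i).le] at ht
    exact hFi i t ht
  have hgrad : D.arcDeriv F =ᵐ[D.angularMeasure] ψ := by
    refine ae_angularMeasure.2 fun i => ?_
    rw [← Measure.restrict_congr_set Ioo_ae_eq_Ioc, ae_restrict_iff' measurableSet_Ioo]
    filter_upwards [(hii i).ae_hasDerivAt_integral] with t ht hmem
    have ht' := ht (by rw [Set.uIcc_of_le (h.arcLen_pos i).le]; exact Set.Ioo_subset_Icc_self hmem) 0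
      Set.left_mem_uIcc
    have : HasDerivAt (fun t => F (D.arcPt i t)) (ψ ⟨i, t⟩) t := by
      refine (ht'.const_add (F (D.arcPt i 0))).congr_of_eventuallyEq ?_
      filter_upwards [Ioo_mem_nhds hmem.1 hmem.2] with s hs
      exact hFi i s (Set.Ioo_subset_Icc_self hs)
    exact this.deriv
  have hE : totalInt (energyDens F) D < ∞ := by
    rw [totalInt_energyDens, lintegral_congr_ae (g := fun p => ‖ψ p‖ₑ ^ 2)
      (hgrad.mono fun p hp => by simp only [hp]), ← enorm_toLp_sq (Lp.memLp ψ)]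
    exact ENNReal.pow_lt_top enorm_lt_top
  refine ⟨⟨F, hac, hE, hF0⟩, ?_, ?_⟩
  -- A subsequence converges almost everywhere to φ, while pointwise it converges to F.
  · obtain ⟨ns, hns, hae⟩ := (tendstoInMeasure_of_tendsto_Lp hφ).exists_seq_tendsto_ae
    refine Lp.ext ((h.coeFn_toL2 _).trans ?_)
    filter_upwards [hae, ae_all_iff.2 fun n => h.coeFn_toL2 (f n)] with x hx hx'
    refine tendsto_nhds_unique ((hF x).comp hns.tendsto_atTop) ?_
    refine hx.congr fun n => ?_
    exact hx' _
  · exact Lp.ext ((h.coeFn_gradL2 _).trans hgrad)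

end Kissing

end Triple

/-! ### The Dirichlet form: Markov property, locality, irreducibility -/

namespace Triple

variable {D : Triple} {f g : ℂ → ℝ}

namespace Kissing

/-- The energy form, as a form on `L²`. -/
def dirichletForm (h : D.Kissing) : L2Form D.gasketMeasure where
  domain := LinearMap.range h.toL2
  form := (innerₗ (Lp ℝ 2 D.angularMeasure)).compl₁₂
    (h.gradL2 ∘ₗ (LinearEquiv.ofInjective h.toL2 h.injective_toL2).symm.toLinearMap)
    (h.gradL2 ∘ₗ (LinearEquiv.ofInjective h.toL2 h.injective_toL2).symm.toLinearMap)

/-- The functions of finite energy are the elements of the domain of the energy form. -/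
def equivDomain (h : D.Kissing) : h.energySpace ≃ₗ[ℝ] h.dirichletForm.domain :=
  LinearEquiv.ofInjective h.toL2 h.injective_toL2

theorem coe_equivDomain (h : D.Kissing) (f : h.energySpace) : (h.equivDomain f : Lp ℝ 2 D.gasketMeasure) = h.toL2 f :=
  rfl

theorem form_equivDomain (h : D.Kissing) (f g : h.energySpace) :
    h.dirichletForm.form (h.equivDomain f) (h.equivDomain g) = inner ℝ (h.gradL2 f) (h.gradL2 g) := by
  have e : ∀ f, (LinearEquiv.ofInjective h.toL2 h.injective_toL2).symm (h.equivDomain f) = f :=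
    fun f => h.equivDomain.symm_apply_apply f
  exact congrArg₂ (fun a b => inner ℝ (h.gradL2 a) (h.gradL2 b)) (e f) (e g)

theorem form_self_equivDomain (h : D.Kissing) (f : h.energySpace) :
    h.dirichletForm.form (h.equivDomain f) (h.equivDomain f) = ‖h.gradL2 f‖ ^ 2 := by
  rw [form_equivDomain, real_inner_self_eq_norm_sq]

theorem energyOne_equivDomain (h : D.Kissing) (f : h.energySpace) :
    h.dirichletForm.energyOne (h.equivDomain f) = ‖h.gradL2 f‖ ^ 2 + ‖h.toL2 f‖ ^ 2 := by
  rw [L2Form.energyOne, form_self_equivDomain, coe_equivDomain]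

/-- The elements of the Sobolev space as functions on the plane. -/
def ofSobolev (h : D.Kissing) {u : D.arcUnion → ℝ} (hu : u ∈ D.sobolevSpace) : h.energySpace :=
  ⟨D.zeroExt u, ((h.mem_sobolevSpace_iff u).1 hu).1, ((h.mem_sobolevSpace_iff u).1 hu).2,
    fun _ hx => D.zeroExt_of_notMem u hx⟩

theorem toL2_ofSobolev (h : D.Kissing) {u : D.arcUnion → ℝ} (hu : u ∈ D.sobolevSpace) :
    h.toL2 (h.ofSobolev hu) =ᵐ[D.gasketMeasure] D.onGasket u := h.coeFn_toL2 _

theorem eq_equivDomain (h : D.Kissing) {f : h.dirichletForm.domain} {g : h.energySpace}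
    (hfg : (f : Lp ℝ 2 D.gasketMeasure) =ᵐ[D.gasketMeasure] fun x => (g : ℂ → ℝ) x) : f = h.equivDomain g :=
  Subtype.ext (Lp.ext (hfg.trans (h.coeFn_toL2 g).symm))

theorem inner_gradL2 (h : D.Kissing) (f g : h.energySpace) :
    inner ℝ (h.gradL2 f) (h.gradL2 g) = ∫ p, D.arcDeriv f p * D.arcDeriv g p ∂D.angularMeasure := by
  rw [L2.inner_def]
  refine integral_congr_ae ?_
  filter_upwards [h.coeFn_gradL2 f, h.coeFn_gradL2 g] with p h1 h2
  rw [h1, h2]; exact mul_comm _ _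

theorem integrable_mul_arcDeriv (h : D.Kissing) (f g : h.energySpace) :
    Integrable (fun p => D.arcDeriv f p * D.arcDeriv g p) D.angularMeasure := by
  refine (L2.integrable_inner (𝕜 := ℝ) (h.gradL2 f) (h.gradL2 g)).congr ?_
  filter_upwards [h.coeFn_gradL2 f, h.coeFn_gradL2 g] with p h1 h2
  rw [h1, h2]; exact mul_comm _ _

theorem energy_ofSobolev (h : D.Kissing) {u v : D.arcUnion → ℝ} (hu : u ∈ D.sobolevSpace)
    (hv : v ∈ D.sobolevSpace) :
    D.energy u v = inner ℝ (h.gradL2 (h.ofSobolev hu)) (h.gradL2 (h.ofSobolev hv)) := by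
  rw [h.energy_eq (h.integrable_mul_arcDeriv (h.ofSobolev hu) (h.ofSobolev hv)), h.inner_gradL2]
  rfl

theorem zeroExt_domRestrict (h : D.Kissing) (f : h.energySpace) :
    D.zeroExt (fun x : D.arcUnion => (f : ℂ → ℝ) x) = f := by
  ext x
  by_cases hx : x ∈ D.arcUnion
  · exact D.zeroExt_apply _ ⟨x, hx⟩
  · rw [D.zeroExt_of_notMem _ hx, f.2.2.2 x hx]

theorem isEnergyForm (h : D.Kissing) : D.IsEnergyForm h.dirichletForm where
  memLp u hu := h.memLp_gasketMeasure (h.ofSobolev hu).2.1 (h.ofSobolev hu).2.2.1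
  injective u hu v hv huv := by
    ext x
    have := h.eqOn_of_ae_eq (h.ofSobolev hu).2.1 (h.ofSobolev hv).2.1 huv x x.2
    simpa only [ofSobolev, zeroExt_apply] using this
  mem_domain f := by
    constructor
    · rintro ⟨F, rfl⟩
      refine ⟨fun x => (F : ℂ → ℝ) x, ?_, ?_⟩
      · rw [h.mem_sobolevSpace_iff, h.zeroExt_domRestrict]; exact ⟨F.2.1, F.2.2.1⟩
      · refine (h.coeFn_toL2 F).trans (ae_of_all _ fun x => ?_)
        rw [onGasket, h.zeroExt_domRestrict]
    · rintro ⟨u, hu, hfu⟩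
      exact ⟨h.ofSobolev hu, Lp.ext ((h.toL2_ofSobolev hu).trans hfu.symm)⟩
  form_eq f g u hu v hv hfu hgv := by
    rw [h.eq_equivDomain (g := h.ofSobolev hu) hfu, h.eq_equivDomain (g := h.ofSobolev hv) hgv,
      h.form_equivDomain, h.energy_ofSobolev hu hv]

theorem q_mem_arcUnion (h : D.Kissing) (j : Fin 3) : D.q j ∈ D.arcUnion := by
  obtain ⟨k, rfl⟩ : ∃ k : Fin 3, k + 1 = j := ⟨j - 1, sub_add_cancel j 1⟩
  exact Set.mem_iUnion.2 ⟨_, h.q_mem_arc_snd k⟩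

theorem enorm_toL2_sq_le (h : D.Kissing) (f : h.energySpace) (hf : ∀ j, (f : ℂ → ℝ) (D.q j) = 0) :
    ‖h.toL2 f‖ₑ ^ 2 ≤ ENNReal.ofReal (40 / D.kappa ^ 2) * ‖h.gradL2 f‖ₑ ^ 2 := by
  rw [h.enorm_toL2_sq, h.enorm_gradL2_sq]
  exact f.2.1.totalInt_massDens_le h hf

theorem integral_sq_le (h : D.Kissing) {u : D.arcUnion → ℝ} (hu : u ∈ D.sobolevSpace)
    (hq : ∀ x : D.arcUnion, (x : ℂ) ∈ D.V0 → u x = 0) :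
    ∫ x, D.onGasket u x ^ 2 ∂D.gasketMeasure ≤ 40 / D.kappa ^ 2 * D.energy u u := by
  set f := h.ofSobolev hu
  have h1 := h.enorm_toL2_sq_le f fun j => (D.zeroExt_apply u ⟨_, h.q_mem_arcUnion j⟩).trans (hq _ ⟨j, rfl⟩)
  have h2 : ∫ x, D.onGasket u x ^ 2 ∂D.gasketMeasure = ‖h.toL2 f‖ ^ 2 := by
    rw [← real_inner_self_eq_norm_sq, L2.inner_def]
    refine integral_congr_ae ?_
    filter_upwards [h.toL2_ofSobolev hu] with x hx
    rw [hx]; exact sq _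
  rw [h2, h.energy_ofSobolev hu hu, real_inner_self_eq_norm_sq,
    ← ENNReal.ofReal_le_ofReal_iff (by positivity), ENNReal.ofReal_mul (by positivity),
    ENNReal.ofReal_pow (norm_nonneg _), ENNReal.ofReal_pow (norm_nonneg _), ofReal_norm, ofReal_norm]
  exact h1

/-- Difference quotients of φ ∘ f are dominated by those of f. Where φ ∘ f is not differentiable,
`deriv` takes the default value 0 and the bound is trivial. -/
theorem clamp_mem (h : D.Kissing) (f : h.energySpace) {φ : ℝ → ℝ} (hφ : LipschitzWith 1 φ) (h0 : φ 0 = 0) :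
    ∃ g : h.energySpace, (∀ x, (g : ℂ → ℝ) x = φ ((f : ℂ → ℝ) x)) ∧ ‖h.gradL2 g‖ ≤ ‖h.gradL2 f‖ := by
  have hle : totalInt (energyDens fun x => φ ((f : ℂ → ℝ) x)) D ≤ totalInt (energyDens f) D := by
    rw [totalInt_energyDens, totalInt_energyDens]
    refine lintegral_mono_ae ?_
    filter_upwards [f.2.1.ae_differentiableAt h] with p hp
    gcongr 1
    rw [enorm_le_iff_norm_le]
    by_cases hd : DifferentiableAt ℝ (fun t => φ ((f : ℂ → ℝ) (D.arcPt p.1 t))) p.2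
    · have t1 := hd.hasDerivAt.tendsto_slope.norm
      have t2 := hp.hasDerivAt.tendsto_slope.norm
      refine le_of_tendsto_of_tendsto' t1 t2 fun t => ?_
      simp only [slope_def_field, norm_div]
      gcongr
      simpa [Real.dist_eq] using hφ.dist_le_mul ((f : ℂ → ℝ) (D.arcPt p.1 t)) ((f : ℂ → ℝ) (D.arcPt p.1 p.2))
    · have : D.arcDeriv (fun x => φ ((f : ℂ → ℝ) x)) p = 0 := deriv_zero_of_not_differentiableAt hd
      rw [this, norm_zero]; exact norm_nonneg _
  refine ⟨⟨fun x => φ ((f : ℂ → ℝ) x), f.2.1.comp_lipschitz hφ, hle.trans_lt f.2.2.1, fun x hx => ?_⟩,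
    fun x => rfl, ?_⟩
  · simp only [f.2.2.2 x hx, h0]
  · rw [← enorm_le_iff_norm_le]
    refine (ENNReal.pow_le_pow_left_iff two_ne_zero).1 ?_
    rw [h.enorm_gradL2_sq, h.enorm_gradL2_sq]; exact hle

theorem dirichletForm_closed (h : D.Kissing) (f : ℕ → h.dirichletForm.domain)
    (hf : ∀ ε > 0, ∃ N, ∀ m ≥ N, ∀ n ≥ N, h.dirichletForm.energyOne (f m - f n) < ε) :
    ∃ g : h.dirichletForm.domain, Tendsto (fun n => h.dirichletForm.energyOne (f n - g)) atTop (𝓝 0) := by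
  choose F hF using fun n => h.equivDomain.surjective (f n)
  obtain rfl : (fun n => h.equivDomain (F n)) = f := funext hF
  simp only [← map_sub, energyOne_equivDomain] at hf
  have hc : CauchySeq (fun n => h.toL2 (F n)) ∧ CauchySeq (fun n => h.gradL2 (F n)) := by
    simp only [Metric.cauchySeq_iff, dist_eq_norm, ← map_sub]
    refine ⟨fun ε hε => ?_, fun ε hε => ?_⟩
    all_goals
      obtain ⟨N, hN⟩ := hf (ε ^ 2) (by positivity)
      refine ⟨N, fun m hm n hn => lt_of_pow_lt_pow_left₀ 2 hε.le ?_⟩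
      have h1 := hN m hm n hn
      have h2 := sq_nonneg ‖h.toL2 (F m - F n)‖
      have h3 := sq_nonneg ‖h.gradL2 (F m - F n)‖
      linarith
  obtain ⟨φ, hφ⟩ := cauchySeq_tendsto_of_complete hc.1
  obtain ⟨ψ, hψ⟩ := cauchySeq_tendsto_of_complete hc.2
  obtain ⟨G, rfl, rfl⟩ := h.exists_of_tendsto hφ hψ
  refine ⟨h.equivDomain G, ?_⟩
  simp only [← map_sub, energyOne_equivDomain]
  simp only [map_sub]
  have h1 := (tendsto_iff_norm_sub_tendsto_zero.1 hφ).pow 2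
  have h2 := (tendsto_iff_norm_sub_tendsto_zero.1 hψ).pow 2
  simpa using h2.add h1

theorem dirichletForm_markov (h : D.Kissing) (f : h.dirichletForm.domain) : ∃ g : h.dirichletForm.domain,
    (g : Lp ℝ 2 D.gasketMeasure) =ᵐ[D.gasketMeasure]
      (fun x => min (max ((f : Lp ℝ 2 D.gasketMeasure) x) 0) 1) ∧
      h.dirichletForm.form g g ≤ h.dirichletForm.form f f := by
  obtain ⟨F, rfl⟩ := h.equivDomain.surjective f
  obtain ⟨G, hG, hGF⟩ := h.clamp_mem F (φ := fun t => min (max t 0) 1)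
    ((LipschitzWith.id.max_const 0).min_const 1) (by simp)
  refine ⟨h.equivDomain G, ?_, ?_⟩
  · filter_upwards [h.coeFn_toL2 F, h.coeFn_toL2 G] with x h1 h2
    rw [coe_equivDomain, coe_equivDomain, h1, h2, hG]
  · rw [form_self_equivDomain, form_self_equivDomain]; gcongr

/-- By continuity along the arc, equality almost everywhere on a relatively open set is equality
there, so f is locally constant in the angle. -/
theorem arcDeriv_eq_zero_of_ae_const (h : D.Kissing) (hf : D.ACOnArcs f) {W : Set ℂ} (hW : IsOpen W) {c : ℝ}
    (hc : ∀ᵐ x : D.gasket ∂D.gasketMeasure, (x : ℂ) ∈ W → f x = c) :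
    ∀ᵐ p ∂D.angularMeasure, D.arcPt p.1 p.2 ∈ W → D.arcDeriv f p = 0 := by
  refine ae_angularMeasure.2 fun i => ?_
  have h1 := ae_angularMeasure.1 ((h.ae_gasketMeasure (P := fun x => x ∈ W → f x = c)).1 hc) i
  rw [← Measure.restrict_congr_set Ioo_ae_eq_Ioc] at h1 ⊢
  have hN : IsOpen (Set.Ioo 0 (D.arcLen i) ∩ D.arcPt i ⁻¹' W) :=
    isOpen_Ioo.inter (hW.preimage (D.continuous_arcPt i))
  have h2 : (fun t => f (D.arcPt i t)) =ᵐ[volume.restrict (Set.Ioo 0 (D.arcLen i) ∩ D.arcPt i ⁻¹' W)]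
      fun _ => c := by
    rw [ae_restrict_iff' measurableSet_Ioo] at h1
    refine (ae_restrict_iff' hN.measurableSet).2 ?_
    filter_upwards [h1] with t ht hmem using ht hmem.1 hmem.2
  have h3 := Measure.eqOn_open_of_ae_eq h2 hN
    ((h.continuousOn_arcPt hf i).mono fun t ht => Set.Ioo_subset_Icc_self ht.1) continuousOn_const
  refine (ae_restrict_iff' measurableSet_Ioo).2 (ae_of_all _ fun t ht htW => ?_)
  have h4 : (fun t => f (D.arcPt i t)) =ᶠ[𝓝 t] fun _ => c := by
    filter_upwards [hN.mem_nhds ⟨ht, htW⟩] with s hs using h3 hs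
  exact h4.deriv_eq.trans (deriv_const _ _)

theorem _root_.L2Form.ae_eq_zero_of_notMem_l2Support {X : Type*} [MeasurableSpace X] [TopologicalSpace X]
    [HereditarilyLindelofSpace X] [OpensMeasurableSpace X] {μ : Measure X} (f : Lp ℝ 2 μ) :
    ∀ᵐ x ∂μ, x ∉ L2Form.l2Support f → f x = 0 := by
  have h1 : (μ.withDensity fun x => ‖f x‖ₑ) (L2Form.l2Support f)ᶜ = 0 := Measure.measure_compl_support
  have hm : MeasurableSet (L2Form.l2Support f)ᶜ := Measure.isClosed_support.isOpen_compl.measurableSet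
  rw [withDensity_apply _ hm, lintegral_eq_zero_iff' (Lp.aestronglyMeasurable f).restrict.enorm,
    EventuallyEq, ae_restrict_iff' hm] at h1
  filter_upwards [h1] with x hx hx'
  simpa using hx hx'

/-- The derivative of f vanishes off its support and that of g vanishes on U, which contains this
support. Almost everywhere one factor of the integrand is zero. -/
theorem dirichletForm_stronglyLocal (h : D.Kissing) : h.dirichletForm.IsStronglyLocal := by
  rintro f g - - ⟨U, hU, hfU, c, hc⟩
  obtain ⟨F, rfl⟩ := h.equivDomain.surjective f
  obtain ⟨G, rfl⟩ := h.equivDomain.surjective g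
  obtain ⟨W, hW, rfl⟩ := isOpen_induced_iff.1 hU
  obtain ⟨W', hW', hWF⟩ := isOpen_induced_iff.1
    (Measure.isClosed_support (μ := D.gasketMeasure.withDensity fun x =>
      ‖(h.equivDomain F : Lp ℝ 2 D.gasketMeasure) x‖ₑ)).isOpen_compl
  have hF := h.arcDeriv_eq_zero_of_ae_const F.2.1 hW' (c := 0) (by
    filter_upwards [L2Form.ae_eq_zero_of_notMem_l2Support (h.equivDomain F : Lp ℝ 2 D.gasketMeasure),
      h.coeFn_toL2 F] with x h1 h2 hx
    rw [← h2]
    exact h1 (hWF.le hx))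
  have hG := h.arcDeriv_eq_zero_of_ae_const G.2.1 hW (c := c) (by
    rw [ae_restrict_iff' hU.measurableSet] at hc
    filter_upwards [hc, h.coeFn_toL2 G] with x h1 h2 hx
    rw [← h2]
    exact h1 hx)
  have hmem : ∀ᵐ p ∂D.angularMeasure, D.arcPt p.1 p.2 ∈ D.gasket :=
    ae_angularMeasure.2 fun i => (ae_restrict_iff' measurableSet_Ioc).2 (ae_of_all _ fun t ht =>
      h.arcUnion_subset_gasket (h.arcPt_mem_arcUnion i (Set.Ioc_subset_Icc_self ht)))
  rw [h.form_equivDomain, h.inner_gradL2]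
  refine integral_eq_zero_of_ae ?_
  filter_upwards [hF, hG, hmem] with p h1 h2 h3
  by_cases hp : (⟨D.arcPt p.1 p.2, h3⟩ : D.gasket) ∈ L2Form.l2Support (h.equivDomain F : Lp ℝ 2 D.gasketMeasure)
  · rw [h2 (hfU hp), mul_zero]; rfl
  · rw [h1 (hWF.ge hp), zero_mul]; rfl

theorem totalInt_energyDens_lt_top_of_lipschitz (h : D.Kissing) {L : ℝ≥0} (hf : LipschitzWith L f) :
    totalInt (energyDens f) D < ∞ := by
  have := h.isFiniteMeasure_gasketMeasure
  have h1 : totalInt (energyDens f) D ≤ totalInt (massDens fun _ => (L : ℝ)) D := by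
    rw [totalInt_eq_lintegral, totalInt_eq_lintegral]
    refine lintegral_mono fun p => ?_
    rw [energyDens_arcPt, massDens, ← ofReal_sq_eq, ← ofReal_sq_eq, ← ENNReal.ofReal_mul (sq_nonneg _), ← mul_pow]
    refine ENNReal.ofReal_le_ofReal (sq_le_sq.2 ?_)
    have h2 := norm_deriv_le_of_lipschitz (x₀ := p.2)
      (hf.comp ((D.arcDisk p.1).lipschitzWith_pt (h.norm_arcDir p.1)))
    rw [NNReal.coe_mul, Real.coe_toNNReal _ (D.arcDisk p.1).rad_pos.le, mul_comm] at h2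
    exact h2.trans (le_abs_self _)
  refine h1.trans_lt ?_
  rw [← h.lintegral_sq_gasketMeasure fun _ => (L : ℝ), lintegral_const]
  exact ENNReal.mul_lt_top (ENNReal.pow_lt_top enorm_lt_top) (measure_lt_top _ _)

/-- The restriction of a Lipschitz function to the arcs. -/
def ofLipschitz (h : D.Kissing) {L : ℝ≥0} (hf : LipschitzWith L f) : h.energySpace :=
  ⟨D.arcUnion.indicator f, (h.acOnArcs_of_lipschitz hf).congr h fun x hx => by simp [hx],
    (h.totalInt_energyDens_congr fun x hx => by simp [hx]).trans_lt (h.totalInt_energyDens_lt_top_of_lipschitz hf),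
    fun x hx => by simp [hx]⟩

theorem ofLipschitz_apply (h : D.Kissing) {L : ℝ≥0} (hf : LipschitzWith L f) {x : ℂ} (hx : x ∈ D.arcUnion) :
    (h.ofLipschitz hf : ℂ → ℝ) x = f x := Set.indicator_of_mem hx f

theorem ae_mem_arcUnion (h : D.Kissing) : ∀ᵐ x : D.gasket ∂D.gasketMeasure, (x : ℂ) ∈ D.arcUnion :=
  h.ae_gasketMeasure.2 (ae_angularMeasure.2 fun i => (ae_restrict_iff' measurableSet_Ioc).2
    (ae_of_all _ fun _ ht => h.arcPt_mem_arcUnion i (Set.Ioc_subset_Icc_self ht)))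

theorem toL2_ofLipschitz (h : D.Kissing) {L : ℝ≥0} (hf : LipschitzWith L f) :
    h.toL2 (h.ofLipschitz hf) =ᵐ[D.gasketMeasure] fun x => f x := by
  filter_upwards [h.coeFn_toL2 (h.ofLipschitz hf), h.ae_mem_arcUnion] with x h1 h2
  rw [h1, h.ofLipschitz_apply hf h2]

theorem gradL2_ofLipschitz_const (h : D.Kissing) (c : ℝ) :
    h.gradL2 (h.ofLipschitz (LipschitzWith.const c : LipschitzWith 0 fun _ : ℂ => c)) = 0 := by
  have h2 := h.enorm_gradL2_sq (h.ofLipschitz (LipschitzWith.const c : LipschitzWith 0 fun _ : ℂ => c))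
  rw [h.totalInt_energyDens_congr (g := fun _ => c) fun x hx => h.ofLipschitz_apply _ hx,
    totalInt_energyDens] at h2
  have : D.arcDeriv (fun _ => c) = 0 := by ext p; exact deriv_const _ _
  simpa [this] using h2

theorem exists_apply_q_eq (h : D.Kissing) (f : h.energySpace) (hf : h.gradL2 f = 0) :
    ∃ c, ∀ j, (f : ℂ → ℝ) (D.q j) = c := by
  have h1 : ∀ j : Fin 3, (f : ℂ → ℝ) (D.q (j + 1)) = (f : ℂ → ℝ) (D.q (j + 2)) := fun j => by
    have h2 := h.enorm_gradL2_sq f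
    rw [hf, enorm_zero, zero_pow two_ne_zero, totalInt] at h2
    have h3 : sideInt (energyDens f) D j ≤ 0 := by
      refine le_trans ?_ h2.symm.le
      exact (Finset.single_le_sum (f := fun j => sideInt (energyDens f) D j) (fun _ _ => zero_le) (Finset.mem_univ j)).trans
        le_self_add
    have h4 := (h.ofReal_sq_div_angle_le f.2.1 j).trans h3
    rw [nonpos_iff_eq_zero, ENNReal.ofReal_eq_zero, div_nonpos_iff] at h4
    have ha := (h.angle_mem j).1
    have h5 : ((f : ℂ → ℝ) (D.q (j + 1)) - (f : ℂ → ℝ) (D.q (j + 2))) ^ 2 = 0 :=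
      le_antisymm (by rcases h4 with h4 | h4 <;> linarith [h4.1, h4.2]) (sq_nonneg _)
    exact sub_eq_zero.1 (pow_eq_zero_iff two_ne_zero |>.1 h5)
  refine ⟨(f : ℂ → ℝ) (D.q 0), fun j => ?_⟩
  have e0 := h1 0
  have e1 := h1 1
  have e2 := h1 2
  fin_cases j
  · rfl
  · exact e2.symm
  · exact e1

/-- Functions of zero energy are constant. -/
theorem exists_eq_const (h : D.Kissing) (f : h.energySpace) (hf : h.gradL2 f = 0) :
    ∃ c, h.toL2 f =ᵐ[D.gasketMeasure] fun _ => c := by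
  obtain ⟨c, hc⟩ := h.exists_apply_q_eq f hf
  set k := h.ofLipschitz (LipschitzWith.const c : LipschitzWith 0 fun _ : ℂ => c)
  have hk : h.gradL2 k = 0 := h.gradL2_ofLipschitz_const c
  -- The Poincaré inequality for f minus its common vertex value: zero energy forces zero mass.
  have h3 := h.enorm_toL2_sq_le (f - k) fun j => by
    have := h.ofLipschitz_apply (LipschitzWith.const c : LipschitzWith 0 fun _ : ℂ => c) (h.q_mem_arcUnion j)
    simp only [Submodule.coe_sub, Pi.sub_apply, hc, k, this, sub_self]
  rw [map_sub, map_sub, hf, hk, sub_zero, enorm_zero, zero_pow two_ne_zero, mul_zero, nonpos_iff_eq_zero,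
    pow_eq_zero_iff two_ne_zero, enorm_eq_zero, sub_eq_zero] at h3
  exact ⟨c, h3 ▸ h.toL2_ofLipschitz _⟩

/-- The constant 1 has zero energy, and invariance splits this into the energies of 1_A and 1_{Aᶜ},
both nonnegative. So 1_A has zero energy and is almost everywhere constant. -/
theorem dirichletForm_irreducible (h : D.Kissing) : h.dirichletForm.IsIrreducible := by
  rintro A ⟨hA, P, hP, hE⟩
  set k := h.ofLipschitz (LipschitzWith.const 1 : LipschitzWith 0 fun _ : ℂ => (1 : ℝ))
  have h0 : h.gradL2 k = 0 := h.gradL2_ofLipschitz_const 1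
  obtain ⟨χ, hχ⟩ := h.equivDomain.surjective (P (h.equivDomain k))
  have h1 := hE (h.equivDomain k) (h.equivDomain k)
  rw [← hχ, ← map_sub, h.form_self_equivDomain, h.form_self_equivDomain, h.form_self_equivDomain, h0,
    norm_zero] at h1
  have h2 : h.gradL2 χ = 0 := by
    have := sq_nonneg ‖h.gradL2 (k - χ)‖
    have := sq_nonneg ‖h.gradL2 χ‖
    exact norm_eq_zero.1 ((pow_eq_zero_iff two_ne_zero).1 (by linarith))
  obtain ⟨c, hc⟩ := h.exists_eq_const χ h2
  have h3 : ∀ᵐ x ∂D.gasketMeasure, A.indicator (fun _ => (1 : ℝ)) x = c := by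
    have hPk := hP (h.equivDomain k)
    rw [← hχ] at hPk
    filter_upwards [hPk, hc, h.toL2_ofLipschitz (LipschitzWith.const 1 : LipschitzWith 0 fun _ : ℂ => (1 : ℝ))]
      with x e1 e2 e3
    rw [← e2]
    refine Eq.trans ?_ e1.symm
    by_cases hx : x ∈ A
    · rw [Set.indicator_of_mem hx, Set.indicator_of_mem hx]; exact e3.symm
    · rw [Set.indicator_of_notMem hx, Set.indicator_of_notMem hx]
  by_cases hc1 : c = 1
  · right
    refine measure_mono_null (fun x hx => ?_) h3
    simp only [Set.mem_compl_iff, Set.mem_ofPred_eq]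
    rw [Set.indicator_of_notMem hx, hc1]; exact zero_ne_one
  · left
    refine measure_mono_null (fun x hx => ?_) h3
    simp only [Set.mem_compl_iff, Set.mem_ofPred_eq]
    rw [Set.indicator_of_mem hx]; exact Ne.symm hc1

end Kissing

end Triple

/-- The algebra of Lipschitz functions on a compact metric space. -/
def lipschitzSubalgebra (X : Type*) [MetricSpace X] [CompactSpace X] : Subalgebra ℝ C(X, ℝ) where
  carrier := {f | ∃ K : ℝ≥0, LipschitzWith K f}
  algebraMap_mem' r := ⟨0, LipschitzWith.const r⟩
  add_mem' := by
    rintro f g ⟨K, hf⟩ ⟨L, hg⟩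
    exact ⟨K + L, hf.add hg⟩
  mul_mem' := by
    rintro f g ⟨K, hf⟩ ⟨L, hg⟩
    refine ⟨K * ‖g‖₊ + ‖f‖₊ * L, LipschitzWith.of_dist_le_mul fun x y => ?_⟩
    have h1 := hf.dist_le_mul x y
    have h2 := hg.dist_le_mul x y
    have h3 := g.norm_coe_le_norm x
    have h4 := f.norm_coe_le_norm y
    rw [Real.dist_eq] at h1 h2 ⊢
    rw [Real.norm_eq_abs] at h3 h4
    simp only [ContinuousMap.mul_apply, NNReal.coe_add, NNReal.coe_mul, coe_nnnorm]
    have e : f x * g x - f y * g y = (f x - f y) * g x + f y * (g x - g y) := by ring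
    rw [e]
    refine (abs_add_le _ _).trans ?_
    rw [abs_mul, abs_mul]
    have h5 := mul_le_mul h1 h3 (abs_nonneg _) (by positivity)
    have h6 := mul_le_mul h4 h2 (abs_nonneg _) (by positivity)
    linarith

theorem lipschitzSubalgebra_separatesPoints (X : Type*) [MetricSpace X] [CompactSpace X] :
    (lipschitzSubalgebra X).SeparatesPoints := by
  intro x y hxy
  refine ⟨fun z => Dist.dist z y, ⟨⟨fun z => Dist.dist z y, by fun_prop⟩, ⟨1, LipschitzWith.dist_left y⟩, rfl⟩, ?_⟩
  simpa using hxy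

theorem dense_lipschitzSubalgebra (X : Type*) [MetricSpace X] [CompactSpace X] :
    Dense (lipschitzSubalgebra X : Set C(X, ℝ)) :=
  ContinuousMap.continuousMap_mem_subalgebra_closure_of_separatesPoints _ (lipschitzSubalgebra_separatesPoints X)

/-- Bounded sequences of a subspace can be improved, by passing to convex combinations, so that
their images under a second linear map converge. -/
theorem exists_seq_tendsto_of_bounded {V E G : Type*} [AddCommGroup V] [Module ℝ V] [NormedAddCommGroup E]
    [NormedSpace ℝ E] [NormedAddCommGroup G] [InnerProductSpace ℝ G] [CompleteSpace G] (A : V →ₗ[ℝ] E)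
    (B : V →ₗ[ℝ] G) (L : Submodule ℝ V) (a : E) (C : ℝ)
    (hL : ∀ δ > 0, ∃ l ∈ L, ‖A l - a‖ ≤ δ ∧ ‖B l‖ ^ 2 ≤ C) :
    ∃ l : ℕ → V, (∀ n, l n ∈ L) ∧ Tendsto (fun n => A (l n)) atTop (𝓝 a) ∧
      ∃ b, Tendsto (fun n => B (l n)) atTop (𝓝 b) := by
  set e : ℕ → ℝ := fun n => 1 / ((n : ℝ) + 1)
  have he : ∀ n, 0 < e n := fun n => by positivity
  have het : Tendsto e atTop (𝓝 0) := tendsto_one_div_add_atTop_nhds_zero_nat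
  have hea : Antitone e := fun m n hmn => Nat.one_div_le_one_div hmn
  -- `S n` collects the energies ‖B l‖² of the l ∈ L with A l within e n of a. The infima d n
  -- increase to a finite limit d'. Midpoints respect the constraint, so for indices beyond N the
  -- parallelogram law bounds the squared distance between near-minimisers by 4(d' + e N) - 4 d N.
  set S : ℕ → Set ℝ := fun n => {r | ∃ l ∈ L, ‖A l - a‖ ≤ e n ∧ ‖B l‖ ^ 2 = r}
  have hSb : ∀ n, BddBelow (S n) := fun n => ⟨0, by rintro r ⟨l, -, -, rfl⟩; positivity⟩
  have hSn : ∀ n, ∃ r ∈ S n, r ≤ C := fun n => by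
    obtain ⟨l, h1, h2, h3⟩ := hL (e n) (he n)
    exact ⟨_, ⟨l, h1, h2, rfl⟩, h3⟩
  set d : ℕ → ℝ := fun n => sInf (S n)
  have hmono : Monotone d := fun m n hmn => by
    obtain ⟨r, hr, -⟩ := hSn n
    refine csInf_le_csInf (hSb m) ⟨r, hr⟩ ?_
    rintro r ⟨l, h1, h2, h3⟩
    exact ⟨l, h1, h2.trans (hea hmn), h3⟩
  have hbdd : BddAbove (Set.range d) := ⟨C, by
    rintro _ ⟨n, rfl⟩
    obtain ⟨r, hr, hrC⟩ := hSn n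
    exact (csInf_le (hSb n) hr).trans hrC⟩
  have hd := tendsto_atTop_ciSup hmono hbdd
  set d' := ⨆ n, d n
  have hl : ∀ n, ∃ l ∈ L, ‖A l - a‖ ≤ e n ∧ ‖B l‖ ^ 2 < d n + e n := fun n => by
    obtain ⟨r, hr, -⟩ := hSn n
    obtain ⟨_, ⟨l, h1, h2, rfl⟩, h3⟩ := exists_lt_of_csInf_lt ⟨r, hr⟩ (lt_add_of_pos_right (sInf (S n)) (he n))
    exact ⟨l, h1, h2, h3⟩
  choose l hlL hlA hlB using hl
  refine ⟨l, hlL, ?_, ?_⟩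
  · exact tendsto_iff_norm_sub_tendsto_zero.2 (squeeze_zero (fun _ => norm_nonneg _) hlA het)
  · refine cauchySeq_tendsto_of_complete (cauchySeq_of_le_tendsto_0 (fun N => Real.sqrt (4 * (d' + e N) - 4 * d N))
      (fun n m N hn hm => ?_) ?_)
    · rw [dist_eq_norm]
      refine Real.le_sqrt_of_sq_le ?_
      have h1 := parallelogram_law_with_norm ℝ (B (l n)) (B (l m))
      have h2 : d N ≤ ‖B ((1 / 2 : ℝ) • (l n + l m))‖ ^ 2 := by
        refine csInf_le (hSb N) ⟨_, L.smul_mem _ (L.add_mem (hlL n) (hlL m)), ?_, rfl⟩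
        have e1 : A ((1 / 2 : ℝ) • (l n + l m)) - a = (1 / 2 : ℝ) • ((A (l n) - a) + (A (l m) - a)) := by
          rw [map_smul, map_add]; module
        rw [e1, norm_smul, Real.norm_of_nonneg (by norm_num)]
        have e2 := norm_add_le (A (l n) - a) (A (l m) - a)
        have e3 := (hlA n).trans (hea hn)
        have e4 := (hlA m).trans (hea hm)
        linarith
      rw [map_smul, norm_smul, map_add, Real.norm_of_nonneg (by norm_num), mul_pow] at h2
      have h3 := hlB n
      have h4 := hlB m
      have h5 := hea hn
      have h6 := hea hm
      have h7 := le_ciSup hbdd n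
      have h8 := le_ciSup hbdd m
      nlinarith
    · have : Tendsto (fun N => 4 * (d' + e N) - 4 * d N) atTop (𝓝 (4 * (d' + 0) - 4 * d')) :=
        ((het.const_add d').const_mul 4).sub (hd.const_mul 4)
      simpa using this.sqrt

/-! ### Lipschitz functions as a core -/

namespace Triple

variable {D : Triple} {f g : ℂ → ℝ}

namespace Kissing

theorem compactSpace_gasket (h : D.Kissing) : CompactSpace D.gasket :=
  isCompact_iff_compactSpace.1 h.isCompact_gasket

theorem exists_lipschitz_extension {φ : D.gasket → ℝ} {K : ℝ≥0} (hφ : LipschitzWith K φ) :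
    ∃ f : ℂ → ℝ, LipschitzWith K f ∧ ∀ x : D.gasket, f x = φ x := by
  have h1 : LipschitzOnWith K (Function.extend Subtype.val φ 0) D.gasket := by
    rw [lipschitzOnWith_iff_restrict]
    convert! hφ
    ext x
    exact Subtype.val_injective.extend_apply φ 0 x
  obtain ⟨f, hf, hfe⟩ := h1.extend_real
  exact ⟨f, hf, fun x => (hfe x.2).symm.trans (Subtype.val_injective.extend_apply φ 0 x)⟩

theorem exists_mem_domain_of_lipschitz (h : D.Kissing) {φ : D.gasket → ℝ} {K : ℝ≥0} (hφ : LipschitzWith K φ) :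
    ∃ g : h.dirichletForm.domain, (g : Lp ℝ 2 D.gasketMeasure) =ᵐ[D.gasketMeasure] φ := by
  obtain ⟨f, hf, hfφ⟩ := exists_lipschitz_extension hφ
  exact ⟨h.equivDomain (h.ofLipschitz hf), (h.toL2_ofLipschitz hf).trans (ae_of_all _ hfφ)⟩

theorem dense_domain (h : D.Kissing) : Dense (h.dirichletForm.domain : Set (Lp ℝ 2 D.gasketMeasure)) := by
  have := h.compactSpace_gasket
  have := h.isFiniteMeasure_gasketMeasure
  have h1 := (ContinuousMap.toLp_denseRange ℝ D.gasketMeasure ℝ (p := 2) (by simp)).dense_image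
    (ContinuousLinearMap.continuous _) (dense_lipschitzSubalgebra D.gasket)
  refine h1.mono ?_
  rintro _ ⟨φ, ⟨K, hφ⟩, rfl⟩
  obtain ⟨g, hg⟩ := h.exists_mem_domain_of_lipschitz hφ
  convert! g.2
  exact Lp.ext ((ContinuousMap.coeFn_toLp _ _).trans hg.symm)

/-- The functions of finite energy which are Lipschitz continuous on the arcs. -/
def lipschitzSubmodule (h : D.Kissing) : Submodule ℝ h.energySpace where
  carrier := {f | ∃ (K : ℝ≥0) (φ : ℂ → ℝ), LipschitzWith K φ ∧ ∀ x ∈ D.arcUnion, (f : ℂ → ℝ) x = φ x}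
  zero_mem' := ⟨0, fun _ => 0, LipschitzWith.const 0, fun _ _ => rfl⟩
  add_mem' := by
    rintro f g ⟨K, φ, hφ, hf⟩ ⟨L, ψ, hψ, hg⟩
    exact ⟨K + L, fun x => φ x + ψ x, hφ.add hψ, fun x hx => congrArg₂ _ (hf x hx) (hg x hx)⟩
  smul_mem' := by
    rintro c f ⟨K, φ, hφ, hf⟩
    exact ⟨_, fun x => c * φ x, (lipschitzWith_smul c).comp hφ, fun x hx => congrArg _ (hf x hx)⟩

/-- The approximants of level n converge to F in L² with energies at most 100 times that of F.
`exists_seq_tendsto_of_bounded` yields Lipschitz functions whose gradients converge as well;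
closedness and injectivity identify the limit with the gradient of F. -/
theorem exists_lipschitz_tendsto (h : D.Kissing) (F : h.energySpace) : ∃ l : ℕ → h.energySpace,
    (∀ n, l n ∈ h.lipschitzSubmodule) ∧ Tendsto (fun n => h.toL2 (l n)) atTop (𝓝 (h.toL2 F)) ∧
      Tendsto (fun n => h.gradL2 (l n)) atTop (𝓝 (h.gradL2 F)) := by
  obtain ⟨s, hs, hsD⟩ := exists_pos_le_curv D
  obtain ⟨l, h1, h2, b, h3⟩ := exists_seq_tendsto_of_bounded h.toL2 h.gradL2 h.lipschitzSubmodule (h.toL2 F)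
    (100 * ‖h.gradL2 F‖ ^ 2) fun δ hδ => by
      set M := 40 * (202 * ‖h.gradL2 F‖ ^ 2)
      have hlim : Tendsto (fun n : ℕ => M / (D.kappa + 2 * n * s) ^ 2) atTop (𝓝 0) := by
        refine Tendsto.div_atTop tendsto_const_nhds ((tendsto_pow_atTop two_ne_zero).comp ?_)
        refine tendsto_atTop_add_const_left _ _ ?_
        exact (tendsto_natCast_atTop_atTop.const_mul_atTop two_pos).atTop_mul_const hs
      obtain ⟨n, hn⟩ := (hlim.eventually (gt_mem_nhds (sq_pos_of_pos hδ))).exists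
      obtain ⟨φ, ⟨K, hφ⟩, -, hE, hM⟩ := ACOnArcs.exists_lipschitz_approx hs n h hsD F.2.1
      refine ⟨h.ofLipschitz hφ, ⟨K, φ, hφ, fun x hx => h.ofLipschitz_apply hφ hx⟩, ?_, ?_⟩
      · have e1 : ‖h.toL2 (F - h.ofLipschitz hφ)‖ₑ ^ 2 ≤
            ENNReal.ofReal (40 / (D.kappa + 2 * n * s) ^ 2) * (202 * ‖h.gradL2 F‖ₑ ^ 2) := by
          rw [h.enorm_toL2_sq, h.enorm_gradL2_sq]
          refine le_of_eq_of_le ?_ hM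
          exact h.totalInt_massDens_congr fun x hx => by
            simp only [Submodule.coe_sub, Pi.sub_apply, h.ofLipschitz_apply hφ hx]
        have e2 : ‖h.toL2 (F - h.ofLipschitz hφ)‖ ^ 2 ≤ M / (D.kappa + 2 * n * s) ^ 2 := by
          have : M / (D.kappa + 2 * n * s) ^ 2 = 40 / (D.kappa + 2 * n * s) ^ 2 * (202 * ‖h.gradL2 F‖ ^ 2) := by ring
          rw [this, ← ENNReal.ofReal_le_ofReal_iff (by positivity), ENNReal.ofReal_mul (by positivity),
            ENNReal.ofReal_mul (by positivity), ENNReal.ofReal_pow (norm_nonneg _),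
            ENNReal.ofReal_pow (norm_nonneg _), ofReal_norm, ofReal_norm, ENNReal.ofReal_ofNat]
          exact e1
        rw [norm_sub_rev, ← map_sub]
        exact (lt_of_pow_lt_pow_left₀ 2 hδ.le (e2.trans_lt hn)).le
      · rw [← ENNReal.ofReal_le_ofReal_iff (by positivity), ENNReal.ofReal_mul (by positivity),
          ENNReal.ofReal_pow (norm_nonneg _), ENNReal.ofReal_pow (norm_nonneg _), ofReal_norm, ofReal_norm,
          ENNReal.ofReal_ofNat, h.enorm_gradL2_sq, h.enorm_gradL2_sq]
        refine le_of_eq_of_le ?_ hE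
        exact h.totalInt_energyDens_congr fun x hx => h.ofLipschitz_apply hφ hx
  obtain ⟨G, hG, hG'⟩ := h.exists_of_tendsto h2 h3
  obtain rfl := h.injective_toL2 hG
  exact ⟨l, h1, h2, hG' ▸ h3⟩

theorem isCore_lipschitzFunctions (h : D.Kissing) : h.dirichletForm.IsCore D.lipschitzFunctions where
  continuous := by rintro φ ⟨K, hφ⟩; exact hφ.continuous
  hasCompactSupport φ _ := by
    have := h.compactSpace_gasket
    exact HasCompactSupport.of_compactSpace φ
  mem_domain := by rintro φ ⟨K, hφ⟩; exact h.exists_mem_domain_of_lipschitz hφ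
  dense_domain f ε hε := by
    obtain ⟨F, rfl⟩ := h.equivDomain.surjective f
    obtain ⟨l, h1, h2, h3⟩ := h.exists_lipschitz_tendsto F
    have h4 : Tendsto (fun n => ‖h.gradL2 (l n) - h.gradL2 F‖ ^ 2 + ‖h.toL2 (l n) - h.toL2 F‖ ^ 2) atTop (𝓝 0) := by
      simpa using ((tendsto_iff_norm_sub_tendsto_zero.1 h3).pow 2).add ((tendsto_iff_norm_sub_tendsto_zero.1 h2).pow 2)
    obtain ⟨n, hn⟩ := (h4.eventually (gt_mem_nhds hε)).exists
    obtain ⟨K, φ, hφ, hlφ⟩ := h1 n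
    refine ⟨fun x => φ x, ⟨K, fun x y => hφ x y⟩, h.equivDomain (l n), ?_, ?_⟩
    · filter_upwards [h.coeFn_toL2 (l n), h.ae_mem_arcUnion] with x e1 e2
      rw [coe_equivDomain, e1, hlφ x e2]
    · rw [← map_sub, energyOne_equivDomain, map_sub, map_sub, norm_sub_rev, norm_sub_rev (h.toL2 F)]
      exact hn
  dense_continuous ψ hψ _ ε hε := by
    have := h.compactSpace_gasket
    obtain ⟨⟨φ, K, hφ⟩, hd⟩ := ContinuousMap.exists_mem_subalgebra_near_continuous_of_separatesPoints _
      (lipschitzSubalgebra_separatesPoints D.gasket) ψ hψ ε hε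
    refine ⟨φ, ⟨K, hφ⟩, fun x => ?_⟩
    rw [abs_sub_comm]
    exact hd x

theorem isRegular_dirichletForm (h : D.Kissing) : h.dirichletForm.IsRegular where
  continuous φ hφ := hφ.1
  hasCompactSupport φ hφ := hφ.2.1
  mem_domain φ hφ := hφ.2.2
  dense_domain f ε hε := by
    have H := h.isCore_lipschitzFunctions
    obtain ⟨φ, hφ, r⟩ := H.dense_domain f ε hε
    exact ⟨φ, ⟨H.continuous φ hφ, H.hasCompactSupport φ hφ, H.mem_domain φ hφ⟩, r⟩
  dense_continuous ψ hψ hψ' ε hε := by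
    have H := h.isCore_lipschitzFunctions
    obtain ⟨φ, hφ, r⟩ := H.dense_continuous ψ hψ hψ' ε hε
    exact ⟨φ, ⟨H.continuous φ hφ, H.hasCompactSupport φ hφ, H.mem_domain φ hφ⟩, r⟩

theorem isSymmetricDirichletForm (h : D.Kissing) : h.dirichletForm.IsSymmetricDirichletForm where
  dense := h.dense_domain
  symm f g := by
    obtain ⟨F, rfl⟩ := h.equivDomain.surjective f
    obtain ⟨G, rfl⟩ := h.equivDomain.surjective g
    rw [form_equivDomain, form_equivDomain, real_inner_comm]
  nonneg f := by
    obtain ⟨F, rfl⟩ := h.equivDomain.surjective f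
    rw [form_self_equivDomain]; positivity
  closed := h.dirichletForm_closed
  markov := h.dirichletForm_markov

end Kissing

end Triple

/-! ### Compactness of the inclusion into L² -/

theorem totallyBounded_image_of_finite_approx {α E : Type*} [PseudoMetricSpace E] (A : α → E) (B : Set α)
    (H : ∀ ε > 0, ∃ (W : Type) (_ : Fintype W) (v : α → W → ℝ) (δ : ℝ), 0 < δ ∧
      Bornology.IsBounded (v '' B) ∧ ∀ x ∈ B, ∀ y ∈ B, Dist.dist (v x) (v y) < δ → Dist.dist (A x) (A y) < ε) :
    TotallyBounded (A '' B) := by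
  refine Metric.totallyBounded_iff.2 fun ε hε => ?_
  obtain ⟨W, _, v, δ, hδ, hb, hv⟩ := H ε hε
  obtain ⟨t, htB, htf, ht⟩ := totallyBounded_iff_subset.1 (hb.isCompact_closure.totallyBounded.subset subset_closure) _ (Metric.dist_mem_uniformity hδ)
  obtain ⟨t', ht'B, ht'f, rfl⟩ := Set.exists_subset_image_finite_and.1 ⟨t, htB, htf, rfl⟩
  refine ⟨A '' t', ht'f.image A, ?_⟩
  rintro _ ⟨x, hx, rfl⟩
  obtain ⟨_, ⟨y, hy, rfl⟩, hxy⟩ := Set.mem_iUnion₂.1 (ht (Set.mem_image_of_mem v hx))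
  exact Set.mem_iUnion₂.2 ⟨A y, Set.mem_image_of_mem A hy, hv x hx y (ht'B hy) hxy⟩

/-- This soft threshold is a contraction that vanishes on [-η, η] and moves every number by at most
η. It annihilates small vertex values without raising the energy. -/
theorem lipschitzWith_one_sub_clamp {η : ℝ} (hη : 0 ≤ η) :
    LipschitzWith 1 fun t : ℝ => t - max (min t η) (-η) := by
  refine LipschitzWith.of_dist_le_mul fun a b => ?_
  rw [Real.dist_eq, Real.dist_eq, NNReal.coe_one, one_mul]
  have key : ∀ a b : ℝ, a ≤ b → |(a - max (min a η) (-η)) - (b - max (min b η) (-η))| ≤ |a - b| := by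
    intro a b hab
    rw [abs_of_nonpos (sub_nonpos.2 hab), abs_le]
    rcases min_cases a η with h1 | h1 <;> rcases min_cases b η with h2 | h2 <;>
    rcases max_cases (min a η) (-η) with h3 | h3 <;> rcases max_cases (min b η) (-η) with h4 | h4 <;>
    constructor <;> linarith
  rcases le_total a b with h | h
  · exact key a b h
  · rw [abs_sub_comm, abs_sub_comm a]; exact key b a h

namespace Triple

variable {D : Triple} {f g : ℂ → ℝ}

/-- The Poincaré inequality for functions vanishing at the vertices of all cells of a given level. -/
theorem ACOnArcs.totalInt_massDens_le_of_word {s : ℝ} (hs : 0 < s) (n : ℕ) :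
    ∀ {D : Triple}, D.Kissing → (∀ j, s ≤ (D j).curv) → D.ACOnArcs f →
    (∀ w : List (Fin 3), w.length = n → ∀ j, f ((D.word w).q j) = 0) →
      totalInt (massDens f) D ≤ ENNReal.ofReal (40 / (D.kappa + 2 * n * s) ^ 2) * totalInt (energyDens f) D := by
  induction n with
  | zero =>
    intro D h _ hf hq
    simpa using hf.totalInt_massDens_le h (hq [] rfl)
  | succ n ih =>
    intro D h hsD hf hq
    rw [h.totalInt_step, h.totalInt_step (energyDens f), Finset.mul_sum]
    refine Finset.sum_le_sum fun k _ => ?_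
    refine (ih (h.step k) (h.le_curv_step hsD k) (hf.step h k) fun w hw j =>
      hq (k :: w) (by simp [hw]) j).trans (mul_le_mul_left (ENNReal.ofReal_le_ofReal ?_) _)
    have hk := D.kappa_pos
    have := h.kappa_step k
    have s1 := hsD (k + 1)
    have s2 := hsD (k + 2)
    have hn : (0 : ℝ) ≤ n * s := by positivity
    refine div_le_div_of_nonneg_left (by norm_num) (by positivity)
      (pow_le_pow_left₀ (by positivity) ?_ 2)
    push_cast
    nlinarith

namespace Kissing

/-- If the last letter is i, the vertex `i` is inherited from the parent cell, while the other two
lie on the side `i`, which is an arc of an inscribed circle. -/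
theorem q_word_mem_arcUnion (h : D.Kissing) (w : List (Fin 3)) (j : Fin 3) : (D.word w).q j ∈ D.arcUnion := by
  induction w using List.reverseRecOn generalizing j with
  | nil => exact h.q_mem_arcUnion j
  | append_singleton w i ih =>
    have e : D.word (w ++ [i]) = (D.word w).step i := by simp [Triple.word]
    rw [e]
    have hw := h.word w
    have key : ∀ {x}, x ∈ ((D.word w).step i).arc (Sum.inl i) → x ∈ D.arcUnion := fun {x} hx => by
      have h1 : x ∈ ((D.word w).step i i).boundary := hx.2
      rw [step_self] at h1
      exact Set.mem_iUnion.2 ⟨Sum.inr w, h1⟩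
    obtain ⟨k, rfl⟩ : ∃ k : Fin 3, i + k = j := ⟨j - i, add_sub_cancel i j⟩
    fin_cases k
    · simp only [Fin.zero_eta, add_zero]
      rw [q_step _ hw]; exact ih i
    · exact key ((hw.step i).q_mem_arc_snd i)
    · exact key ((hw.step i).q_mem_arc_fst i)

/-- The function f is split into r, its soft threshold, and f - r, bounded by η. As r vanishes at
the vertices of level n, the Poincaré inequality on small cells applies, with 40 ≤ 7². -/
theorem norm_toL2_le_of_word (h : D.Kissing) {s : ℝ} (hs : 0 < s) (hsD : ∀ j, s ≤ (D j).curv) (n : ℕ)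
    (f : h.energySpace) {η : ℝ} (hη : 0 ≤ η)
    (hf : ∀ w : List (Fin 3), w.length = n → ∀ j, |(f : ℂ → ℝ) ((D.word w).q j)| ≤ η) :
    ‖h.toL2 f‖ ≤ 7 / (D.kappa + 2 * n * s) * ‖h.gradL2 f‖ + Real.sqrt (D.gasketMeasure.real Set.univ) * η := by
  have := h.isFiniteMeasure_gasketMeasure
  have hk := D.kappa_pos
  obtain ⟨r, hr, hrE⟩ := h.clamp_mem f (lipschitzWith_one_sub_clamp hη)
    (by rw [min_eq_left hη, max_eq_left (by linarith), sub_zero])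
  have h1 : ‖h.toL2 r‖ ≤ 7 / (D.kappa + 2 * n * s) * ‖h.gradL2 f‖ := by
    have e1 : ‖h.toL2 r‖ₑ ^ 2 ≤ ENNReal.ofReal (40 / (D.kappa + 2 * n * s) ^ 2) * ‖h.gradL2 r‖ₑ ^ 2 := by
      rw [h.enorm_toL2_sq, h.enorm_gradL2_sq]
      refine r.2.1.totalInt_massDens_le_of_word hs n h hsD fun w hw j => ?_
      have := abs_le.1 (hf w hw j)
      rw [hr, min_eq_left this.2, max_eq_left this.1, sub_self]
    have e2 : ‖h.toL2 r‖ ^ 2 ≤ 40 / (D.kappa + 2 * n * s) ^ 2 * ‖h.gradL2 r‖ ^ 2 := by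
      rw [← ENNReal.ofReal_le_ofReal_iff (by positivity), ENNReal.ofReal_mul (by positivity),
        ENNReal.ofReal_pow (norm_nonneg _), ENNReal.ofReal_pow (norm_nonneg _), ofReal_norm, ofReal_norm]
      exact e1
    refine (sq_le_sq₀ (norm_nonneg _) (by positivity)).1 (e2.trans ?_)
    rw [mul_pow, div_pow]
    gcongr
    norm_num
  have h2 : ‖h.toL2 (f - r)‖ ≤ Real.sqrt (D.gasketMeasure.real Set.univ) * η := by
    have e1 : ∀ᵐ x ∂D.gasketMeasure, ‖h.toL2 (f - r) x‖ ≤ η := by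
      filter_upwards [h.coeFn_toL2 (f - r)] with x hx
      rw [hx, Submodule.coe_sub, Pi.sub_apply, hr, sub_sub_cancel, Real.norm_eq_abs, abs_le]
      exact ⟨le_max_right _ _, max_le (min_le_right _ _) (by linarith)⟩
    refine (Lp.norm_le_of_ae_bound hη e1).trans (le_of_eq ?_)
    rw [Real.sqrt_eq_rpow, ENNReal.toReal_ofNat, one_div]
    rfl
  have h3 := norm_add_le (h.toL2 r) (h.toL2 (f - r))
  rw [← map_add, add_sub_cancel] at h3
  linarith

/-- The finite-dimensional data are the values at the vertices of level n. They are bounded on the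
unit ball since evaluations are, and by `norm_toL2_le_of_word` they determine a function up to a
small L² error once n is large. The 14 is 7 · 2, as a difference of two elements of the unit ball
has gradient norm at most 2. -/
theorem hasCompactInclusion (h : D.Kissing) : h.dirichletForm.HasCompactInclusion := by
  have := h.isFiniteMeasure_gasketMeasure
  obtain ⟨s, hs, hsD⟩ := exists_pos_le_curv D
  have hk := D.kappa_pos
  set B : Set h.energySpace := {f | ‖h.gradL2 f‖ ^ 2 + ‖h.toL2 f‖ ^ 2 ≤ 1}
  have hB : ∀ f ∈ B, ‖h.gradL2 f‖ ≤ 1 ∧ ‖h.toL2 f‖ ≤ 1 := fun f hf => by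
    have hf' : ‖h.gradL2 f‖ ^ 2 + ‖h.toL2 f‖ ^ 2 ≤ 1 := hf
    constructor <;> refine (sq_le_sq₀ (norm_nonneg _) zero_le_one).1 ?_ <;>
      nlinarith [sq_nonneg ‖h.gradL2 f‖, sq_nonneg ‖h.toL2 f‖]
  have himg : (fun f : h.dirichletForm.domain => (f : Lp ℝ 2 D.gasketMeasure)) '' {f | h.dirichletForm.energyOne f ≤ 1} =
      h.toL2 '' B := by
    ext x
    constructor
    · rintro ⟨f, hf, rfl⟩
      obtain ⟨F, rfl⟩ := h.equivDomain.surjective f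
      rw [Set.mem_ofPred_eq, energyOne_equivDomain] at hf
      exact ⟨F, hf, rfl⟩
    · rintro ⟨F, hF, rfl⟩
      exact ⟨h.equivDomain F, by rw [Set.mem_ofPred_eq, energyOne_equivDomain]; exact hF, rfl⟩
  rw [L2Form.HasCompactInclusion, himg]
  refine TotallyBounded.isCompact_of_isClosed (TotallyBounded.closure ?_) isClosed_closure
  refine totallyBounded_image_of_finite_approx _ _ fun ε hε => ?_
  have hlim : Tendsto (fun n : ℕ => 14 / (D.kappa + 2 * n * s)) atTop (𝓝 0) :=
    Tendsto.div_atTop tendsto_const_nhds (tendsto_atTop_add_const_left _ _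
      ((tendsto_natCast_atTop_atTop.const_mul_atTop two_pos).atTop_mul_const hs))
  obtain ⟨n, hn⟩ := (hlim.eventually (gt_mem_nhds (half_pos hε))).exists
  set M := Real.sqrt (D.gasketMeasure.real Set.univ) with hM
  have hM0 : 0 ≤ M := Real.sqrt_nonneg _
  refine ⟨List.Vector (Fin 3) n × Fin 3, inferInstance, fun f p => (f : ℂ → ℝ) ((D.word p.1.1).q p.2),
    ε / (2 * (M + 1)), by positivity, ?_, fun x hx y hy hxy => ?_⟩
  · choose C hC using fun p : List.Vector (Fin 3) n × Fin 3 =>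
      h.exists_abs_apply_le (h.q_word_mem_arcUnion p.1.1 p.2)
    refine (Bornology.IsBounded.pi fun p => Metric.isBounded_closedBall (x := (0 : ℝ)) (r := |C p| * 2)).subset ?_
    rintro _ ⟨f, hf, rfl⟩ p -
    rw [mem_closedBall_zero_iff, Real.norm_eq_abs]
    obtain ⟨h1, h2⟩ := hB f hf
    refine (hC p f).trans ((mul_le_mul_of_nonneg_right (le_abs_self _) (by positivity)).trans ?_)
    gcongr
    linarith
  · have e1 := h.norm_toL2_le_of_word hs hsD n (x - y) (η := ε / (2 * (M + 1))) (by positivity) fun w hw j => by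
      have := (dist_pi_lt_iff (by positivity)).1 hxy (⟨w, hw⟩, j)
      exact this.le
    rw [← hM] at e1
    rw [dist_eq_norm, ← map_sub]
    refine e1.trans_lt ?_
    have e2 : ‖h.gradL2 (x - y)‖ ≤ 2 := by
      rw [map_sub]
      exact (norm_sub_le _ _).trans (by linarith [(hB x hx).1, (hB y hy).1])
    have e3 : 7 / (D.kappa + 2 * n * s) * ‖h.gradL2 (x - y)‖ ≤ 14 / (D.kappa + 2 * n * s) := by
      calc _ ≤ 7 / (D.kappa + 2 * n * s) * 2 := by gcongr
        _ = _ := by ring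
    have e4 : M * (ε / (2 * (M + 1))) ≤ ε / 2 := by
      rw [← mul_div_assoc, div_le_div_iff₀ (by positivity) two_pos]
      nlinarith
    linarith

end Kissing

end Triple

end Apollonian

end

theorem mainTheorem5 (D : Apollonian.Triple) (hD : D.IsTangential) :
    (CompactSpace D.gasket ∧ IsFiniteMeasure D.gasketMeasure ∧
      D.gasketMeasure.IsOpenPosMeasure) ∧
    (∃ 𝓔 : L2Form D.gasketMeasure, D.IsEnergyForm 𝓔 ∧
      𝓔.IsSymmetricDirichletForm ∧ 𝓔.IsRegular ∧ 𝓔.IsStronglyLocal ∧ 𝓔.IsIrreducible ∧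
      𝓔.IsCore D.lipschitzFunctions ∧ 𝓔.HasCompactInclusion) ∧
    (∀ u ∈ D.sobolevSpace, (∀ x : D.arcUnion, (x : ℂ) ∈ D.V0 → u x = 0) →
      ∫ x, D.onGasket u x ^ 2 ∂D.gasketMeasure ≤ 40 / D.kappa ^ 2 * D.energy u u) := by
  have h := Apollonian.Triple.isTangential_iff.1 hD
  exact ⟨⟨h.compactSpace_gasket, h.isFiniteMeasure_gasketMeasure, h.isOpenPosMeasure⟩,
    ⟨h.dirichletForm, h.isEnergyForm, h.isSymmetricDirichletForm, h.isRegular_dirichletForm,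
      h.dirichletForm_stronglyLocal, h.dirichletForm_irreducible, h.isCore_lipschitzFunctions,
      h.hasCompactInclusion⟩,
    fun _ hu hq => h.integral_sq_le hu hq⟩
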